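/- Let $m$ sensors (nodes) $1,\dots,m$ be given, let $\mathcal G_{net}$ be a strongly connected digraph on them (the possible links), and let $b_{ij}>0$ be the cost of each possible link $i\to j$. The networking cost problem $\mathcal P2$ is to minimize $\sum_{i,j} b_{ij}\mathcal W_{ij}$ over all matrices $\mathcal W\in\{0,1\}^{m\times m}$ whose digraph $\mathcal G_W$ (with an arc $i\to j$ when $\mathcal W_{ij}=1$) is a strongly connected subdigraph of $\mathcal G_{net}$. For a root node $r$, a spanning out-branching of $\mathcal G_{net}$ is a spanning subdigraph in which no arc enters $r$, exactly one arc enters each other node, and every node is reachable from $r$; an in-branching is the same notion with all arcs reversed. A branching is of minimum cost if its sum of arc costs is least possible. Edmonds' algorithm for out-branchings chooses a cheapest entering arc for each node other than the root; if the chosen arcs contain no cycle they are the output, and otherwise a cycle of chosen arcs is contracted, the cost of each arc with head on the cycle is lowered by the cost of the chosen arc into its head, the algorithm is run on the contracted digraph, and the result is expanded by all arcs of the cycle but the one with the same head as the arc by which the result enters the cycle. For in-branchings it is run on the reversed digraph. Then: 1. $\mathcal P2$ has an optimal solution and is the Minimum Spanning Strong Subdigraph problem: a $0$-$1$ matrix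 $\mathcal W$ is optimal for $\mathcal P2$ if and only if $\mathcal G_W$ is a strongly connected spanning subdigraph of $\mathcal G_{net}$ of minimum total arc cost; every such minimum subdigraph arises from its $0$-$1$ matrix, and the costs agree. 2. For every root $r$, every output of Edmonds' algorithm is a minimum-cost in-branching (respectively out-branching) with root $r$; and the union of any minimum-cost in-branching and any minimum-cost out-branching with root $r$ is feasible for $\mathcal P2$ and costs at most $2\mathcal L$, where $\mathcal L$ is the minimum of $\mathcal P2$. 3. There are one program of a unit-cost real random access machine (natural and real variables and two-index arrays, addition, subtraction, comparison) and one constant $K$ such that for all $m$, $\mathcal G_{net}$, $b$ and $r$ as above the program, given $m$, $r$, the adjacency matrix and the cost matrix, halts after at most $K m^2$ steps with the adjacency matrices of an in-branching and an out-branching with root $r$, both outputs of Edmonds' algorithm, and of their union. 4. The gap of the method is $1$: the least upper bound of $(\mathcal F-\mathcal L)/\mathcal L$ over all such instances with $m\ge 2$, all roots, and all outcomes of the method is $1$, where $\mathcal F$ is the cost of the union of the in-branching and out-branching output by Edmonds' algorithm. -/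

import Mathlib

namespace SensorNet

/-! ### Digraphs, strong connectivity, cost -/

section Graphs

variable {V : Type*}

/-- Every node is joined to every node by a directed path. -/
def StronglyConnected (G : Digraph V) : Prop :=
  ∀ u v : V, Relation.ReflTransGen G.Adj u v

/-- The digraph with all arcs turned round. -/
def reverse (G : Digraph V) : Digraph V where
  Adj u v := G.Adj v u

open Classical in
/-- Total cost of the arcs of `H`, where `b u v` is the cost of the arc `u → v`. -/
noncomputable def cost [Fintype V] (b : V → V → ℝ) (H : Digraph V) : ℝ :=
  ∑ u, ∑ v, if H.Adj u v then b u v else 0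

/-! ### The minimum spanning strong subdigraph problem -/

/-- `H` is a strongly connected subdigraph of `G` on all nodes of `G`. -/
def IsSpanningStrong (G H : Digraph V) : Prop :=
  H ≤ G ∧ StronglyConnected H

/-- `H` solves the minimum spanning strong subdigraph problem for `G` and `b`. -/
def IsMinSpanningStrong [Fintype V] (G : Digraph V) (b : V → V → ℝ) (H : Digraph V) : Prop :=
  IsSpanningStrong G H ∧ ∀ K, IsSpanningStrong G K → cost b H ≤ cost b K

/-! ### Branchings -/

/-- Spanning out-branching of `G` with root `r`: no arc enters `r`, exactly one arc enters every
other node, and every node is reached from `r`. -/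
structure IsOutBranching (G : Digraph V) (r : V) (B : Digraph V) : Prop where
  sub : B ≤ G
  root : ∀ u, ¬ B.Adj u r
  unique : ∀ v, v ≠ r → ∃! u, B.Adj u v
  reach : ∀ v, Relation.ReflTransGen B.Adj r v

/-- Spanning in-branching of `G` with root `r`: no arc leaves `r`, exactly one arc leaves every
other node, and every node reaches `r`. -/
structure IsInBranching (G : Digraph V) (r : V) (B : Digraph V) : Prop where
  sub : B ≤ G
  root : ∀ u, ¬ B.Adj r u
  unique : ∀ v, v ≠ r → ∃! u, B.Adj v u
  reach : ∀ v, Relation.ReflTransGen B.Adj v r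

/-- Out-branching of minimum total cost. -/
def IsMinOutBranching [Fintype V] (G : Digraph V) (b : V → V → ℝ) (r : V) (B : Digraph V) : Prop :=
  IsOutBranching G r B ∧ ∀ B', IsOutBranching G r B' → cost b B ≤ cost b B'

/-- In-branching of minimum total cost. -/
def IsMinInBranching [Fintype V] (G : Digraph V) (b : V → V → ℝ) (r : V) (B : Digraph V) : Prop :=
  IsInBranching G r B ∧ ∀ B', IsInBranching G r B' → cost b B ≤ cost b B'

/-! ### Edmonds' algorithm

A contracted digraph is given by a map `π : V → V` sending each node to the name of the supernode
that contains it, together with the current costs `c` of the original arcs. -/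

/-- The arc `a` of `G` enters the supernode `x` from another supernode. -/
def Enters (G : Digraph V) (π : V → V) (x : V) (a : V × V) : Prop :=
  G.Adj a.1 a.2 ∧ π a.2 = x ∧ π a.1 ≠ x

/-- The arc `a` is a cheapest arc among those that enter the supernode `x`. -/
def CheapestEntering (G : Digraph V) (π : V → V) (c : V → V → ℝ) (x : V) (a : V × V) : Prop :=
  Enters G π x a ∧ ∀ a', Enters G π x a' → c a.1 a.2 ≤ c a'.1 a'.2

/-- The supernode from which the arc chosen for the supernode `x` comes. -/
def pred (π : V → V) (f : V → V × V) (x : V) : V := π (f x).1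

open Classical in
/-- `EdmondsRun G r π c B`: started on the contracted digraph `(π, c)`, the procedure can output
the arc set `B`. At each stage a cheapest entering arc `f x` is chosen for supernodes `x` other than
that of the root. If the chosen arcs lead from the root to every supernode, they are the output.
Otherwise a cycle of chosen arcs with set of supernodes `C` is contracted to one supernode `z`, each
arc with head in `C` is made cheaper by the cost of the chosen arc into the supernode of its head,
the procedure is run on the result, and its output is expanded by all arcs of the cycle except the
one whose head lies in the supernode at which the output enters the cycle. -/
inductive EdmondsRun (G : Digraph V) (r : V) :
    (V → V) → (V → V → ℝ) → Digraph V → Prop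
  | base (π : V → V) (c : V → V → ℝ) (f : V → V × V) (B : Digraph V)
      (cheapest : ∀ x ∈ Set.range π, x ≠ π r → CheapestEntering G π c x (f x))
      (acyclic : ∀ x ∈ Set.range π, ∃ k : ℕ, (pred π f)^[k] x = π r)
      (output : ∀ u v, B.Adj u v ↔ ∃ x ∈ Set.range π, x ≠ π r ∧ f x = (u, v)) :
      EdmondsRun G r π c B
  | contract (π : V → V) (c : V → V → ℝ) (f : V → V × V) (C : Set V) (z : V)
      (B' B : Digraph V) (a : V × V)
      (cheapest : ∀ x ∈ C, x ≠ π r ∧ CheapestEntering G π c x (f x))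
      (cycle : ∀ x ∈ C, ∀ y, y ∈ C ↔ ∃ k : ℕ, (pred π f)^[k] x = y)
      (name : z ∈ C)
      (rest : EdmondsRun G r (fun v => if π v ∈ C then z else π v)
        (fun u v => if π v ∈ C then c u v - c (f (π v)).1 (f (π v)).2 else c u v) B')
      (entry : B'.Adj a.1 a.2 ∧ π a.2 ∈ C ∧ π a.1 ∉ C)
      (output : ∀ u v, B.Adj u v ↔
        B'.Adj u v ∨ ∃ x ∈ C, x ≠ π a.2 ∧ f x = (u, v)) :
      EdmondsRun G r π c B

/-- `B` is a possible output of Edmonds' algorithm for out-branchings of `G` with root `r`. -/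
def EdmondsOut (G : Digraph V) (b : V → V → ℝ) (r : V) (B : Digraph V) : Prop :=
  EdmondsRun G r id b B

/-- `B` is a possible output of Edmonds' algorithm for in-branchings: the algorithm is run on the
reversed digraph. -/
def EdmondsIn (G : Digraph V) (b : V → V → ℝ) (r : V) (B : Digraph V) : Prop :=
  EdmondsOut (reverse G) (fun u v => b v u) r (reverse B)

end Graphs

/-! ### The networking cost problem -/

section Networking

variable {m : ℕ}

/-- The digraph of a link matrix: `i → j` is an arc when the entry `(i, j)` is not zero. -/
def linkDigraph (W : Matrix (Fin m) (Fin m) ℝ) : Digraph (Fin m) where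
  Adj i j := W i j ≠ 0

/-- The networking cost of a link matrix. -/
def networkingCost (b W : Matrix (Fin m) (Fin m) ℝ) : ℝ :=
  ∑ i, ∑ j, b i j * W i j

/-- The constraints: `W` is a `0`-`1` matrix, its digraph lies in the network of possible links,
and its digraph is strongly connected. -/
def IsFeasible (G : Digraph (Fin m)) (W : Matrix (Fin m) (Fin m) ℝ) : Prop :=
  (∀ i j, W i j = 0 ∨ W i j = 1) ∧ linkDigraph W ≤ G ∧ StronglyConnected (linkDigraph W)

/-- `W` solves the networking cost problem. -/
def IsOptimal (G : Digraph (Fin m)) (b W : Matrix (Fin m) (Fin m) ℝ) : Prop :=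
  IsFeasible G W ∧ ∀ W', IsFeasible G W' → networkingCost b W ≤ networkingCost b W'

open Classical in
/-- The `0`-`1` link matrix of a digraph. -/
noncomputable def linkMatrix (H : Digraph (Fin m)) : Matrix (Fin m) (Fin m) ℝ :=
  fun i j => if H.Adj i j then 1 else 0

end Networking

/-! ### A unit-cost real random access machine

Programs are structured programs over natural and real variables and over arrays of natural and of
real numbers with two indices; names of variables and arrays are natural numbers. Arithmetic consists
of addition and subtraction (truncated on the natural numbers). A step is counted for every command
executed, for every test made and for every node of every expression evaluated. -/

/-- The memory. -/
structure Memory where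
  natVar : ℕ → ℕ
  natArr : ℕ → ℕ → ℕ → ℕ
  realVar : ℕ → ℝ
  realArr : ℕ → ℕ → ℕ → ℝ

/-- Expressions for natural numbers; `get A i j` reads the entry `(i, j)` of the array `A`. -/
inductive NatExpr where
  | const (n : ℕ)
  | var (x : ℕ)
  | get (A : ℕ) (i j : NatExpr)
  | add (e₁ e₂ : NatExpr)
  | sub (e₁ e₂ : NatExpr)

/-- Expressions for real numbers. -/
inductive RealExpr where
  | var (x : ℕ)
  | get (A : ℕ) (i j : NatExpr)
  | add (e₁ e₂ : RealExpr)
  | sub (e₁ e₂ : RealExpr)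

/-- Tests. -/
inductive Test where
  | natLe (e₁ e₂ : NatExpr)
  | realLe (e₁ e₂ : RealExpr)
  | not (t : Test)
  | and (t₁ t₂ : Test)

/-- Programs. -/
inductive Program where
  | skip
  | setNat (x : ℕ) (e : NatExpr)
  | putNat (A : ℕ) (i j e : NatExpr)
  | setReal (x : ℕ) (e : RealExpr)
  | putReal (A : ℕ) (i j : NatExpr) (e : RealExpr)
  | seq (p q : Program)
  | ite (t : Test) (p q : Program)
  | while (t : Test) (p : Program)

/-- Value of an expression. -/
def NatExpr.eval (s : Memory) : NatExpr → ℕ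
  | const n => n
  | var x => s.natVar x
  | get A i j => s.natArr A (i.eval s) (j.eval s)
  | add e₁ e₂ => e₁.eval s + e₂.eval s
  | sub e₁ e₂ => e₁.eval s - e₂.eval s

/-- Number of steps needed to evaluate an expression. -/
def NatExpr.steps : NatExpr → ℕ
  | const _ => 1
  | var _ => 1
  | get _ i j => 1 + i.steps + j.steps
  | add e₁ e₂ => 1 + e₁.steps + e₂.steps
  | sub e₁ e₂ => 1 + e₁.steps + e₂.steps

/-- Value of an expression. -/
def RealExpr.eval (s : Memory) : RealExpr → ℝ
  | var x => s.realVar x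
  | get A i j => s.realArr A (i.eval s) (j.eval s)
  | add e₁ e₂ => e₁.eval s + e₂.eval s
  | sub e₁ e₂ => e₁.eval s - e₂.eval s

/-- Number of steps needed to evaluate an expression. -/
def RealExpr.steps : RealExpr → ℕ
  | var _ => 1
  | get _ i j => 1 + i.steps + j.steps
  | add e₁ e₂ => 1 + e₁.steps + e₂.steps
  | sub e₁ e₂ => 1 + e₁.steps + e₂.steps

/-- Truth of a test. -/
def Test.holds (s : Memory) : Test → Prop
  | natLe e₁ e₂ => e₁.eval s ≤ e₂.eval s
  | realLe e₁ e₂ => e₁.eval s ≤ e₂.eval s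
  | not t => ¬ t.holds s
  | and t₁ t₂ => t₁.holds s ∧ t₂.holds s

/-- Number of steps needed for a test. -/
def Test.steps : Test → ℕ
  | natLe e₁ e₂ => 1 + e₁.steps + e₂.steps
  | realLe e₁ e₂ => 1 + e₁.steps + e₂.steps
  | not t => 1 + t.steps
  | and t₁ t₂ => 1 + t₁.steps + t₂.steps

/-- The array family `F` after `v` is stored in the entry `(i, j)` of the array `A`. -/
def store {α : Type*} (F : ℕ → ℕ → ℕ → α) (A i j : ℕ) (v : α) : ℕ → ℕ → ℕ → α :=
  fun A' i' j' => if A' = A ∧ i' = i ∧ j' = j then v else F A' i' j'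

/-- `Exec p s s' t`: the program `p`, started with memory `s`, halts after `t` steps with
memory `s'`. -/
inductive Exec : Program → Memory → Memory → ℕ → Prop
  | skip (s : Memory) : Exec .skip s s 1
  | setNat (s : Memory) (x : ℕ) (e : NatExpr) :
      Exec (.setNat x e) s
        { s with natVar := Function.update s.natVar x (e.eval s) } (1 + e.steps)
  | putNat (s : Memory) (A : ℕ) (i j e : NatExpr) :
      Exec (.putNat A i j e) s
        { s with natArr := store s.natArr A (i.eval s) (j.eval s) (e.eval s) }
        (1 + i.steps + j.steps + e.steps)
  | setReal (s : Memory) (x : ℕ) (e : RealExpr) :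
      Exec (.setReal x e) s
        { s with realVar := Function.update s.realVar x (e.eval s) } (1 + e.steps)
  | putReal (s : Memory) (A : ℕ) (i j : NatExpr) (e : RealExpr) :
      Exec (.putReal A i j e) s
        { s with realArr := store s.realArr A (i.eval s) (j.eval s) (e.eval s) }
        (1 + i.steps + j.steps + e.steps)
  | seq (p q : Program) (s s' s'' : Memory) (t t' : ℕ) :
      Exec p s s' t → Exec q s' s'' t' → Exec (.seq p q) s s'' (t + t')
  | iteTrue (b : Test) (p q : Program) (s s' : Memory) (t : ℕ) :
      b.holds s → Exec p s s' t → Exec (.ite b p q) s s' (1 + b.steps + t)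
  | iteFalse (b : Test) (p q : Program) (s s' : Memory) (t : ℕ) :
      ¬ b.holds s → Exec q s s' t → Exec (.ite b p q) s s' (1 + b.steps + t)
  | whileTrue (b : Test) (p : Program) (s s' s'' : Memory) (t t' : ℕ) :
      b.holds s → Exec p s s' t → Exec (.while b p) s' s'' t' →
      Exec (.while b p) s s'' (1 + b.steps + t + t')
  | whileFalse (b : Test) (p : Program) (s : Memory) :
      ¬ b.holds s → Exec (.while b p) s s (1 + b.steps)

open Classical in
/-- The initial memory: the natural variables `0` and `1` hold the number of nodes and the root, the
natural array `0` holds the adjacency matrix of the network, the real array `0` holds the cost matrix,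
and everything else is zero. -/
noncomputable def inputMemory {m : ℕ} (G : Digraph (Fin m)) (b : Matrix (Fin m) (Fin m) ℝ)
    (r : Fin m) : Memory where
  natVar x := if x = 0 then m else if x = 1 then (r : ℕ) else 0
  natArr A i j := if A = 0 ∧ ∃ (hi : i < m) (hj : j < m), G.Adj ⟨i, hi⟩ ⟨j, hj⟩ then 1 else 0
  realVar _ := 0
  realArr A i j := if h : A = 0 ∧ i < m ∧ j < m then b ⟨i, h.2.1⟩ ⟨j, h.2.2⟩ else 0

open Classical in
/-- The natural array `A` holds the adjacency matrix of the digraph `H`. -/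
def Holds {m : ℕ} (s : Memory) (A : ℕ) (H : Digraph (Fin m)) : Prop :=
  ∀ i j : Fin m, s.natArr A i j = if H.Adj i j then 1 else 0

/-! ### The gap -/

/-- The relative gaps `(F - L) / L` over all instances with at least two nodes: `F` is the cost of an
outcome of the method (union of an in-branching and an out-branching, both computed by Edmonds'
algorithm, for some root) and `L` is the minimum networking cost. -/
def gaps : Set ℝ :=
  { g | ∃ (m : ℕ) (G : Digraph (Fin m)) (b : Matrix (Fin m) (Fin m) ℝ) (r : Fin m)
      (Bin Bout : Digraph (Fin m)) (W : Matrix (Fin m) (Fin m) ℝ),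
      2 ≤ m ∧ StronglyConnected G ∧ (∀ i j, G.Adj i j → 0 < b i j) ∧
      EdmondsIn G b r Bin ∧ EdmondsOut G b r Bout ∧ IsOptimal G b W ∧
      g = (networkingCost b (linkMatrix (Bin ⊔ Bout)) - networkingCost b W)
        / networkingCost b W }

end SensorNet

/-!
*The problem.* A `0`-`1` matrix and its digraph determine each other, which identifies the networking
cost problem with the minimum spanning strong subdigraph problem (`isOptimal_linkMatrix`). An optimum
exists because there are finitely many digraphs on the nodes.

*Optimality of Edmonds' algorithm* (`EdmondsRun.optimal`). By induction on a run, its output is at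
most as expensive as any set of arcs that connects the root to all supernodes, provided that costs
are nonnegative. If the chosen arcs reach everything, this holds because every connecting set has an
arc into each supernode other than that of the root. If a cycle is contracted, the expanded output
costs the output of the contracted run plus the cost of the cycle, while a connecting set loses at
least the cost of the cycle, having an arc into each supernode of it. Admitting all connecting sets,
not only branchings, as competitors makes the induction work: a connecting set stays connecting
when a cycle is contracted.

*The factor two.* A strongly connected spanning subdigraph contains an out-branching and an
in-branching with any given root, so a cheapest branching of either kind costs at most `L`
(`IsMinOutBranching.cost_le`, `IsMinInBranching.cost_le`), and the union costs at most `2 L`. The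
union of an in-branching and an out-branching is strongly connected through the root.

*The gap* (`isLUB_gaps`). By the factor two it is at most `1`. In the complete digraph on `n + 2`
nodes with unit costs the algorithm may output the two stars at the root, of cost `2 (n + 1)`
together, while a Hamiltonian cycle costs `n + 2`; the relative gap is at least `n / (n + 2)`.

*The quadratic time bound.* The program grows a path of supernodes backwards: the front of the path
chooses a cheapest entering arc. If its tail is unvisited, the path is extended; if it lies on the
path, the cycle of chosen arcs is contracted (`OnPath.contract`); if it lies in the finished part,
the whole path is finished and a new one is started. Three observations keep the time quadratic.
The reduction of the cost of an arc depends on its head only, so one number for each node describes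
the current costs (`contractCost_reducedCost`). For each supernode `x` and each tail `u` the head of
a cheapest arc from `u` into `x` is kept; a choice is then a scan of one row, and a contraction of
`l` supernodes is a merger of `l` rows, possible because all arcs into one supernode are reduced by
the same amount. Finally, the potential "unvisited nodes plus three times the number of supernodes"
drops by an amount proportional to `1` in the first and third case and to `l` in the second
(`SearchInv.step`), so the time `O(m l)` of all rounds adds up to `O(m ^ 2)`. The labels, reductions,
chosen arcs and cycles of all stages are recorded, and the cycles are expanded in reverse order
(`IsOutput.expand`). A cycle found in this way is a legitimate choice of Edmonds' algorithm, which
may contract any cycle of cheapest entering arcs, so the result is one of its outputs.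

Time bounds for the program are proved with the predicate `Runs`; that a piece of program leaves the
rest of the memory alone follows from the lists of variables and arrays that it may change
(`Exec.frame`). All numerical constants in the time bounds are generous.
-/

namespace SensorNet

/-! ### The networking cost problem as a minimum spanning strong subdigraph problem -/

section Networking

variable {m : ℕ}

theorem networkingCost_linkMatrix (b : Matrix (Fin m) (Fin m) ℝ) (H : Digraph (Fin m)) :
    networkingCost b (linkMatrix H) = cost b H := by
  simp [networkingCost, cost, linkMatrix]

theorem linkDigraph_linkMatrix (H : Digraph (Fin m)) : linkDigraph (linkMatrix H) = H := by
  ext i j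
  simp [linkDigraph, linkMatrix]

theorem linkMatrix_linkDigraph {W : Matrix (Fin m) (Fin m) ℝ}
    (hW : ∀ i j, W i j = 0 ∨ W i j = 1) : linkMatrix (linkDigraph W) = W := by
  ext i j
  rcases hW i j with h | h <;> simp [linkDigraph, linkMatrix, h]

theorem isFeasible_linkMatrix {G H : Digraph (Fin m)} :
    IsFeasible G (linkMatrix H) ↔ IsSpanningStrong G H := by
  rw [IsFeasible, linkDigraph_linkMatrix]
  refine ⟨fun h => h.2, fun h => ⟨fun i j => ?_, h⟩⟩
  by_cases hH : H.Adj i j <;> simp [linkMatrix, hH]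

theorem isOptimal_linkMatrix {G H : Digraph (Fin m)} {b : Matrix (Fin m) (Fin m) ℝ} :
    IsOptimal G b (linkMatrix H) ↔ IsMinSpanningStrong G b H := by
  unfold IsOptimal IsMinSpanningStrong
  rw [isFeasible_linkMatrix]
  refine and_congr_right fun _ => ⟨fun h K hK => ?_, fun h W hW => ?_⟩
  · simpa only [networkingCost_linkMatrix] using h _ (isFeasible_linkMatrix.2 hK)
  · rw [← linkMatrix_linkDigraph hW.1, networkingCost_linkMatrix, networkingCost_linkMatrix]
    exact h _ hW.2

theorem isOptimal_iff {G : Digraph (Fin m)} {b W : Matrix (Fin m) (Fin m) ℝ} :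
    IsOptimal G b W ↔
      (∀ i j, W i j = 0 ∨ W i j = 1) ∧ IsMinSpanningStrong G b (linkDigraph W) := by
  constructor
  · intro h
    refine ⟨h.1.1, isOptimal_linkMatrix.1 ?_⟩
    rwa [linkMatrix_linkDigraph h.1.1]
  · rintro ⟨h01, h⟩
    rw [← linkMatrix_linkDigraph h01]
    exact isOptimal_linkMatrix.2 h

theorem exists_isMinSpanningStrong {V : Type*} [Fintype V] {G : Digraph V} (b : V → V → ℝ)
    (hG : StronglyConnected G) : ∃ H, IsMinSpanningStrong G b H := by
  have : Finite (Digraph V) :=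
    Finite.of_injective (fun H : Digraph V => H.Adj) fun H K h => Digraph.ext h
  obtain ⟨H, hH, hmin⟩ := Set.exists_min_image {H | IsSpanningStrong G H} (cost b)
    (Set.toFinite _) ⟨G, le_rfl, hG⟩
  exact ⟨H, hH, hmin⟩

theorem exists_isOptimal {G : Digraph (Fin m)} (b : Matrix (Fin m) (Fin m) ℝ)
    (hG : StronglyConnected G) : ∃ W, IsOptimal G b W :=
  (exists_isMinSpanningStrong b hG).imp' linkMatrix fun _ h => isOptimal_linkMatrix.2 h

end Networking

/-! ### Reversal of arcs -/

section Reverse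

variable {V : Type*}

theorem isInBranching_iff {G B : Digraph V} {r : V} :
    IsInBranching G r B ↔ IsOutBranching (reverse G) r (reverse B) :=
  ⟨fun h => ⟨fun _ _ hb => h.sub hb, h.root, h.unique, fun v => (h.reach v).swap⟩,
    fun h => ⟨fun _ _ hb => h.sub hb, h.root, h.unique, fun v => (h.reach v).swap⟩⟩

theorem cost_reverse [Fintype V] (b : V → V → ℝ) (H : Digraph V) :
    cost (fun u v => b v u) (reverse H) = cost b H := by
  rw [cost, cost, Finset.sum_comm]
  rfl

theorem isMinInBranching_iff [Fintype V] {G B : Digraph V} {r : V} {b : V → V → ℝ} :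
    IsMinInBranching G b r B ↔
      IsMinOutBranching (reverse G) (fun u v => b v u) r (reverse B) := by
  rw [IsMinInBranching, IsMinOutBranching, isInBranching_iff]
  refine and_congr_right fun _ => ⟨fun h B' hB' => ?_, fun h B' hB' => ?_⟩
  · rw [cost_reverse]
    exact (h (reverse B') (isInBranching_iff.2 hB')).trans_eq (cost_reverse b (reverse B')).symm
  · rw [← cost_reverse b B, ← cost_reverse b B']
    exact h _ (isInBranching_iff.1 hB')

theorem StronglyConnected.reverse {G : Digraph V} (h : StronglyConnected G) :
    StronglyConnected (reverse G) := fun u v => (h v u).swap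

end Reverse

/-! ### Optimality of Edmonds' algorithm -/

section Optimality

variable {V : Type*}

/-- In the digraph of supernodes, every supernode is reached from that of `r` along arcs of `S`. -/
def Connects (r : V) (π : V → V) (S : Digraph V) : Prop :=
  ∀ v, Relation.ReflTransGen (fun x y => ∃ u w, S.Adj u w ∧ π u = x ∧ π w = y) (π r) (π v)

/-- A path from the root to another supernode enters that supernode at some arc. -/
theorem Connects.exists_entering {r : V} {π : V → V} {S : Digraph V} (h : Connects r π S) {v : V}
    (hv : π v ≠ π r) : ∃ u w, S.Adj u w ∧ π w = π v ∧ π u ≠ π v := by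
  have key : ∀ y,
      Relation.ReflTransGen (fun x y => ∃ u w, S.Adj u w ∧ π u = x ∧ π w = y) (π r) y →
        y = π v → ∃ u w, S.Adj u w ∧ π w = π v ∧ π u ≠ π v := by
    intro y hy
    induction hy with
    | refl => exact fun h => absurd h.symm hv
    | @tail x y _ hxy ih =>
      rintro rfl
      obtain ⟨u, w, huw, hu, hw⟩ := hxy
      by_cases hx : x = π v
      · exact ih hx
      · exact ⟨u, w, huw, hw, hu ▸ hx⟩
  exact key _ (h v) rfl

theorem Connects.comp {r : V} {π : V → V} {S : Digraph V} (h : Connects r π S) (g : V → V) :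
    Connects r (fun v => g (π v)) S := fun v =>
  (h v).lift g fun _ _ ⟨u, w, huw, hu, hw⟩ => ⟨u, w, huw, congrArg g hu, congrArg g hw⟩

theorem StronglyConnected.connects {G : Digraph V} (hG : StronglyConnected G) (r : V)
    (π : V → V) : Connects r π G := by
  have : Connects r id G := fun v => (hG r v).lift id fun u w h => ⟨u, w, h, rfl, rfl⟩
  exact this.comp π

/-- `B` is an out-branching of the digraph of supernodes of `π`. Its arcs are arcs of `G`, and parallel
arcs between two supernodes are told apart. -/
structure IsContractedBranching (G : Digraph V) (r : V) (π : V → V) (B : Digraph V) : Prop where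
  sub : B ≤ G
  noInner : ∀ u v, B.Adj u v → π u ≠ π v
  root : ∀ u v, B.Adj u v → π v ≠ π r
  unique : ∀ a a' : V × V, B.Adj a.1 a.2 → B.Adj a'.1 a'.2 → π a.2 = π a'.2 → a = a'
  connects : Connects r π B

open Classical in
/-- The arcs of `S` between different supernodes. -/
noncomputable def outerArcs [Fintype V] (π : V → V) (S : Digraph V) : Finset (V × V) :=
  Finset.univ.filter fun a => S.Adj a.1 a.2 ∧ π a.1 ≠ π a.2

theorem mem_outerArcs [Fintype V] {π : V → V} {S : Digraph V} {a : V × V} :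
    a ∈ outerArcs π S ↔ S.Adj a.1 a.2 ∧ π a.1 ≠ π a.2 := by
  simp [outerArcs]

/-- A set of arcs with an arc into each `x ∈ X` costs at least the sum of lower bounds `w x` for the
arcs into `x`. -/
theorem sum_le_sum_of_entering {V : Type*} {X : Finset V} {A : Finset (V × V)} {p : V × V → V}
    {w : V → ℝ} {c : V × V → ℝ} (hX : ∀ x ∈ X, ∃ a ∈ A, p a = x)
    (hw : ∀ a ∈ A, p a ∈ X → w (p a) ≤ c a) (hc : ∀ a ∈ A, 0 ≤ c a) :
    ∑ x ∈ X, w x ≤ ∑ a ∈ A, c a := by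
  classical
  choose! g hgA hg using hX
  have hinj : Set.InjOn g X := fun x hx y hy h => by rw [← hg x hx, ← hg y hy, h]
  calc ∑ x ∈ X, w x ≤ ∑ x ∈ X, c (g x) := Finset.sum_le_sum fun x hx => by
        have := hw (g x) (hgA x hx) (by rwa [hg x hx])
        rwa [hg x hx] at this
    _ = ∑ a ∈ X.image g, c a := (Finset.sum_image hinj).symm
    _ ≤ ∑ a ∈ A, c a := Finset.sum_le_sum_of_subset_of_nonneg
        (Finset.image_subset_iff.2 hgA) fun a ha _ => hc a ha

open Classical in
/-- The labels of the supernodes after the cycle `C` is contracted to one supernode named `z`. -/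
noncomputable def contractMap (π : V → V) (C : Set V) (z : V) : V → V :=
  fun v => if π v ∈ C then z else π v

open Classical in
/-- The arc costs after the cycle `C` of arcs chosen by `f` is contracted. -/
noncomputable def contractCost (π : V → V) (c : V → V → ℝ) (f : V → V × V) (C : Set V) :
    V → V → ℝ :=
  fun u v => if π v ∈ C then c u v - c (f (π v)).1 (f (π v)).2 else c u v

section Contraction

variable {G : Digraph V} {r : V} {π : V → V} {c : V → V → ℝ} {f : V → V × V} {C : Set V} {z : V}

theorem contractMap_eq_name_iff (hz : z ∈ C) {v : V} : contractMap π C z v = z ↔ π v ∈ C := by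
  unfold contractMap
  split_ifs with h
  · simp [h]
  · exact ⟨fun h' => absurd (h' ▸ hz) h, fun h' => absurd h' h⟩

theorem contractMap_of_notMem {v : V} (hv : π v ∉ C) : contractMap π C z v = π v := if_neg hv

theorem contractMap_congr {u v : V} (h : π u = π v) :
    contractMap π C z u = contractMap π C z v := by
  unfold contractMap
  rw [h]

theorem ne_of_contractMap_ne {u v : V} (h : contractMap π C z u ≠ contractMap π C z v) :
    π u ≠ π v := fun h' => h (contractMap_congr h')

theorem contractCost_nonneg (hC : ∀ x ∈ C, x ≠ π r ∧ CheapestEntering G π c x (f x))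
    (hc : ∀ u v, G.Adj u v → π u ≠ π v → 0 ≤ c u v) {u v : V} (huv : G.Adj u v)
    (hne : π u ≠ π v) : 0 ≤ contractCost π c f C u v := by
  unfold contractCost
  split_ifs with h
  · exact sub_nonneg.2 ((hC _ h).2.2 (u, v) ⟨huv, rfl, hne⟩)
  · exact hc u v huv hne

open Classical in
theorem sum_eq_sum_contractCost_add (A : Finset (V × V)) :
    ∑ a ∈ A, c a.1 a.2 = ∑ a ∈ A, contractCost π c f C a.1 a.2 +
      ∑ a ∈ A, if π a.2 ∈ C then c (f (π a.2)).1 (f (π a.2)).2 else 0 := by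
  rw [← Finset.sum_add_distrib]
  refine Finset.sum_congr rfl fun a _ => ?_
  unfold contractCost
  split_ifs <;> ring

/-- Expanding a branching of the contracted digraph gives a branching. -/
theorem IsContractedBranching.expand {B' B : Digraph V} {a : V × V}
    (hC : ∀ x ∈ C, x ≠ π r ∧ CheapestEntering G π c x (f x))
    (cycle : ∀ x ∈ C, ∀ y, y ∈ C ↔ ∃ k : ℕ, (pred π f)^[k] x = y) (hz : z ∈ C)
    (hB' : IsContractedBranching G r (contractMap π C z) B')
    (entry : B'.Adj a.1 a.2 ∧ π a.2 ∈ C ∧ π a.1 ∉ C)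
    (output : ∀ u v, B.Adj u v ↔ B'.Adj u v ∨ ∃ x ∈ C, x ≠ π a.2 ∧ f x = (u, v)) :
    IsContractedBranching G r π B := by
  have hr : π r ∉ C := fun h => (hC _ h).1 rfl
  have hle : ∀ u v, B'.Adj u v → B.Adj u v := fun u v h => (output u v).2 (Or.inl h)
  have hcase : ∀ u v, B.Adj u v → (B'.Adj u v ∨ π v ∈ C ∧ π v ≠ π a.2 ∧ f (π v) = (u, v)) := by
    intro u v h
    refine ((output u v).1 h).imp_right ?_
    rintro ⟨x, hx, hxa, hf⟩
    have := (hC x hx).2.1.2.1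
    rw [hf] at this
    subst this
    exact ⟨hx, hxa, hf⟩
  have honly : ∀ u v, B'.Adj u v → π v ∈ C → (u, v) = a := fun u v h hv =>
    hB'.unique (u, v) a h entry.1 (by
      rw [(contractMap_eq_name_iff hz).2 hv, (contractMap_eq_name_iff hz).2 entry.2.1])
  refine ⟨fun u v h => ?_, fun u v h => ?_, fun u v h => ?_, ?_, ?_⟩
  · rcases hcase u v h with h | ⟨hv, -, hf⟩
    · exact hB'.sub h
    · have := (hC _ hv).2.1.1
      rwa [hf] at this
  · rcases hcase u v h with h | ⟨hv, -, hf⟩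
    · exact ne_of_contractMap_ne (hB'.noInner u v h)
    · have := (hC _ hv).2.1.2.2
      rwa [hf] at this
  · rcases hcase u v h with h | ⟨hv, -, hf⟩
    · exact ne_of_contractMap_ne (hB'.root u v h)
    · exact (hC _ hv).1
  · rintro ⟨u, v⟩ ⟨u', v'⟩ h h' heq
    simp only at h h' heq
    rcases hcase u v h with h1 | ⟨hv, hne, hf⟩ <;> rcases hcase u' v' h' with h2 | ⟨hv', hne', hf'⟩
    · exact hB'.unique _ _ h1 h2 (contractMap_congr heq)
    · have := honly u v h1 (heq ▸ hv')
      rw [← this] at hne'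
      exact absurd heq.symm hne'
    · have := honly u' v' h2 (heq ▸ hv)
      rw [← this] at hne
      exact absurd heq hne
    · rw [← hf, ← hf', heq]
  · let R : V → V → Prop := fun x y => ∃ u w, B.Adj u w ∧ π u = x ∧ π w = y
    have hcyc : Relation.ReflTransGen R (π r) (π a.2) →
        ∀ x ∈ C, Relation.ReflTransGen R (π r) x := by
      intro hreach x hx
      obtain ⟨k, hk⟩ := (cycle x hx _).1 entry.2.1
      induction k generalizing x with
      | zero => simpa [← hk] using hreach
      | succ k ih =>
        by_cases hxa : x = π a.2
        · rwa [hxa]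
        · have hp : pred π f x ∈ C := (cycle x hx _).2 ⟨1, rfl⟩
          refine (ih _ hp (by simpa using hk)).tail ⟨(f x).1, (f x).2, ?_, rfl, ?_⟩
          · exact (output _ _).2 (Or.inr ⟨x, hx, hxa, rfl⟩)
          · exact (hC x hx).2.1.2.1
    have key : ∀ y, Relation.ReflTransGen (fun x y => ∃ u w, B'.Adj u w ∧
        contractMap π C z u = x ∧ contractMap π C z w = y) (contractMap π C z r) y →
        ∀ v, contractMap π C z v = y → Relation.ReflTransGen R (π r) (π v) := by
      intro y hy
      induction hy with
      | refl =>
        intro v hv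
        rw [contractMap_of_notMem hr] at hv
        have hvC : π v ∉ C := fun h => by
          rw [(contractMap_eq_name_iff hz).2 h] at hv
          exact hr (hv ▸ hz)
        rw [contractMap_of_notMem hvC] at hv
        rw [hv]
      | tail _ hxy ih =>
        rintro v hv
        obtain ⟨u, w, huw, hu, hw⟩ := hxy
        have hwr : Relation.ReflTransGen R (π r) (π w) :=
          (ih u hu).tail ⟨u, w, hle u w huw, rfl, rfl⟩
        by_cases hwC : π w ∈ C
        · have hvC : π v ∈ C := by
            rw [← contractMap_eq_name_iff (π := π) hz, hv, ← hw]
            exact (contractMap_eq_name_iff hz).2 hwC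
          have := honly u w huw hwC
          rw [← this] at hcyc
          exact hcyc hwr _ hvC
        · have hvC : π v ∉ C := by
            rw [← contractMap_eq_name_iff (π := π) hz, hv, ← hw]
            exact fun h => hwC ((contractMap_eq_name_iff hz).1 h)
          rw [contractMap_of_notMem hwC] at hw
          rw [contractMap_of_notMem hvC] at hv
          rwa [hv, ← hw]
    exact fun v => key _ (hB'.connects v) v rfl

/-- Expanding a cheapest branching of the contracted digraph gives a cheapest branching: the costs of
the two differ by the cost of the cycle, and an arbitrary connecting set of arcs loses at least that
much when the cycle is contracted, since it has an arc into each supernode of the cycle. -/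
theorem sum_outerArcs_expand_le [Fintype V] {B' B S : Digraph V} {a : V × V}
    (hC : ∀ x ∈ C, x ≠ π r ∧ CheapestEntering G π c x (f x)) (hz : z ∈ C)
    (hc : ∀ u v, G.Adj u v → π u ≠ π v → 0 ≤ c u v)
    (hB' : IsContractedBranching G r (contractMap π C z) B')
    (entry : B'.Adj a.1 a.2 ∧ π a.2 ∈ C ∧ π a.1 ∉ C)
    (output : ∀ u v, B.Adj u v ↔ B'.Adj u v ∨ ∃ x ∈ C, x ≠ π a.2 ∧ f x = (u, v))
    (hS : S ≤ G) (hSc : Connects r π S)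
    (hmin : ∑ a ∈ outerArcs (contractMap π C z) B', contractCost π c f C a.1 a.2 ≤
      ∑ a ∈ outerArcs (contractMap π C z) S, contractCost π c f C a.1 a.2) :
    ∑ a ∈ outerArcs π B, c a.1 a.2 ≤ ∑ a ∈ outerArcs π S, c a.1 a.2 := by
  classical
  set π' := contractMap π C z
  set c' := contractCost π c f C
  have hf0 : ∀ x ∈ C, 0 ≤ c (f x).1 (f x).2 := fun x hx => by
    obtain ⟨h1, h2, h3⟩ := (hC x hx).2.1
    exact hc _ _ h1 (h2.symm ▸ h3)
  have hinj : Set.InjOn f C := fun x hx y hy h => by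
    rw [← (hC x hx).2.1.2.1, ← (hC y hy).2.1.2.1, h]
  have upper : ∑ a ∈ outerArcs π B, c a.1 a.2 ≤
      ∑ a ∈ outerArcs π' B', c' a.1 a.2 + ∑ x ∈ C.toFinset, c (f x).1 (f x).2 := by
    have h1 : outerArcs π B ⊆ outerArcs π' B' ∪ (C.toFinset.erase (π a.2)).image f := by
      intro e he
      rw [mem_outerArcs, output] at he
      rcases he with ⟨h | ⟨x, hx, hxa, hf⟩, hne⟩
      · exact Finset.mem_union_left _ (mem_outerArcs.2 ⟨h, hB'.noInner _ _ h⟩)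
      · refine Finset.mem_union_right _ (Finset.mem_image.2 ⟨x, ?_, hf⟩)
        simp [hxa, hx]
    have h2 : ∑ e ∈ outerArcs π' B', (if π e.2 ∈ C then c (f (π e.2)).1 (f (π e.2)).2 else 0) =
        c (f (π a.2)).1 (f (π a.2)).2 := by
      rw [Finset.sum_eq_single a]
      · rw [if_pos entry.2.1]
      · intro e he hea
        refine if_neg fun heC => hea (hB'.unique e a (mem_outerArcs.1 he).1 entry.1 ?_)
        exact ((contractMap_eq_name_iff hz).2 heC).trans
          ((contractMap_eq_name_iff hz).2 entry.2.1).symm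
      · exact fun h => absurd (mem_outerArcs.2 ⟨entry.1, hB'.noInner _ _ entry.1⟩) h
    have h3 : ∑ e ∈ (C.toFinset.erase (π a.2)).image f, c e.1 e.2 =
        ∑ x ∈ C.toFinset.erase (π a.2), c (f x).1 (f x).2 :=
      Finset.sum_image fun x hx y hy => hinj
        (Set.mem_toFinset.1 (Finset.mem_of_mem_erase hx))
        (Set.mem_toFinset.1 (Finset.mem_of_mem_erase hy))
    have h4 := Finset.sum_erase_add C.toFinset (fun x => c (f x).1 (f x).2)
      (Set.mem_toFinset.2 entry.2.1)
    have h5 := sum_eq_sum_contractCost_add (π := π) (c := c) (f := f) (C := C) (outerArcs π' B')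
    have h6 : ∀ e ∈ outerArcs π' B' ∪ (C.toFinset.erase (π a.2)).image f, 0 ≤ c e.1 e.2 := by
      intro e he
      rcases Finset.mem_union.1 he with h | h
      · rw [mem_outerArcs] at h
        exact hc _ _ (hB'.sub h.1) (ne_of_contractMap_ne h.2)
      · obtain ⟨x, hx, rfl⟩ := Finset.mem_image.1 h
        exact hf0 x (Set.mem_toFinset.1 (Finset.mem_of_mem_erase hx))
    have h7 := Finset.sum_le_sum_of_subset_of_nonneg h1 fun e he _ => h6 e he
    have h8 := Finset.sum_union_inter (s₁ := outerArcs π' B')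
      (s₂ := (C.toFinset.erase (π a.2)).image f) (f := fun e => c e.1 e.2)
    have h9 : 0 ≤ ∑ e ∈ outerArcs π' B' ∩ (C.toFinset.erase (π a.2)).image f, c e.1 e.2 :=
      Finset.sum_nonneg fun e he => h6 e (Finset.mem_union_left _ (Finset.mem_inter.1 he).1)
    linarith
  have lower : ∑ a ∈ outerArcs π' S, c' a.1 a.2 + ∑ x ∈ C.toFinset, c (f x).1 (f x).2 ≤
      ∑ a ∈ outerArcs π S, c a.1 a.2 := by
    rw [sum_eq_sum_contractCost_add (π := π) (f := f) (C := C) (outerArcs π S)]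
    refine add_le_add (Finset.sum_le_sum_of_subset_of_nonneg ?_ ?_)
      (sum_le_sum_of_entering (p := fun e => π e.2) ?_ ?_ ?_)
    · intro e he
      rw [mem_outerArcs] at he ⊢
      exact ⟨he.1, ne_of_contractMap_ne he.2⟩
    · intro e he _
      rw [mem_outerArcs] at he
      exact contractCost_nonneg hC hc (hS he.1) he.2
    · intro x hx
      rw [Set.mem_toFinset] at hx
      obtain ⟨hxr, ⟨-, hx2, -⟩, -⟩ := hC x hx
      obtain ⟨u, w, h1, h2, h3⟩ := hSc.exists_entering (v := (f x).2) (hx2.symm ▸ hxr)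
      exact ⟨(u, w), mem_outerArcs.2 ⟨h1, h2.symm ▸ h3⟩, h2.trans hx2⟩
    · intro e _ heC
      rw [if_pos (Set.mem_toFinset.1 heC)]
    · intro e _
      split_ifs with h
      · exact hf0 _ h
      · exact le_rfl
  linarith

end Contraction

/-- Every output of Edmonds' algorithm is a branching of the digraph of supernodes, and no set of
arcs that connects the root to all supernodes is cheaper. -/
theorem EdmondsRun.optimal [Fintype V] {G : Digraph V} {r : V} {π : V → V} {c : V → V → ℝ}
    {B : Digraph V} (h : EdmondsRun G r π c B)
    (hc : ∀ u v, G.Adj u v → π u ≠ π v → 0 ≤ c u v) :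
    IsContractedBranching G r π B ∧ ∀ S ≤ G, Connects r π S →
      ∑ a ∈ outerArcs π B, c a.1 a.2 ≤ ∑ a ∈ outerArcs π S, c a.1 a.2 := by
  classical
  induction h with
  | base π c f B cheapest acyclic output =>
    have hcase : ∀ u v, B.Adj u v →
        π v ≠ π r ∧ f (π v) = (u, v) ∧ CheapestEntering G π c (π v) (u, v) := by
      intro u v h
      obtain ⟨x, hx, hxr, hf⟩ := (output u v).1 h
      have h1 := cheapest x hx hxr
      have h2 := h1.1.2.1
      rw [hf] at h1 h2
      subst h2
      exact ⟨hxr, hf, h1⟩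
    refine ⟨⟨fun u v h => (hcase u v h).2.2.1.1, fun u v h => (hcase u v h).2.2.1.2.2,
      fun u v h => (hcase u v h).1, ?_, ?_⟩, fun S hS hSc => ?_⟩
    · intro a a' ha ha' heq
      have h1 := (hcase _ _ ha).2.1
      have h2 := (hcase _ _ ha').2.1
      rw [heq, h2] at h1
      exact h1.symm
    · intro v
      obtain ⟨k, hk⟩ := acyclic (π v) ⟨v, rfl⟩
      have hx : π v ∈ Set.range π := ⟨v, rfl⟩
      generalize π v = x at hk hx ⊢
      induction k generalizing x with
      | zero => simp only [Function.iterate_zero, id_eq] at hk; rw [hk]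
      | succ k ih =>
        by_cases hxr : x = π r
        · rw [hxr]
        · refine (ih (pred π f x) hk ⟨(f x).1, rfl⟩).tail ⟨(f x).1, (f x).2, ?_, rfl, ?_⟩
          · exact (output _ _).2 ⟨x, hx, hxr, rfl⟩
          · exact (cheapest x hx hxr).1.2.1
    · have hB : outerArcs π B ⊆
          (Finset.univ.filter fun x => x ∈ Set.range π ∧ x ≠ π r).image f := by
        intro e he
        obtain ⟨x, h1, h2, h3⟩ := (output _ _).1 (mem_outerArcs.1 he).1
        exact Finset.mem_image.2 ⟨x, by simpa using ⟨h1, h2⟩, h3⟩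
      have hpos : ∀ x, x ∈ Set.range π → x ≠ π r → 0 ≤ c (f x).1 (f x).2 := fun x hx hxr => by
        obtain ⟨h1, h2, h3⟩ := (cheapest x hx hxr).1
        exact hc _ _ h1 (h2.symm ▸ h3)
      calc ∑ a ∈ outerArcs π B, c a.1 a.2
          ≤ ∑ a ∈ (Finset.univ.filter fun x => x ∈ Set.range π ∧ x ≠ π r).image f, c a.1 a.2 := by
            refine Finset.sum_le_sum_of_subset_of_nonneg hB fun e he _ => ?_
            obtain ⟨x, hx, rfl⟩ := Finset.mem_image.1 he
            rw [Finset.mem_filter] at hx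
            exact hpos x hx.2.1 hx.2.2
        _ = ∑ x ∈ Finset.univ.filter fun x => x ∈ Set.range π ∧ x ≠ π r, c (f x).1 (f x).2 := by
            refine Finset.sum_image fun x hx y hy h => ?_
            have hx := (Finset.mem_filter.1 hx).2
            have hy := (Finset.mem_filter.1 hy).2
            rw [← (cheapest x hx.1 hx.2).1.2.1, ← (cheapest y hy.1 hy.2).1.2.1, h]
        _ ≤ ∑ a ∈ outerArcs π S, c a.1 a.2 := by
            refine sum_le_sum_of_entering (p := fun e => π e.2) ?_ ?_ ?_
            · intro x hx
              obtain ⟨-, ⟨v, rfl⟩, hxr⟩ := Finset.mem_filter.1 hx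
              obtain ⟨u, w, h1, h2, h3⟩ := hSc.exists_entering hxr
              exact ⟨(u, w), mem_outerArcs.2 ⟨h1, h2.symm ▸ h3⟩, h2⟩
            · intro e he hx
              obtain ⟨-, hx, hxr⟩ := Finset.mem_filter.1 hx
              rw [mem_outerArcs] at he
              exact (cheapest _ hx hxr).2 e ⟨hS he.1, rfl, he.2⟩
            · intro e he
              rw [mem_outerArcs] at he
              exact hc _ _ (hS he.1) he.2
  | contract π c f C z B' B a cheapest cycle name rest entry output ih =>
    obtain ⟨hB', hmin⟩ := ih fun u v huv hne =>
      contractCost_nonneg cheapest hc huv (ne_of_contractMap_ne (C := C) (z := z) hne)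
    refine ⟨hB'.expand cheapest cycle name entry output, fun S hS hSc => ?_⟩
    exact sum_outerArcs_expand_le cheapest name hc hB' entry output hS hSc
      (hmin S hS (hSc.comp fun x => if x ∈ C then z else x))

theorem sum_outerArcs_id_le_cost [Fintype V] {b : V → V → ℝ} {S : Digraph V}
    (hb : ∀ u v, S.Adj u v → 0 ≤ b u v) : ∑ a ∈ outerArcs id S, b a.1 a.2 ≤ cost b S := by
  classical
  rw [cost, ← Fintype.sum_prod_type' fun u v => if S.Adj u v then b u v else 0,
    ← Finset.sum_filter fun a : V × V => S.Adj a.1 a.2]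
  refine Finset.sum_le_sum_of_subset_of_nonneg (fun a ha => ?_) fun a ha _ => ?_
  · simpa using (mem_outerArcs.1 ha).1
  · exact hb _ _ (by simpa using ha)

theorem cost_eq_sum_outerArcs_id [Fintype V] {b : V → V → ℝ} {B : Digraph V}
    (hB : ∀ u v, B.Adj u v → u ≠ v) : cost b B = ∑ a ∈ outerArcs id B, b a.1 a.2 := by
  classical
  rw [cost, ← Fintype.sum_prod_type' fun u v => if B.Adj u v then b u v else 0,
    ← Finset.sum_filter fun a : V × V => B.Adj a.1 a.2]
  refine Finset.sum_congr (Finset.ext fun a => ?_) fun _ _ => rfl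
  simpa [mem_outerArcs] using hB _ _

theorem IsContractedBranching.isOutBranching {G B : Digraph V} {r : V}
    (h : IsContractedBranching G r id B) : IsOutBranching G r B where
  sub := h.sub
  root u hu := h.root u r hu rfl
  unique v hv := by
    obtain ⟨u, w, huw, rfl, -⟩ := h.connects.exists_entering (v := v) hv
    refine ⟨u, huw, fun u' hu' => ?_⟩
    exact congrArg Prod.fst (h.unique (u', w) (u, w) hu' huw rfl)
  reach v := (h.connects v).lift id fun _ _ ⟨_, _, h, hx, hy⟩ => hx ▸ hy ▸ h

theorem EdmondsOut.isMinOutBranching [Fintype V] {G B : Digraph V} {r : V} {b : V → V → ℝ}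
    (hb : ∀ u v, G.Adj u v → 0 ≤ b u v) (h : EdmondsOut G b r B) : IsMinOutBranching G b r B := by
  obtain ⟨hB, hmin⟩ := EdmondsRun.optimal h fun u v huv _ => hb u v huv
  refine ⟨hB.isOutBranching, fun B' hB' => ?_⟩
  rw [cost_eq_sum_outerArcs_id hB.noInner]
  exact (hmin B' hB'.sub fun v => (hB'.reach v).lift id fun u w h => ⟨u, w, h, rfl, rfl⟩).trans
    (sum_outerArcs_id_le_cost fun u v h => hb u v (hB'.sub h))

theorem EdmondsIn.isMinInBranching [Fintype V] {G B : Digraph V} {r : V} {b : V → V → ℝ}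
    (hb : ∀ u v, G.Adj u v → 0 ≤ b u v) (h : EdmondsIn G b r B) : IsMinInBranching G b r B :=
  isMinInBranching_iff.2 (EdmondsOut.isMinOutBranching (fun u v h => hb v u h) h)

end Optimality

/-! ### The union of two branchings -/

section Union

variable {V : Type*}

/-- A digraph in which every node is reached from `r` contains an out-branching with root `r`: each
node chooses an arc from a node at smaller distance. -/
theorem exists_isOutBranching {H : Digraph V} {r : V}
    (h : ∀ v, Relation.ReflTransGen H.Adj r v) : ∃ B ≤ H, IsOutBranching H r B := by
  classical
  let reachIn : ℕ → V → Prop := fun n => n.rec (fun v => v = r)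
    fun _ R v => ∃ u, R u ∧ H.Adj u v
  have hex : ∀ v, ∃ n : ℕ, reachIn n v := by
    intro v
    induction h v with
    | refl => exact ⟨0, rfl⟩
    | tail _ huv ih => exact ih.elim fun n hn => ⟨n + 1, _, hn, huv⟩
  let d : V → ℕ := fun v => @Nat.find (fun n => reachIn n v) (Classical.decPred _) (hex v)
  have hpar : ∀ v, v ≠ r → ∃ u, H.Adj u v ∧ d u < d v := by
    intro v hv
    have hd : reachIn (d v) v := @Nat.find_spec (fun n => reachIn n v) (Classical.decPred _) (hex v)
    cases hn : d v with
    | zero => rw [hn] at hd; exact absurd hd hv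
    | succ n =>
      rw [hn] at hd
      obtain ⟨u, hu, huv⟩ := hd
      exact ⟨u, huv, Nat.lt_succ_of_le
        (@Nat.find_min' (fun n => reachIn n u) (Classical.decPred _) (hex u) n hu)⟩
  choose! p hp hpd using hpar
  let B : Digraph V := ⟨fun u v => v ≠ r ∧ u = p v⟩
  have hB : B ≤ H := fun u v ⟨hv, hu⟩ => hu ▸ hp v hv
  refine ⟨B, hB, hB, fun u hu => hu.1 rfl, fun v hv => ⟨p v, ⟨hv, rfl⟩, fun u hu => hu.2⟩, ?_⟩
  intro v
  induction hn : d v using Nat.strong_induction_on generalizing v with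
  | _ n ih =>
    by_cases hv : v = r
    · rw [hv]
    · exact (ih _ (hn ▸ hpd v hv) (p v) rfl).tail ⟨hv, rfl⟩

theorem cost_mono [Fintype V] {b : V → V → ℝ} {H K : Digraph V} (hHK : H ≤ K)
    (hb : ∀ u v, K.Adj u v → 0 ≤ b u v) : cost b H ≤ cost b K := by
  classical
  refine Finset.sum_le_sum fun u _ => Finset.sum_le_sum fun v _ => ?_
  by_cases h : H.Adj u v
  · rw [if_pos h, if_pos (hHK h)]
  · rw [if_neg h]
    split_ifs with hK
    · exact hb u v hK
    · exact le_rfl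

theorem cost_sup_le [Fintype V] {b : V → V → ℝ} {H K : Digraph V}
    (hb : ∀ u v, H.Adj u v → K.Adj u v → 0 ≤ b u v) : cost b (H ⊔ K) ≤ cost b H + cost b K := by
  classical
  simp only [cost, ← Finset.sum_add_distrib]
  refine Finset.sum_le_sum fun u _ => Finset.sum_le_sum fun v _ => ?_
  have := hb u v
  by_cases h : H.Adj u v <;> by_cases h' : K.Adj u v <;> simp [h, h', Digraph.sup_adj]
  exact this h h'

/-- A strongly connected subdigraph contains an out-branching. -/
theorem IsMinOutBranching.cost_le [Fintype V] {G B H : Digraph V} {r : V} {b : V → V → ℝ}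
    (hb : ∀ u v, G.Adj u v → 0 ≤ b u v) (hB : IsMinOutBranching G b r B)
    (hH : IsSpanningStrong G H) : cost b B ≤ cost b H := by
  obtain ⟨T, hTH, hT⟩ := exists_isOutBranching (hH.2 r)
  exact (hB.2 T ⟨fun _ _ h => hH.1 (hTH h), hT.root, hT.unique, hT.reach⟩).trans
    (cost_mono hTH fun u v h => hb u v (hH.1 h))

theorem IsMinInBranching.cost_le [Fintype V] {G B H : Digraph V} {r : V} {b : V → V → ℝ}
    (hb : ∀ u v, G.Adj u v → 0 ≤ b u v) (hB : IsMinInBranching G b r B)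
    (hH : IsSpanningStrong G H) : cost b B ≤ cost b H := by
  rw [← cost_reverse b B, ← cost_reverse b H]
  exact (isMinInBranching_iff.1 hB).cost_le (fun u v h => hb v u h)
    ⟨fun _ _ h => hH.1 h, hH.2.reverse⟩

theorem isSpanningStrong_sup {G Bin Bout : Digraph V} {r : V} (hin : IsInBranching G r Bin)
    (hout : IsOutBranching G r Bout) : IsSpanningStrong G (Bin ⊔ Bout) :=
  ⟨sup_le hin.sub hout.sub, fun u v =>
    (Relation.ReflTransGen.mono (fun _ _ h => Or.inl h) _ _ (hin.reach u)).trans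
      (Relation.ReflTransGen.mono (fun _ _ h => Or.inr h) _ _ (hout.reach v))⟩

theorem networkingCost_sup_le {m : ℕ} {G Bin Bout : Digraph (Fin m)} {r : Fin m}
    {b W : Matrix (Fin m) (Fin m) ℝ} (hb : ∀ u v, G.Adj u v → 0 ≤ b u v)
    (hin : IsMinInBranching G b r Bin) (hout : IsMinOutBranching G b r Bout)
    (hW : IsOptimal G b W) :
    networkingCost b (linkMatrix (Bin ⊔ Bout)) ≤ 2 * networkingCost b W := by
  have hH := (isOptimal_iff.1 hW).2.1
  have h1 := hin.cost_le hb hH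
  have h2 := hout.cost_le hb hH
  have h3 := cost_sup_le (b := b) (H := Bin) (K := Bout) fun u v h _ => hb u v (hin.1.sub h)
  rw [← linkMatrix_linkDigraph hW.1.1, networkingCost_linkMatrix, networkingCost_linkMatrix]
  linarith

end Union

/-! ### The gap -/

section Gap

/-- With two nodes or more some arc is needed, so the relative gap does not divide by zero. -/
theorem IsOptimal.networkingCost_pos {m : ℕ} {G : Digraph (Fin m)}
    {b W : Matrix (Fin m) (Fin m) ℝ} (hm : 2 ≤ m) (hb : ∀ u v, G.Adj u v → 0 < b u v)
    (hW : IsOptimal G b W) : 0 < networkingCost b W := by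
  classical
  rw [← linkMatrix_linkDigraph hW.1.1, networkingCost_linkMatrix]
  obtain ⟨-, hsub, hsc⟩ := hW.1
  have hne : (⟨0, by omega⟩ : Fin m) ≠ ⟨1, by omega⟩ := by simp
  obtain heq | ⟨v, hv, -⟩ := (hsc ⟨0, by omega⟩ ⟨1, by omega⟩).cases_head
  · exact absurd heq hne
  have hnn : ∀ u v, 0 ≤ if (linkDigraph W).Adj u v then b u v else 0 := fun u v => by
    split_ifs with h
    · exact (hb u v (hsub h)).le
    · exact le_rfl
  refine Finset.sum_pos' (fun u _ => Finset.sum_nonneg fun v _ => hnn u v)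
    ⟨⟨0, by omega⟩, Finset.mem_univ _, Finset.sum_pos' (fun v _ => hnn _ v)
      ⟨v, Finset.mem_univ _, ?_⟩⟩
  rw [if_pos hv]
  exact hb _ _ (hsub hv)

/-- The digraph with all arcs between different nodes. -/
def completeDigraph (V : Type*) : Digraph V := ⟨fun u v => u ≠ v⟩

/-- The arcs from `r` to all other nodes. -/
def outStar {V : Type*} (r : V) : Digraph V := ⟨fun u v => u = r ∧ v ≠ r⟩

theorem edmondsOut_outStar {V : Type*} (r : V) :
    EdmondsOut (completeDigraph V) (fun _ _ => 1) r (outStar r) := by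
  refine EdmondsRun.base _ _ (fun x => (r, x)) _ ?_ (fun x _ => ⟨1, rfl⟩) fun u v => ?_
  · exact fun x _ hx => ⟨⟨Ne.symm hx, rfl, Ne.symm hx⟩, fun _ _ => le_rfl⟩
  · simp only [outStar, Set.range_id, Set.mem_univ, true_and, Prod.mk.injEq, id_eq]
    exact ⟨fun ⟨hu, hv⟩ => ⟨v, hv, hu.symm, rfl⟩, fun ⟨x, hx, hu, hv⟩ => ⟨hu.symm, hv ▸ hx⟩⟩

theorem edmondsIn_inStar {V : Type*} (r : V) :
    EdmondsIn (completeDigraph V) (fun _ _ => 1) r (reverse (outStar r)) := by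
  have h : reverse (completeDigraph V) = completeDigraph V :=
    Digraph.ext (funext₂ fun _ _ => propext ne_comm)
  rw [EdmondsIn, h]
  exact edmondsOut_outStar r

/-- In the complete digraph with unit costs the two stars cost `2 (m - 1)` together, but a
Hamiltonian cycle only costs `m`. -/
theorem exists_mem_gaps_ge (n : ℕ) : ∃ g ∈ gaps, (n : ℝ) / (n + 2) ≤ g := by
  classical
  let G := completeDigraph (Fin (n + 2))
  let b : Matrix (Fin (n + 2)) (Fin (n + 2)) ℝ := fun _ _ => 1
  let T : Digraph (Fin (n + 2)) := ⟨fun u v => v = u + 1⟩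
  have hT : IsSpanningStrong G T := by
    refine ⟨fun u v (h : v = u + 1) => ?_, fun u v => ?_⟩
    · change u ≠ v
      rw [h]
      simp
    · have key : ∀ k : ℕ, Relation.ReflTransGen T.Adj u (u + Fin.ofNat (n + 2) k) := by
        intro k
        induction k with
        | zero => rw [show Fin.ofNat (n + 2) 0 = 0 from rfl, add_zero]
        | succ k ih =>
          refine ih.tail ?_
          change _ = _ + 1
          rw [add_assoc]
          congr 1
          ext
          simp [Fin.val_add]
      have := key (v - u).val
      simpa using this
  have hG : StronglyConnected G := fun u v => (hT.2 u v).lift id fun _ _ h => hT.1 h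
  have hb : ∀ u v, G.Adj u v → 0 < b u v := fun _ _ _ => one_pos
  obtain ⟨W, hW⟩ := exists_isOptimal b hG
  have hL := hW.networkingCost_pos (by omega) hb
  have hLle : networkingCost b W ≤ n + 2 := by
    have h1 := hW.2 _ (isFeasible_linkMatrix.2 hT)
    have h2 : networkingCost b (linkMatrix T) = n + 2 := by
      rw [networkingCost_linkMatrix]
      simp [cost, T, b]
    linarith
  have hF : networkingCost b (linkMatrix (reverse (outStar 0) ⊔ outStar 0)) = 2 * (n + 1) := by
    have h1 : cost b (reverse (outStar 0) ⊔ outStar 0) = ∑ u : Fin (n + 2), ∑ v : Fin (n + 2),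
        ((if v = 0 then if u = 0 then 0 else 1 else 0) +
          (if u = 0 then if v = 0 then 0 else 1 else 0)) := by
      refine Finset.sum_congr rfl fun u _ => Finset.sum_congr rfl fun v _ => ?_
      simp only [Digraph.sup_adj, reverse, outStar, b]
      by_cases hu : u = 0 <;> by_cases hv : v = 0 <;> simp [hu, hv]
    rw [networkingCost_linkMatrix, h1]
    have h2 : ∑ u : Fin (n + 2), (if u = 0 then (0 : ℝ) else 1) = n + 1 := by
      rw [Fin.sum_univ_succ]
      simp
    simp only [Finset.sum_add_distrib, Finset.sum_ite_eq', Finset.mem_univ, if_true, h2]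
    rw [Finset.sum_comm (f := fun u v : Fin (n + 2) =>
      if u = 0 then if v = 0 then (0 : ℝ) else 1 else 0)]
    simp only [Finset.sum_ite_eq', Finset.mem_univ, if_true, h2]
    ring
  refine ⟨_, ⟨n + 2, G, b, 0, _, _, W, by omega, hG, hb, edmondsIn_inStar 0, edmondsOut_outStar 0,
    hW, rfl⟩, ?_⟩
  rw [hF, div_le_div_iff₀ (by positivity) hL]
  have hn : (0 : ℝ) ≤ n := Nat.cast_nonneg n
  nlinarith

theorem isLUB_gaps : IsLUB gaps 1 := by
  constructor
  · rintro g ⟨m, G, b, r, Bin, Bout, W, hm, -, hb, hin, hout, hW, rfl⟩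
    have hb' : ∀ i j, G.Adj i j → 0 ≤ b i j := fun i j h => (hb i j h).le
    have := networkingCost_sup_le hb' (hin.isMinInBranching hb') (hout.isMinOutBranching hb') hW
    rw [div_le_one (hW.networkingCost_pos hm hb)]
    linarith
  · intro x hx
    have hlim : Filter.Tendsto (fun n : ℕ => (n : ℝ) / (n + 2)) Filter.atTop (nhds 1) :=
      tendsto_natCast_div_add_atTop 2
    refine le_of_tendsto' hlim fun n => ?_
    obtain ⟨g, hg, hng⟩ := exists_mem_gaps_ge n
    exact hng.trans (hx hg)

end Gap

/-! ### The path-growing form of Edmonds' algorithm -/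

section Search

variable {V : Type*} {G : Digraph V} {r : V}

/-- Among the arcs from `u` into `S`, one with head `v` is cheapest if there is an arc from `u` into
`S` at all; otherwise `v` is any node of `S`. -/
def BestHead (G : Digraph V) (c : V → V → ℝ) (S : Set V) (u v : V) : Prop :=
  v ∈ S ∧ ∀ v' ∈ S, G.Adj u v' → G.Adj u v ∧ c u v ≤ c u v'

/-- The better of the best heads in `S` and in `T` is a best head in their union. -/
theorem BestHead.union {c : V → V → ℝ} {S T : Set V} {u v w : V} (hv : BestHead G c S u v)
    (hw : BestHead G c T u w) (hvw : G.Adj u v → c u v ≤ c u w ∨ ¬ G.Adj u w)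
    (hwv : G.Adj u w → G.Adj u v) : BestHead G c (S ∪ T) u v := by
  refine ⟨Or.inl hv.1, fun v' hv' ha => ?_⟩
  rcases hv' with h | h
  · exact hv.2 v' h ha
  · obtain ⟨h1, h2⟩ := hw.2 v' h ha
    have h3 := hwv h1
    rcases hvw h3 with h4 | h4
    · exact ⟨h3, h4.trans h2⟩
    · exact absurd h1 h4

/-- One step from a supernode `x ≠ e` to the supernode from which its chosen arc comes, inside `P`. -/
def ChosenStep (π : V → V) (f : V → V × V) (P : V → Prop) (e : V) (x y : V) : Prop :=
  P x ∧ P y ∧ x ≠ e ∧ pred π f x = y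

theorem exists_iterate_of_reflTransGen {π : V → V} {f : V → V × V} {P : V → Prop} {e x y : V}
    (h : Relation.ReflTransGen (ChosenStep π f P e) x y) : ∃ n : ℕ, (pred π f)^[n] x = y := by
  induction h using Relation.ReflTransGen.head_induction_on with
  | refl => exact ⟨0, rfl⟩
  | head h _ ih =>
    obtain ⟨n, hn⟩ := ih
    exact ⟨n + 1, by rw [Function.iterate_succ_apply, h.2.2.2, hn]⟩

/-- What holds at all times of the search. A node has status `0` while it is unvisited, `1` while
its supernode is on the current path and `2` once the chosen arcs lead from the root to its
supernode; supernodes are named by one of their nodes, and `H x u` is the head of a cheapest arc from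
`u` into the supernode `x`. -/
structure SearchBase (G : Digraph V) (r : V) (π : V → V) (c : V → V → ℝ) (σ : V → ℕ)
    (H : V → V → V) : Prop where
  idem : ∀ v, π (π v) = π v
  root : π r = r
  single : ∀ v, σ v = 0 → π v = v
  le_two : ∀ v, σ v ≤ 2
  best : ∀ x u, π x = x → BestHead G c {v | π v = x} u (H x u)

/-- The state of the search while a path of supernodes is grown backwards from its front `h`: all
visited supernodes except the root and `h` have chosen a cheapest entering arc, the arcs chosen on
the path lead from `h` through the path, and the arcs chosen by the finished supernodes lead from
the root. -/
structure OnPath (G : Digraph V) (r : V) (π : V → V) (c : V → V → ℝ) (f : V → V × V) (σ : V → ℕ)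
    (H : V → V → V) (h : V) : Prop extends SearchBase G r π c σ H where
  status_root : σ r = 2
  head : π h = h
  status_head : σ h = 1
  cheapest : ∀ x, π x = x → x ≠ r → x ≠ h → σ x ≠ 0 → CheapestEntering G π c x (f x)
  path : ∀ x, π x = x → σ x = 1 → Relation.ReflTransGen (ChosenStep π f (σ · = 1) h) x h
  done : ∀ x, π x = x → σ x = 2 → Relation.ReflTransGen (ChosenStep π f (σ · = 2) r) x r

/-- The state of the search when the path has met the finished part: the arcs chosen by the visited
supernodes lead from the root to all of them. -/
structure PathClosed (G : Digraph V) (r : V) (π : V → V) (c : V → V → ℝ) (f : V → V × V)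
    (σ : V → ℕ) (H : V → V → V) : Prop extends SearchBase G r π c σ H where
  status_root : σ r ≠ 0
  cheapest : ∀ x, π x = x → x ≠ r → σ x ≠ 0 → CheapestEntering G π c x (f x)
  done : ∀ x, π x = x → σ x ≠ 0 → Relation.ReflTransGen (ChosenStep π f (σ · ≠ 0) r) x r

variable {π : V → V} {c : V → V → ℝ} {f : V → V × V} {σ : V → ℕ} {H : V → V → V} {h : V}

/-- A cheapest entering arc of `x` is found among the best arcs of the tails outside `x`. -/
theorem SearchBase.cheapestEntering (hS : SearchBase G r π c σ H) {x u : V} (hx : π x = x)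
    (hu : π u ≠ x) (hadj : G.Adj u (H x u))
    (hmin : ∀ u', π u' ≠ x → G.Adj u' (H x u') → c u (H x u) ≤ c u' (H x u')) :
    CheapestEntering G π c x (u, H x u) := by
  refine ⟨⟨hadj, (hS.best x u hx).1, hu⟩, ?_⟩
  rintro ⟨u', v'⟩ ⟨h1, h2, h3⟩
  obtain ⟨h4, h5⟩ := (hS.best x u' hx).2 v' h2 h1
  exact (hmin u' h3 h4).trans h5

/-- Strong connectivity provides an arc into the front of the path. -/
theorem OnPath.exists_candidate (hS : OnPath G r π c f σ H h) (hG : StronglyConnected G) :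
    ∃ u, π u ≠ h ∧ G.Adj u (H h u) := by
  have hne : π h ≠ π r := by
    rw [hS.head, hS.root]
    rintro rfl
    have := hS.status_head
    rw [hS.status_root] at this
    cases this
  obtain ⟨u, w, huw, hw, hu⟩ := (hG.connects r π).exists_entering hne
  rw [hS.head] at hw hu
  exact ⟨u, hu, ((hS.best h u hS.head).2 w hw huw).1⟩

section Choose

variable [DecidableEq V] {u : V}

theorem pred_update_of_ne {x : V} (hx : x ≠ h) (a : V × V) :
    pred π (Function.update f h a) x = pred π f x := by
  unfold pred
  rw [Function.update_of_ne hx]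

theorem pred_update_self (a : V × V) : pred π (Function.update f h a) h = π a.1 := by
  unfold pred
  rw [Function.update_self]

theorem OnPath.cheapest_update (hS : OnPath G r π c f σ H h) {a : V × V}
    (ha : CheapestEntering G π c h a) {x : V} (hx : π x = x) (hxr : x ≠ r) (h0 : σ x ≠ 0) :
    CheapestEntering G π c x (Function.update f h a x) := by
  by_cases hxh : x = h
  · subst hxh
    rwa [Function.update_self]
  · rw [Function.update_of_ne hxh]
    exact hS.cheapest x hx hxr hxh h0

theorem OnPath.path_update (hS : OnPath G r π c f σ H h) (a : V × V) {x : V} (hx : π x = x)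
    (h1 : σ x = 1) :
    Relation.ReflTransGen (ChosenStep π (Function.update f h a) (σ · = 1) h) x h :=
  Relation.ReflTransGen.mono (fun _ _ ⟨h1, h2, h3, h4⟩ =>
    ⟨h1, h2, h3, (pred_update_of_ne h3 a).trans h4⟩) _ _ (hS.path x hx h1)

theorem OnPath.done_update (hS : OnPath G r π c f σ H h) (a : V × V) {x : V} (hx : π x = x)
    (h2 : σ x = 2) :
    Relation.ReflTransGen (ChosenStep π (Function.update f h a) (σ · = 2) r) x r := by
  refine Relation.ReflTransGen.mono (fun y _ ⟨h1, h2, h3, h4⟩ =>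
    ⟨h1, h2, h3, (pred_update_of_ne ?_ a).trans h4⟩) _ _ (hS.done x hx h2)
  rintro rfl
  simp [hS.status_head] at h1

/-- The path is extended when the chosen arc comes from an unvisited supernode. -/
theorem OnPath.extend (hS : OnPath G r π c f σ H h) {a : V × V}
    (ha : CheapestEntering G π c h a) (ht : σ (π a.1) = 0) :
    OnPath G r π c (Function.update f h a) (Function.update σ (π a.1) 1) H (π a.1) := by
  have hrt : r ≠ π a.1 := by
    rintro heq
    rw [← heq, hS.status_root] at ht
    cases ht
  have hht : h ≠ π a.1 := by
    rintro heq
    rw [← heq, hS.status_head] at ht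
    cases ht
  have hσ : ∀ x, σ x ≠ 0 → Function.update σ (π a.1) 1 x = σ x := by
    intro x hx
    rw [Function.update_of_ne]
    rintro rfl
    exact hx ht
  have hσ' : ∀ x, x ≠ π a.1 → Function.update σ (π a.1) 1 x = σ x := fun x hx =>
    Function.update_of_ne hx _ _
  refine { idem := hS.idem, root := hS.root, best := hS.best, single := ?_, le_two := ?_,
           status_root := ?_, head := hS.idem _, status_head := Function.update_self _ _ _,
           cheapest := ?_, path := ?_, done := ?_ }
  · intro v hv
    by_cases hvt : v = π a.1
    · rw [hvt, hS.idem]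
    · exact hS.single v (by rwa [hσ' v hvt] at hv)
  · intro v
    by_cases hvt : v = π a.1
    · rw [hvt, Function.update_self]; omega
    · rw [hσ' v hvt]; exact hS.le_two v
  · rw [hσ' r hrt, hS.status_root]
  · intro x hx hxr hxt h0
    rw [hσ' x hxt] at h0
    exact hS.cheapest_update ha hx hxr h0
  · intro x hx h1
    by_cases hxt : x = π a.1
    · rw [hxt]
    · rw [hσ' x hxt] at h1
      have hm := Relation.ReflTransGen.mono (p := ChosenStep π (Function.update f h a)
        (Function.update σ (π a.1) 1 · = 1) (π a.1)) (fun y z ⟨h1, h2, h3, h4⟩ =>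
          ⟨(hσ y (by simp [h1])).trans h1, (hσ z (by simp [h2])).trans h2, (by
            rintro rfl; simp [ht] at h1), h4⟩) _ _ (hS.path_update a hx h1)
      refine hm.tail ⟨?_, Function.update_self _ _ _, hht, pred_update_self a⟩
      change Function.update σ (π a.1) 1 h = 1
      rw [hσ' h hht, hS.status_head]
  · intro x hx h2
    have hxt : x ≠ π a.1 := by
      rintro rfl
      rw [Function.update_self] at h2
      cases h2
    rw [hσ' x hxt] at h2
    exact Relation.ReflTransGen.mono (fun y z ⟨h1, h2, h3, h4⟩ =>
      ⟨(hσ y (by simp [h1])).trans h1, (hσ z (by simp [h2])).trans h2, h3, h4⟩) _ _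
      (hS.done_update a hx h2)

/-- The path is finished when the chosen arc comes from a finished supernode. -/
theorem OnPath.close (hS : OnPath G r π c f σ H h) {a : V × V}
    (ha : CheapestEntering G π c h a) (ht : σ (π a.1) = 2) :
    PathClosed G r π c (Function.update f h a) σ H := by
  have hdone : ∀ x, π x = x → σ x = 2 → Relation.ReflTransGen
      (ChosenStep π (Function.update f h a) (σ · ≠ 0) r) x r := fun x hx h2 =>
    Relation.ReflTransGen.mono (fun y z ⟨h1, h2, h3, h4⟩ =>
      ⟨by simp [h1], by simp [h2], h3, h4⟩) _ _ (hS.done_update a hx h2)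
  refine { hS.toSearchBase with
    status_root := by simp [hS.status_root]
    cheapest := fun x hx hxr h0 => hS.cheapest_update ha hx hxr h0
    done := fun x hx h0 => ?_ }
  have hle := hS.le_two x
  obtain h1 | h2 : σ x = 1 ∨ σ x = 2 := by omega
  · have hr : ∀ y, σ y = 1 → y ≠ r := by
      rintro y h1 rfl
      rw [hS.status_root] at h1
      cases h1
    have hm := Relation.ReflTransGen.mono (p := ChosenStep π (Function.update f h a) (σ · ≠ 0) r)
      (fun y z ⟨h1, h2, _, h4⟩ => ⟨by simp [h1], by simp [h2], hr y h1, h4⟩) _ _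
      (hS.path_update a hx h1)
    refine (hm.tail ?_).trans (hdone _ (hS.idem _) ht)
    exact ⟨by simp [hS.status_head], by simp [ht], hr h hS.status_head, pred_update_self a⟩
  · exact hdone x hx h2

/-- A new path starts at an unvisited node. -/
theorem PathClosed.start (hS : PathClosed G r π c f σ H) {v : V} (hv : σ v = 0) :
    OnPath G r π c f (Function.update (fun x => if σ x = 1 then 2 else σ x) v 1) H v := by
  have hle := hS.le_two
  have hσv : Function.update (fun x => if σ x = 1 then 2 else σ x) v 1 v = 1 :=
    Function.update_self _ _ _
  have hσ : ∀ x, x ≠ v → Function.update (fun x => if σ x = 1 then 2 else σ x) v 1 x =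
      if σ x = 0 then 0 else 2 := by
    intro x hx
    rw [Function.update_of_ne hx]
    have := hle x
    grind
  have hσ0 : ∀ x, σ x ≠ 0 → Function.update (fun x => if σ x = 1 then 2 else σ x) v 1 x = 2 := by
    intro x hx
    rw [hσ x (by rintro rfl; exact hx hv), if_neg hx]
  refine { idem := hS.idem, root := hS.root, best := hS.best, single := ?_, le_two := ?_,
           status_root := hσ0 r hS.status_root, head := hS.single v hv, status_head := hσv,
           cheapest := ?_, path := ?_, done := ?_ }
  · intro x hx
    by_cases hxv : x = v
    · rw [hxv]; exact hS.single v hv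
    · rw [hσ x hxv] at hx
      refine hS.single x ?_
      by_contra h0
      rw [if_neg h0] at hx
      cases hx
  · intro x
    by_cases hxv : x = v
    · rw [hxv, hσv]; omega
    · rw [hσ x hxv]; split_ifs <;> omega
  · intro x hx hxr hxv h0
    rw [hσ x hxv] at h0
    exact hS.cheapest x hx hxr fun h => h0 (if_pos h)
  · intro x hx h1
    by_cases hxv : x = v
    · rw [hxv]
    · rw [hσ x hxv] at h1
      split_ifs at h1
      cases h1
  · intro x hx h2
    have hxv : x ≠ v := by
      rintro rfl
      rw [hσv] at h2
      cases h2
    rw [hσ x hxv] at h2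
    have h0 : σ x ≠ 0 := fun h => by simp [h] at h2
    exact Relation.ReflTransGen.mono (fun y z ⟨h1, h2, h3, h4⟩ => ⟨hσ0 y h1, hσ0 z h2, h3, h4⟩) _ _
      (hS.done x hx h0)

end Choose

/-- The arcs chosen by the supernodes other than that of the root. -/
def chosenArcs (r : V) (π : V → V) (f : V → V × V) : Digraph V :=
  ⟨fun u v => ∃ x ∈ Set.range π, x ≠ π r ∧ f x = (u, v)⟩

/-- `X` chooses for each supernode the arc of an output of Edmonds' algorithm that enters it. -/
def IsOutput (G : Digraph V) (r : V) (π : V → V) (c : V → V → ℝ) (X : V → V × V) : Prop :=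
  EdmondsRun G r π c (chosenArcs r π X) ∧
    ∀ x ∈ Set.range π, x ≠ π r → π (X x).2 = x ∧ π (X x).1 ≠ x

/-- Once all nodes are visited, the chosen arcs contain no cycle and are the output. -/
theorem PathClosed.isOutput (hS : PathClosed G r π c f σ H) (hσ : ∀ v, σ v ≠ 0) :
    IsOutput G r π c f := by
  have hch : ∀ x ∈ Set.range π, x ≠ π r → CheapestEntering G π c x (f x) := by
    rintro _ ⟨v, rfl⟩ hv
    exact hS.cheapest _ (hS.idem v) (hS.root ▸ hv) (hσ _)
  refine ⟨.base π c f _ hch ?_ fun _ _ => Iff.rfl, fun x hx hxr => (hch x hx hxr).1.2⟩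
  rintro _ ⟨v, rfl⟩
  rw [hS.root]
  exact exists_iterate_of_reflTransGen (hS.done _ (hS.idem v) (hσ _))

/-- The supernodes on the cycle of chosen arcs through `t`. -/
def orbit (π : V → V) (f : V → V × V) (t : V) : Set V := {y | ∃ n : ℕ, (pred π f)^[n] t = y}

theorem mem_orbit_self (t : V) : t ∈ orbit π f t := ⟨0, rfl⟩

theorem pred_mem_orbit {t x : V} (hx : x ∈ orbit π f t) : pred π f x ∈ orbit π f t := by
  obtain ⟨n, rfl⟩ := hx
  exact ⟨n + 1, Function.iterate_succ_apply' _ _ _⟩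

/-- If `t` is periodic, all supernodes of its orbit have the same orbit. -/
theorem orbit_isCycle {t : V} {N : ℕ} (hN : 0 < N) (ht : (pred π f)^[N] t = t) :
    ∀ x ∈ orbit π f t, ∀ y, y ∈ orbit π f t ↔ ∃ k : ℕ, (pred π f)^[k] x = y := by
  rintro _ ⟨i, rfl⟩ y
  constructor
  · rintro ⟨j, rfl⟩
    refine ⟨j + (N * i - i), ?_⟩
    have hi : i ≤ N * i := Nat.le_mul_of_pos_left i hN
    rw [← Function.iterate_add_apply, add_assoc, Nat.sub_add_cancel hi, Function.iterate_add_apply]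
    congr 1
    rw [Function.iterate_mul]
    exact Function.iterate_fixed ht i
  · rintro ⟨k, rfl⟩
    exact ⟨k + i, Function.iterate_add_apply _ _ _ _⟩

/-- All nodes of a finite cycle are met in as many steps as there are nodes. -/
theorem mem_orbit_iff_lt [Fintype V] {t y : V} :
    y ∈ orbit π f t ↔ ∃ n < Fintype.card V, (pred π f)^[n] t = y := by
  classical
  refine ⟨?_, fun ⟨n, _, hn⟩ => ⟨n, hn⟩⟩
  rintro ⟨n, hn⟩
  have hex : ∃ n, (pred π f)^[n] t = y := ⟨n, hn⟩
  refine ⟨Nat.find hex, ?_, Nat.find_spec hex⟩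
  by_contra hlt
  rw [not_lt] at hlt
  -- Among the iterates before the first visit of `y` one would be repeated, which could be cut out.
  have hinj : Function.Injective fun i : Fin (Nat.find hex + 1) => (pred π f)^[(i : ℕ)] t := by
    intro i j hij
    by_contra hne
    wlog hlt' : i < j generalizing i j
    · exact this hij.symm (Ne.symm hne) (lt_of_le_of_ne (not_lt.1 hlt') (Ne.symm hne))
    have hj : (j : ℕ) ≤ Nat.find hex := Nat.lt_succ_iff.1 j.2
    refine Nat.find_min hex (m := Nat.find hex - j + i) ?_ ?_
    · have : (i : ℕ) < j := hlt'
      omega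
    · rw [Function.iterate_add_apply]
      simp only at hij
      rw [hij, ← Function.iterate_add_apply, Nat.sub_add_cancel hj]
      exact Nat.find_spec hex
  have := Fintype.card_le_of_injective _ hinj
  rw [Fintype.card_fin] at this
  omega

section Contract

variable [DecidableEq V] {a : V × V}

theorem OnPath.orbit_subset (hS : OnPath G r π c f σ H h) (ht : σ (π a.1) = 1) :
    ∀ x ∈ orbit π (Function.update f h a) (π a.1), π x = x ∧ σ x = 1 := by
  rintro _ ⟨n, rfl⟩
  induction n with
  | zero => exact ⟨hS.idem _, ht⟩
  | succ n ih =>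
    rw [Function.iterate_succ_apply']
    set x := (pred π (Function.update f h a))^[n] (π a.1)
    by_cases hx : x = h
    · rw [hx, pred_update_self]
      exact ⟨hS.idem _, ht⟩
    · refine ⟨hS.idem _, ?_⟩
      rcases (hS.path_update a ih.1 ih.2).cases_head with h' | ⟨y, ⟨-, h2, -, h4⟩, -⟩
      · exact absurd h' hx
      · rw [h4]
        exact h2

theorem OnPath.head_mem_orbit (hS : OnPath G r π c f σ H h) (ht : σ (π a.1) = 1) :
    h ∈ orbit π (Function.update f h a) (π a.1) :=
  exists_iterate_of_reflTransGen (hS.path_update a (hS.idem _) ht)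

/-- The arc chosen by the front `h` closes the path from `h` to its tail to a cycle. -/
theorem OnPath.isCycle (hS : OnPath G r π c f σ H h) (ht : σ (π a.1) = 1) :
    ∀ x ∈ orbit π (Function.update f h a) (π a.1), ∀ y,
      y ∈ orbit π (Function.update f h a) (π a.1) ↔
        ∃ k : ℕ, (pred π (Function.update f h a))^[k] x = y := by
  obtain ⟨n, hn⟩ := hS.head_mem_orbit ht
  refine orbit_isCycle (Nat.succ_pos n) ?_
  rw [Function.iterate_succ_apply', hn, pred_update_self]

theorem OnPath.cheapest_orbit (hS : OnPath G r π c f σ H h) (ha : CheapestEntering G π c h a)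
    (ht : σ (π a.1) = 1) : ∀ x ∈ orbit π (Function.update f h a) (π a.1),
      x ≠ π r ∧ CheapestEntering G π c x (Function.update f h a x) := by
  intro x hx
  obtain ⟨h1, h2⟩ := hS.orbit_subset ht x hx
  have hxr : x ≠ r := by
    rintro rfl
    rw [hS.status_root] at h2
    cases h2
  exact ⟨hS.root.symm ▸ hxr, hS.cheapest_update ha h1 hxr (by simp [h2])⟩

/-- When the chosen arc comes from the path, the cycle of chosen arcs is contracted, and the path
ends at the new supernode. -/
theorem OnPath.contract (hS : OnPath G r π c f σ H h) (ha : CheapestEntering G π c h a)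
    (ht : σ (π a.1) = 1) {H' : V → V → V} {C : Set V}
    (hC : C = orbit π (Function.update f h a) (π a.1))
    (hbest : ∀ u, BestHead G (contractCost π c (Function.update f h a) C) {v | π v ∈ C} u
      (H' (π a.1) u))
    (hH' : ∀ x, x ≠ π a.1 → H' x = H x) :
    OnPath G r (contractMap π C (π a.1)) (contractCost π c (Function.update f h a) C)
      (Function.update f h a) σ H' (π a.1) := by
  classical
  set t := π a.1 with htdef
  set f' := Function.update f h a with hf'
  have hsub : ∀ x ∈ C, π x = x ∧ σ x = 1 := fun x hx => hS.orbit_subset ht x (hC ▸ hx)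
  have htC : t ∈ C := hC ▸ mem_orbit_self t
  have hhC : h ∈ C := hC ▸ hS.head_mem_orbit ht
  have hπt : π t = t := hS.idem _
  have hpC : ∀ x ∈ C, pred π f' x ∈ C := fun x hx => by
    rw [hC] at hx ⊢
    exact pred_mem_orbit hx
  have hnot : ∀ x, σ x ≠ 1 → x ∉ C := fun x h1 hx => h1 (hsub x hx).2
  have hπ' : ∀ v, contractMap π C t v = t ↔ π v ∈ C := fun v => contractMap_eq_name_iff htC
  have hπ'x : ∀ v x, x ∉ C → (contractMap π C t v = x ↔ π v = x) := by
    intro v x hx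
    by_cases hv : π v ∈ C
    · rw [(hπ' v).2 hv]
      exact ⟨fun h => absurd (h ▸ htC) hx, fun h => absurd (h ▸ hv) hx⟩
    · rw [contractMap_of_notMem hv]
  have hfix : ∀ x, contractMap π C t x = x → x = t ∨ x ∉ C ∧ π x = x := by
    intro x hx
    by_cases hxC : π x ∈ C
    · exact Or.inl (hx.symm.trans ((hπ' x).2 hxC))
    · rw [contractMap_of_notMem hxC] at hx
      exact Or.inr ⟨hx ▸ hxC, hx⟩
  have hpred : ∀ x, pred (contractMap π C t) f' x = if pred π f' x ∈ C then t else pred π f' x :=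
    fun x => by unfold pred contractMap; split_ifs <;> rfl
  refine { idem := ?_, root := ?_, best := ?_, single := ?_, le_two := hS.le_two,
           status_root := hS.status_root, head := (hπ' t).2 (hπt.symm ▸ htC),
           status_head := ht, cheapest := ?_, path := ?_, done := ?_ }
  · intro v
    by_cases hv : π v ∈ C
    · rw [(hπ' v).2 hv]
      exact (hπ' t).2 (hπt.symm ▸ htC)
    · rw [contractMap_of_notMem hv, contractMap_of_notMem (by rwa [hS.idem]), hS.idem]
  · rw [contractMap_of_notMem, hS.root]
    rw [hS.root]
    exact hnot r (by simp [hS.status_root])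
  · intro v hv
    have h1 := hS.single v hv
    rw [contractMap_of_notMem, h1]
    rw [h1]
    exact hnot v (by simp [hv])
  · intro x u hx
    by_cases hxt : x = t
    · subst hxt
      have : {v | contractMap π C t v = t} = {v | π v ∈ C} := Set.ext hπ'
      rw [this]
      exact hbest u
    · obtain h' | ⟨hxC, hπx⟩ := hfix x hx
      · exact absurd h' hxt
      have : {v | contractMap π C t v = x} = {v | π v = x} := Set.ext fun v => hπ'x v x hxC
      rw [this, hH' x hxt]
      have hc : ∀ v, π v = x → contractCost π c f' C u v = c u v := fun v hv =>
        if_neg (hv.symm ▸ hxC)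
      obtain ⟨h1, h2⟩ := hS.best x u hπx
      refine ⟨h1, fun v' hv' hadj => ?_⟩
      rw [hc v' hv', hc _ h1]
      exact h2 v' hv' hadj
  · intro x hx hxr hxt h0
    obtain h' | ⟨hxC, hπx⟩ := hfix x hx
    · exact absurd h' hxt
    have hent : ∀ e : V × V, Enters G (contractMap π C t) x e ↔ Enters G π x e := fun e => by
      unfold Enters
      rw [hπ'x _ _ hxC, Ne, hπ'x _ _ hxC]
    have hc : ∀ e : V × V, Enters G π x e → contractCost π c f' C e.1 e.2 = c e.1 e.2 :=
      fun e he => if_neg (he.2.1.symm ▸ hxC)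
    obtain ⟨h1, h2⟩ := hS.cheapest_update ha hπx hxr h0
    refine ⟨(hent _).2 h1, fun e he => ?_⟩
    have he' := (hent e).1 he
    rw [hc e he', hc _ h1]
    exact h2 e he'
  · intro x hx h1
    obtain rfl | ⟨hxC, hπx⟩ := hfix x hx
    · exact .refl
    -- The old path to `h`, read modulo the contraction, leads to the new supernode.
    have key : ∀ y, Relation.ReflTransGen (ChosenStep π f' (σ · = 1) h) y h →
        Relation.ReflTransGen (ChosenStep (contractMap π C t) f' (σ · = 1) t)
          (if y ∈ C then t else y) t := by
      intro y hy
      induction hy using Relation.ReflTransGen.head_induction_on with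
      | refl => rw [if_pos hhC]
      | @head y w hyw _ ih =>
        obtain ⟨h1, h2, -, h4⟩ := hyw
        by_cases hyC : y ∈ C
        · rw [if_pos hyC]
        · rw [if_neg hyC]
          refine .head ⟨h1, ?_, ?_, ?_⟩ ih
          · change σ (if w ∈ C then t else w) = 1
            split_ifs
            · exact ht
            · exact h2
          · rintro rfl
            exact hyC htC
          · rw [hpred, h4]
    have := key x (hS.path_update a hπx h1)
    rwa [if_neg hxC] at this
  · intro x hx h2
    obtain rfl | ⟨hxC, hπx⟩ := hfix x hx
    · rw [ht] at h2
      cases h2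
    refine Relation.ReflTransGen.mono (fun y w ⟨h1, h2, h3, h4⟩ => ⟨h1, h2, h3, ?_⟩) _ _
      (hS.done_update a hπx h2)
    rw [hpred, h4, if_neg]
    exact hnot w (by simp [h2])

theorem OnPath.two_le_card_orbit [Fintype V] (hS : OnPath G r π c f σ H h)
    (ha : CheapestEntering G π c h a) (ht : σ (π a.1) = 1) {C : Finset V}
    (hC : (C : Set V) = orbit π (Function.update f h a) (π a.1)) : 2 ≤ C.card := by
  have h1 : h ∈ C := by
    rw [← Finset.mem_coe, hC]
    exact hS.head_mem_orbit ht
  have h2 : π a.1 ∈ C := by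
    rw [← Finset.mem_coe, hC]
    exact mem_orbit_self _
  exact Finset.one_lt_card.2 ⟨_, h2, _, h1, ha.1.2.2⟩

/-- Contraction of a cycle of `n` supernodes lowers the number of supernodes by `n - 1`. -/
theorem card_filter_contractMap [Fintype V] {C : Finset V} {t : V} (htC : t ∈ C)
    (hC : ∀ x ∈ C, π x = x) :
    (Finset.univ.filter fun x => contractMap π C t x = x).card + C.card =
      (Finset.univ.filter fun x => π x = x).card + 1 := by
  have h1 : (Finset.univ.filter fun x => contractMap π C t x = x) =
      insert t ((Finset.univ.filter fun x => π x = x) \ C) := by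
    ext x
    simp only [Finset.mem_filter, Finset.mem_univ, true_and, Finset.mem_insert, Finset.mem_sdiff]
    by_cases hx : π x ∈ C
    · rw [(contractMap_eq_name_iff (C := (C : Set V)) htC).2 hx]
      exact ⟨fun h => Or.inl h.symm, fun h => h.elim Eq.symm fun h => absurd (h.1 ▸ hx) h.2⟩
    · rw [contractMap_of_notMem (C := (C : Set V)) hx]
      refine ⟨fun h => Or.inr ⟨h, h ▸ hx⟩, fun h => h.elim ?_ And.left⟩
      rintro rfl
      exact absurd (by rwa [hC x htC]) hx
  have h2 : C ⊆ Finset.univ.filter fun x => π x = x := fun x hx => by simpa using hC x hx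
  rw [h1, Finset.card_insert_of_notMem (by simp [htC])]
  have := Finset.card_sdiff_add_card_eq_card h2
  omega

end Contract

end Search

/-! ### Recorded stages and the expansion of cycles -/

section Stages

variable {V : Type*} {G : Digraph V} {r : V} {b : V → V → ℝ}

/-- The reduced cost of an arc: all reductions that an arc has undergone depend on its head only. -/
def reducedCost (b : V → V → ℝ) (Y : V → ℝ) (u v : V) : ℝ := b u v - Y v

open Classical in
/-- The total reduction by head after the contraction of the cycle `C`. -/
noncomputable def contractReduction (π : V → V) (b : V → V → ℝ) (Y : V → ℝ) (f : V → V × V)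
    (C : Set V) (v : V) : ℝ :=
  if π v ∈ C then Y v + reducedCost b Y (f (π v)).1 (f (π v)).2 else Y v

theorem contractCost_reducedCost (π : V → V) (Y : V → ℝ) (f : V → V × V) (C : Set V) :
    contractCost π (reducedCost b Y) f C = reducedCost b (contractReduction π b Y f C) := by
  ext u v
  unfold contractCost contractReduction
  by_cases h : π v ∈ C
  · simp only [if_pos h, reducedCost]
    ring
  · simp only [if_neg h, reducedCost]

/-- The first `k` contractions: at stage `j` the labels of supernodes are `π j`, the reductions by
head are `Y j`, and the cycle `C j` of arcs chosen by `f j` is contracted to a supernode `z j`. -/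
structure IsHistory (G : Digraph V) (r : V) (b : V → V → ℝ) (π : ℕ → V → V) (Y : ℕ → V → ℝ)
    (f : ℕ → V → V × V) (C : ℕ → Set V) (z : ℕ → V) (k : ℕ) : Prop where
  label_zero : π 0 = id
  reduction_zero : Y 0 = fun _ => 0
  cheapest : ∀ j < k, ∀ x ∈ C j,
    x ≠ π j r ∧ CheapestEntering G (π j) (reducedCost b (Y j)) x (f j x)
  cycle : ∀ j < k, ∀ x ∈ C j, ∀ y, y ∈ C j ↔ ∃ n : ℕ, (pred (π j) (f j))^[n] x = y
  name : ∀ j < k, z j ∈ C j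
  label_succ : ∀ j < k, π (j + 1) = contractMap (π j) (C j) (z j)
  reduction_succ : ∀ j < k, Y (j + 1) = contractReduction (π j) b (Y j) (f j) (C j)

open Classical in
/-- The arcs chosen after the cycle `C`, contracted to `z`, is expanded: the supernode at which `X`
enters the cycle keeps the entering arc, and the rest of the cycle gets the arcs of the cycle. -/
noncomputable def expandArcs (π : V → V) (f : V → V × V) (C : Set V) (z : V) (X : V → V × V)
    (x : V) : V × V :=
  if x = π (X z).2 then X z else if x ∈ C then f x else X x

/-- The expansion is the step with which Edmonds' algorithm returns from a contraction. -/
theorem IsOutput.expand {π : V → V} {c : V → V → ℝ} {f X : V → V × V} {C : Set V} {z : V}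
    (hX : IsOutput G r (contractMap π C z) (contractCost π c f C) X)
    (hC : ∀ x ∈ C, x ≠ π r ∧ CheapestEntering G π c x (f x))
    (cycle : ∀ x ∈ C, ∀ y, y ∈ C ↔ ∃ k : ℕ, (pred π f)^[k] x = y) (hz : z ∈ C) :
    IsOutput G r π c (expandArcs π f C z X) := by
  obtain ⟨hrun, hent⟩ := hX
  have hr : π r ∉ C := fun h => (hC _ h).1 rfl
  have hrange : ∀ x ∈ C, x ∈ Set.range π := fun x hx => ⟨_, (hC x hx).2.1.2.1⟩
  have hr' : contractMap π C z r = π r := contractMap_of_notMem hr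
  have hzr : z ≠ π r := fun h => hr (h ▸ hz)
  have hmem : ∀ x, x ∈ Set.range (contractMap π C z) ↔ x = z ∨ x ∈ Set.range π ∧ x ∉ C := by
    intro x
    constructor
    · rintro ⟨v, rfl⟩
      by_cases hv : π v ∈ C
      · exact Or.inl ((contractMap_eq_name_iff hz).2 hv)
      · rw [contractMap_of_notMem hv]
        exact Or.inr ⟨⟨v, rfl⟩, hv⟩
    · rintro (rfl | ⟨⟨v, rfl⟩, hv⟩)
      · obtain ⟨v, hv⟩ := hrange x hz
        exact ⟨v, (contractMap_eq_name_iff hz).2 (hv ▸ hz)⟩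
      · exact ⟨v, contractMap_of_notMem hv⟩
  have hiff : ∀ v x, x ∉ C → (contractMap π C z v = x ↔ π v = x) := by
    intro v x hx
    by_cases hv : π v ∈ C
    · rw [(contractMap_eq_name_iff hz).2 hv]
      exact ⟨fun h => absurd (h ▸ hz) hx, fun h => absurd (h ▸ hv) hx⟩
    · rw [contractMap_of_notMem hv]
  have hzent := hent z ((hmem z).2 (Or.inl rfl)) (hr'.symm ▸ hzr)
  rw [Ne, contractMap_eq_name_iff hz, contractMap_eq_name_iff hz] at hzent
  obtain ⟨hin, hout⟩ := hzent
  have hXy : expandArcs π f C z X (π (X z).2) = X z := if_pos rfl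
  have hXC : ∀ x ∈ C, x ≠ π (X z).2 → expandArcs π f C z X x = f x := fun x hx hne => by
    rw [expandArcs, if_neg hne, if_pos hx]
  have hXn : ∀ x, x ∉ C → expandArcs π f C z X x = X x := fun x hx => by
    rw [expandArcs, if_neg (fun h : x = π (X z).2 => hx (h ▸ hin)), if_neg hx]
  constructor
  · refine .contract π c f C z _ _ (X z) hC cycle hz hrun
      ⟨⟨z, (hmem z).2 (Or.inl rfl), hr'.symm ▸ hzr, rfl⟩, hin, hout⟩ fun u v => ?_
    constructor
    · rintro ⟨x, hx, hxr, hxe⟩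
      by_cases hxy : x = π (X z).2
      · rw [hxy, hXy] at hxe
        exact Or.inl ⟨z, (hmem z).2 (Or.inl rfl), hr'.symm ▸ hzr, hxe⟩
      by_cases hxC : x ∈ C
      · exact Or.inr ⟨x, hxC, hxy, by rwa [hXC x hxC hxy] at hxe⟩
      · rw [hXn x hxC] at hxe
        exact Or.inl ⟨x, (hmem x).2 (Or.inr ⟨hx, hxC⟩), hr'.symm ▸ hxr, hxe⟩
    · rintro (⟨x, hx, hxr, hxe⟩ | ⟨x, hxC, hxy, hxe⟩)
      · obtain rfl | ⟨hx, hxC⟩ := (hmem x).1 hx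
        · exact ⟨_, ⟨_, rfl⟩, fun h => hr (h ▸ hin), hXy.trans hxe⟩
        · exact ⟨x, hx, hr' ▸ hxr, (hXn x hxC).trans hxe⟩
      · exact ⟨x, hrange x hxC, (hC x hxC).1, (hXC x hxC hxy).trans hxe⟩
  · intro x hx hxr
    by_cases hxy : x = π (X z).2
    · rw [hxy, hXy]
      exact ⟨rfl, fun h => hout (h ▸ hin)⟩
    by_cases hxC : x ∈ C
    · rw [hXC x hxC hxy]
      exact (hC x hxC).2.1.2
    · rw [hXn x hxC]
      have := hent x ((hmem x).2 (Or.inr ⟨hx, hxC⟩)) (hr'.symm ▸ hxr)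
      rwa [Ne, hiff _ _ hxC, hiff _ _ hxC] at this

theorem IsHistory.isOutput_expand {π : ℕ → V → V} {Y : ℕ → V → ℝ} {f : ℕ → V → V × V}
    {C : ℕ → Set V} {z : ℕ → V} {k j : ℕ} (hh : IsHistory G r b π Y f C z k) (hj : j < k)
    {X : V → V × V} (hX : IsOutput G r (π (j + 1)) (reducedCost b (Y (j + 1))) X) :
    IsOutput G r (π j) (reducedCost b (Y j)) (expandArcs (π j) (f j) (C j) (z j) X) := by
  rw [hh.label_succ j hj, hh.reduction_succ j hj, ← contractCost_reducedCost] at hX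
  exact hX.expand (hh.cheapest j hj) (hh.cycle j hj) (hh.name j hj)

theorem IsOutput.edmondsOut {X : V → V × V} (hX : IsOutput G r id (reducedCost b fun _ => 0) X) :
    EdmondsOut G b r ⟨fun u v => v ≠ r ∧ (X v).1 = u⟩ := by
  obtain ⟨hrun, hent⟩ := hX
  have h1 : reducedCost b (fun _ => 0) = b := by
    ext u v
    exact sub_zero _
  have h2 : chosenArcs r id X = ⟨fun u v => v ≠ r ∧ (X v).1 = u⟩ := by
    ext u v
    constructor
    · rintro ⟨x, hx, hxr, hxe⟩
      have : (X x).2 = x := (hent x hx hxr).1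
      rw [hxe] at this
      obtain rfl : v = x := this
      exact ⟨hxr, by rw [hxe]⟩
    · rintro ⟨hv, rfl⟩
      exact ⟨v, ⟨v, rfl⟩, hv, Prod.ext rfl (hent v ⟨v, rfl⟩ hv).1⟩
  rw [h1, h2] at hrun
  exact hrun

end Stages

/-! ### Reasoning about programs -/

section Machine

/-- The natural variables that a program may change. -/
def Program.natVars : Program → List ℕ
  | .setNat x _ => [x]
  | .seq p q => p.natVars ++ q.natVars
  | .ite _ p q => p.natVars ++ q.natVars
  | .while _ p => p.natVars
  | _ => []

/-- The natural arrays that a program may change. -/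
def Program.natArrs : Program → List ℕ
  | .putNat A _ _ _ => [A]
  | .seq p q => p.natArrs ++ q.natArrs
  | .ite _ p q => p.natArrs ++ q.natArrs
  | .while _ p => p.natArrs
  | _ => []

/-- The real arrays that a program may change. -/
def Program.realArrs : Program → List ℕ
  | .putReal A _ _ _ => [A]
  | .seq p q => p.realArrs ++ q.realArrs
  | .ite _ p q => p.realArrs ++ q.realArrs
  | .while _ p => p.realArrs
  | _ => []

/-- The memories `s` and `s'` differ at most in variables and arrays that `p` may change. -/
structure Frame (p : Program) (s s' : Memory) : Prop where
  natVar : ∀ x, x ∉ p.natVars → s'.natVar x = s.natVar x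
  natArr : ∀ A, A ∉ p.natArrs → s'.natArr A = s.natArr A
  realArr : ∀ A, A ∉ p.realArrs → s'.realArr A = s.realArr A

theorem Frame.refl (p : Program) (s : Memory) : Frame p s s :=
  ⟨fun _ _ => rfl, fun _ _ => rfl, fun _ _ => rfl⟩

theorem Frame.trans {p : Program} {s s' s'' : Memory} (h : Frame p s s') (h' : Frame p s' s'') :
    Frame p s s'' :=
  ⟨fun x hx => (h'.natVar x hx).trans (h.natVar x hx),
    fun A hA => (h'.natArr A hA).trans (h.natArr A hA),
    fun A hA => (h'.realArr A hA).trans (h.realArr A hA)⟩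

theorem Frame.mono {p q : Program} {s s' : Memory} (h : Frame p s s')
    (h₁ : p.natVars ⊆ q.natVars) (h₂ : p.natArrs ⊆ q.natArrs) (h₃ : p.realArrs ⊆ q.realArrs) :
    Frame q s s' :=
  ⟨fun x hx => h.natVar x fun h => hx (h₁ h), fun A hA => h.natArr A fun h => hA (h₂ h),
    fun A hA => h.realArr A fun h => hA (h₃ h)⟩

theorem store_of_ne {α : Type*} {F : ℕ → ℕ → ℕ → α} {A A' : ℕ} (h : A' ≠ A) (i j : ℕ) (v : α) :
    store F A i j v A' = F A' := by
  ext i' j'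
  exact if_neg fun h' => h h'.1

/-- What a program may change can be read off its text. -/
theorem Exec.frame {p : Program} {s s' : Memory} {t : ℕ} (h : Exec p s s' t) : Frame p s s' := by
  induction h with
  | skip | whileFalse => exact .refl _ _
  | setNat s x e =>
    exact ⟨fun y hy => Function.update_of_ne (by simpa [Program.natVars] using hy) _ _,
      fun _ _ => rfl, fun _ _ => rfl⟩
  | putNat s A i j e =>
    exact ⟨fun _ _ => rfl, fun B hB => store_of_ne (by simpa [Program.natArrs] using hB) _ _ _,
      fun _ _ => rfl⟩
  | setReal => exact ⟨fun _ _ => rfl, fun _ _ => rfl, fun _ _ => rfl⟩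
  | putReal s A i j e =>
    exact ⟨fun _ _ => rfl, fun _ _ => rfl,
      fun B hB => store_of_ne (by simpa [Program.realArrs] using hB) _ _ _⟩
  | seq p q _ _ _ _ _ _ _ h₁ h₂ =>
    exact (h₁.mono (q := .seq p q) (by simp [Program.natVars]) (by simp [Program.natArrs])
      (by simp [Program.realArrs])).trans (h₂.mono (by simp [Program.natVars])
      (by simp [Program.natArrs]) (by simp [Program.realArrs]))
  | iteTrue _ _ _ _ _ _ _ _ h =>
    exact h.mono (by simp [Program.natVars]) (by simp [Program.natArrs])
      (by simp [Program.realArrs])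
  | iteFalse _ _ _ _ _ _ _ _ h =>
    exact h.mono (by simp [Program.natVars]) (by simp [Program.natArrs])
      (by simp [Program.realArrs])
  | whileTrue b p _ _ _ _ _ _ _ _ h₁ h₂ =>
    exact (h₁.mono (q := .while b p) (List.Subset.refl _) (List.Subset.refl _)
      (List.Subset.refl _)).trans h₂

/-- Started with memory `s`, the program `p` halts within `T` steps with a memory satisfying `Q`. -/
def Runs (p : Program) (s : Memory) (T : ℕ) (Q : Memory → Prop) : Prop :=
  ∃ s' t, Exec p s s' t ∧ t ≤ T ∧ Q s'

variable {p q : Program} {s : Memory} {T T' : ℕ} {Q R : Memory → Prop}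

theorem Runs.mono (h : Runs p s T R) (hT : T ≤ T') (hQ : ∀ s', Frame p s s' → R s' → Q s') :
    Runs p s T' Q := by
  obtain ⟨s', t, he, ht, hR⟩ := h
  exact ⟨s', t, he, ht.trans hT, hQ s' he.frame hR⟩

theorem Runs.seq (hp : Runs p s T R) (hq : ∀ s', Frame p s s' → R s' → Runs q s' T' Q) :
    Runs (.seq p q) s (T + T') Q := by
  obtain ⟨s', t, he, ht, hR⟩ := hp
  obtain ⟨s'', t', he', ht', hQ⟩ := hq s' he.frame hR
  exact ⟨s'', t + t', .seq _ _ _ _ _ _ _ he he', by omega, hQ⟩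

theorem Runs.ite {b : Test} (hp : b.holds s → Runs p s T Q) (hq : ¬ b.holds s → Runs q s T Q) :
    Runs (.ite b p q) s (1 + b.steps + T) Q := by
  by_cases h : b.holds s
  · obtain ⟨s', t, he, ht, hQ⟩ := hp h
    exact ⟨s', _, .iteTrue _ _ _ _ _ _ h he, by omega, hQ⟩
  · obtain ⟨s', t, he, ht, hQ⟩ := hq h
    exact ⟨s', _, .iteFalse _ _ _ _ _ _ h he, by omega, hQ⟩

open Classical in
/-- The effect of a program without loops. -/
noncomputable def Program.run : Program → Memory → Memory
  | .skip, s => s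
  | .setNat x e, s => { s with natVar := Function.update s.natVar x (e.eval s) }
  | .putNat A i j e, s =>
    { s with natArr := store s.natArr A (i.eval s) (j.eval s) (e.eval s) }
  | .setReal x e, s => { s with realVar := Function.update s.realVar x (e.eval s) }
  | .putReal A i j e, s =>
    { s with realArr := store s.realArr A (i.eval s) (j.eval s) (e.eval s) }
  | .seq p q, s => q.run (p.run s)
  | .ite b p q, s => if b.holds s then p.run s else q.run s
  | .while _ _, s => s

/-- Whether a program has no loops. -/
def Program.loopFree : Program → Bool
  | .seq p q => p.loopFree && q.loopFree
  | .ite _ p q => p.loopFree && q.loopFree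
  | .while _ _ => false
  | _ => true

/-- A bound for the number of steps of a program without loops. -/
def Program.bound : Program → ℕ
  | .skip => 1
  | .setNat _ e => 1 + e.steps
  | .putNat _ i j e => 1 + i.steps + j.steps + e.steps
  | .setReal _ e => 1 + e.steps
  | .putReal _ i j e => 1 + i.steps + j.steps + e.steps
  | .seq p q => p.bound + q.bound
  | .ite b p q => 1 + b.steps + max p.bound q.bound
  | .while _ _ => 0

theorem runs_of_loopFree (p : Program) (s : Memory) (hp : p.loopFree = true) :
    Runs p s p.bound (· = p.run s) := by
  induction p generalizing s with
  | skip => exact ⟨_, _, .skip s, le_rfl, rfl⟩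
  | setNat x e => exact ⟨_, _, .setNat s x e, le_rfl, rfl⟩
  | putNat A i j e => exact ⟨_, _, .putNat s A i j e, le_rfl, rfl⟩
  | setReal x e => exact ⟨_, _, .setReal s x e, le_rfl, rfl⟩
  | putReal A i j e => exact ⟨_, _, .putReal s A i j e, le_rfl, rfl⟩
  | seq p q ihp ihq =>
    simp only [Program.loopFree, Bool.and_eq_true] at hp
    refine (ihp s hp.1).seq fun s' _ hs' => ?_
    rw [hs']
    exact ihq _ hp.2
  | ite b p q ihp ihq =>
    simp only [Program.loopFree, Bool.and_eq_true] at hp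
    refine Runs.ite (fun h => ?_) fun h => ?_
    · exact (ihp s hp.1).mono (le_max_left _ _) fun s' _ hs' => by
        rw [hs', Program.run, if_pos h]
    · exact (ihq s hp.2).mono (le_max_right _ _) fun s' _ hs' => by
        rw [hs', Program.run, if_neg h]
  | _ => cases hp

/-- A loop whose invariant `I n` includes a budget `n` for the remaining time. -/
theorem runs_while {t : Test} {p : Program} {I : ℕ → Memory → Prop}
    (step : ∀ n s, I n s → t.holds s → ∃ s' T n', Exec p s s' T ∧ I n' s' ∧
      1 + t.steps + T + n' ≤ n) {n : ℕ} {s : Memory} (h : I n s) :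
    Runs (.while t p) s (n + 1 + t.steps) fun s' => (∃ n', I n' s') ∧ ¬ t.holds s' := by
  induction n using Nat.strong_induction_on generalizing s with
  | _ n ih =>
    by_cases ht : t.holds s
    · obtain ⟨s', T, n', he, hI, hn⟩ := step n s h ht
      obtain ⟨s'', T', he', hT', hQ⟩ := ih n' (by omega) hI
      exact ⟨s'', _, .whileTrue _ _ _ _ _ _ _ ht he he', by omega, hQ⟩
    · exact ⟨s, _, .whileFalse _ _ _ ht, by omega, ⟨n, h⟩, ht⟩

/-- Execute `p` with the variable `i` running through the numbers below the variable `0`. -/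
def forN (i : ℕ) (p : Program) : Program :=
  .seq (.setNat i (.const 0)) (.while (.not (.natLe (.var 0) (.var i)))
    (.seq p (.setNat i (.add (.var i) (.const 1)))))

theorem Frame.setNat_forN (i : ℕ) (p : Program) (s : Memory) (v : ℕ) :
    Frame (forN i p) s { s with natVar := Function.update s.natVar i v } :=
  ⟨fun x hx => Function.update_of_ne (by
    rintro rfl
    simp [forN, Program.natVars] at hx) _ _, fun _ _ => rfl, fun _ _ => rfl⟩

theorem Frame.forN {i : ℕ} {p : Program} {s s' : Memory} (h : Frame p s s') :
    Frame (forN i p) s s' := by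
  refine h.mono ?_ ?_ ?_
  · simp [SensorNet.forN, Program.natVars]
  · simp [SensorNet.forN, Program.natArrs]
  · simp [SensorNet.forN, Program.realArrs]

/-- The invariant `I k` holds before the round `k`, which takes at most `T k` steps; it must not depend
on the loop variable. -/
theorem runs_forN {i m : ℕ} {p : Program} {s : Memory} (I : ℕ → Memory → Prop) (T : ℕ → ℕ)
    (hm : s.natVar 0 = m) (hi : i ≠ 0) (h0p : 0 ∉ p.natVars) (hip : i ∉ p.natVars)
    (hset : ∀ k s v, I k s → I k { s with natVar := Function.update s.natVar i v }) (h0 : I 0 s)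
    (step : ∀ k < m, ∀ s', Frame (forN i p) s s' → s'.natVar i = k → I k s' →
      Runs p s' (T k) (I (k + 1))) :
    Runs (forN i p) s (∑ k ∈ Finset.range m, (T k + 9) + 7) (I m) := by
  have h0f : 0 ∉ (forN i p).natVars := by
    simp [forN, Program.natVars, h0p, Ne.symm hi]
  have key : ∀ j k s', k + j = m → Frame (forN i p) s s' → s'.natVar i = k → I k s' →
      Runs (.while (.not (.natLe (.var 0) (.var i)))
        (.seq p (.setNat i (.add (.var i) (.const 1))))) s'
        (∑ l ∈ Finset.range j, (T (k + l) + 9) + 5) (I m) := by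
    intro j
    induction j with
    | zero =>
      intro k s' hk hf hi' hI
      rw [add_zero] at hk
      subst hk
      refine ⟨s', _, .whileFalse _ _ _ ?_, ?_, hI⟩
      · simp [Test.holds, NatExpr.eval, hi', hf.natVar 0 h0f, hm]
      · simp [Test.steps, NatExpr.steps]
    | succ j ih =>
      intro k s' hk hf hi' hI
      obtain ⟨s₁, t₁, he₁, ht₁, hI₁⟩ := step k (by omega) s' hf hi' hI
      have hi₁ : s₁.natVar i = k := (he₁.frame.natVar i hip).trans hi'
      have he₂ := Exec.setNat s₁ i (.add (.var i) (.const 1))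
      obtain ⟨s₃, t₃, he₃, ht₃, hI₃⟩ := ih (k + 1)
        { s₁ with
          natVar := Function.update s₁.natVar i ((NatExpr.add (.var i) (.const 1)).eval s₁) }
        (by omega)
        ((hf.trans he₁.frame.forN).trans (Frame.setNat_forN i p s₁ _))
        (by simp [NatExpr.eval, hi₁]) (hset (k + 1) s₁ _ hI₁)
      refine ⟨s₃, _, .whileTrue _ _ _ _ _ _ _ ?_ (.seq _ _ _ _ _ _ _ he₁ he₂) he₃, ?_, hI₃⟩
      · have h1 := hf.natVar 0 h0f
        simp only [Test.holds, NatExpr.eval]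
        omega
      · rw [Finset.sum_range_succ']
        simp only [Test.steps, NatExpr.steps, add_zero]
        have : ∀ l, k + 1 + l = k + (l + 1) := fun l => by omega
        simp only [this] at ht₃
        omega
  obtain ⟨s', t, he, ht, hI⟩ := key m 0 _ (by omega) (Frame.setNat_forN i p s 0) (by simp)
    (hset 0 s 0 h0)
  refine ⟨s', _, .seq _ _ _ _ _ _ _ (.setNat s i (.const 0)) he, ?_, hI⟩
  simp only [NatExpr.steps, zero_add] at ht ⊢
  omega

theorem runs_forN_const {i m : ℕ} {p : Program} {s : Memory} (I : ℕ → Memory → Prop) (T : ℕ)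
    (hm : s.natVar 0 = m) (hi : i ≠ 0) (h0p : 0 ∉ p.natVars) (hip : i ∉ p.natVars)
    (hset : ∀ k s v, I k s → I k { s with natVar := Function.update s.natVar i v }) (h0 : I 0 s)
    (step : ∀ k < m, ∀ s', Frame (forN i p) s s' → s'.natVar i = k → I k s' →
      Runs p s' T (I (k + 1))) :
    Runs (forN i p) s (m * (T + 9) + 7) (I m) := by
  refine (runs_forN I (fun _ => T) hm hi h0p hip hset h0 step).mono ?_ fun _ _ h => h
  simp

/-- A loop that fills a row of an array; the array is accessed by `arr`. -/
theorem runs_fillRow {α : Type*} {m i : ℕ} {p : Program} {s : Memory} (arr : Memory → ℕ → ℕ → α)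
    (harr : ∀ s v, arr { s with natVar := v } = arr s) (row : ℕ) (val : Fin m → α)
    (hm : s.natVar 0 = m) (hi0 : i ≠ 0) (hp : p.loopFree = true) (h0p : 0 ∉ p.natVars)
    (hip : i ∉ p.natVars)
    (step : ∀ (x : Fin m) (s' : Memory), Frame (forN i p) s s' → s'.natVar i = x →
      (∀ a, a ≠ row → arr s' a = arr s a) → (∀ c, ↑x ≤ c → arr s' row c = arr s row c) →
      ∀ a c, arr (p.run s') a c = if a = row ∧ c = x then val x else arr s' a c) :
    Runs (forN i p) s (m * (p.bound + 9) + 7) fun s' =>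
      (∀ a, a ≠ row → arr s' a = arr s a) ∧ ∀ x : Fin m, arr s' row x = val x := by
  refine (runs_forN_const (fun k s' => (∀ a, a ≠ row → arr s' a = arr s a) ∧
    (∀ c, k ≤ c → arr s' row c = arr s row c) ∧ ∀ x : Fin m, x < k → arr s' row x = val x)
    p.bound hm hi0 h0p hip (fun k s v h => by rwa [harr]) (by simp)
    fun k hk s' hf hi hI => ?_).mono le_rfl fun s' _ h => ⟨h.1, fun x => h.2.2 x x.2⟩
  refine (runs_of_loopFree p s' hp).mono le_rfl ?_
  rintro s'' - rfl
  have hstep := step ⟨k, hk⟩ s' hf hi hI.1 hI.2.1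
  refine ⟨fun a ha => ?_, fun c hc => ?_, fun x hx => ?_⟩
  · rw [← hI.1 a ha]
    ext c
    rw [hstep, if_neg fun h => ha h.1]
  · rw [hstep, if_neg fun h => (by have : c = k := h.2; omega)]
    exact hI.2.1 c (by omega)
  · rw [hstep]
    split_ifs with h
    · have : x = ⟨k, hk⟩ := Fin.ext h.2
      rw [this]
    · exact hI.2.2 x (lt_of_le_of_ne (Nat.lt_succ_iff.1 hx) fun h' => h ⟨rfl, h'⟩)

/-- Store the value of `e` at the variables `7` and `8` in all entries of a natural array. -/
def fill (A : ℕ) (e : NatExpr) : Program := forN 7 (forN 8 (.putNat A (.var 7) (.var 8) e))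

/-- Store the value of `e` at the variables `7` and `8` in all entries of a real array. -/
def fillReal (A : ℕ) (e : RealExpr) : Program := forN 7 (forN 8 (.putReal A (.var 7) (.var 8) e))

theorem runs_fill {m : ℕ} {s : Memory} (A : ℕ) (e : NatExpr) (val : Fin m → Fin m → ℕ)
    (hm : s.natVar 0 = m)
    (step : ∀ (a c : Fin m) s', Frame (fill A e) s s' → s'.natVar 7 = a → s'.natVar 8 = c →
      e.eval s' = val a c) :
    Runs (fill A e) s (m * (m * (e.steps + 12) + 16) + 7) fun s' =>
      ∀ a c : Fin m, s'.natArr A a c = val a c := by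
  refine (runs_forN_const (fun k s' => ∀ a c : Fin m, a < k → s'.natArr A a c = val a c)
    (m * (3 + e.steps + 9) + 7) hm (by decide) (by simp [forN, Program.natVars])
    (by simp [forN, Program.natVars]) (fun _ _ _ h => h) (by simp) ?_).mono
    (by ring_nf; exact le_rfl) fun _ _ h a c => h a c a.2
  intro a ha s' hf hi hI
  refine (runs_forN_const (m := m) (fun k s'' =>
    (∀ c : Fin m, c < k → s''.natArr A a c = val ⟨a, ha⟩ c) ∧
    ∀ a' c : Fin m, a' < a → s''.natArr A a' c = val a' c) (3 + e.steps)
    ((hf.natVar 0 (by simp [forN, Program.natVars])).trans hm) (by decide)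
    (by simp [Program.natVars]) (by simp [Program.natVars]) (fun _ _ _ h => h) ⟨by simp, hI⟩
    ?_).mono le_rfl ?_
  · rintro c hc s'' hf' hc' ⟨hI1, hI2⟩
    have hv7 : s''.natVar 7 = a := (hf'.natVar 7 (by simp [forN, Program.natVars])).trans hi
    have he := step ⟨a, ha⟩ ⟨c, hc⟩ s'' (hf.trans hf'.forN) hv7 hc'
    refine ⟨_, _, .putNat _ _ _ _ _, by simp [NatExpr.steps], fun c' hlt => ?_,
      fun a' c' ha' => ?_⟩
    · simp only [store, NatExpr.eval, hv7, hc', he, true_and]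
      split_ifs with h
      · rw [show c' = ⟨c, hc⟩ from Fin.ext h]
      · exact hI1 c' (by omega)
    · simp only [store, NatExpr.eval, hv7, hc', he, true_and]
      rw [if_neg (by omega)]
      exact hI2 a' c' ha'
  · rintro s'' - ⟨h1, h2⟩ a' c ha'
    by_cases h : (a' : ℕ) = a
    · rw [h, h1 c c.2]
      exact congrArg (val · c) (Fin.ext h.symm)
    · exact h2 a' c (by omega)

theorem runs_fillReal {m : ℕ} {s : Memory} (A : ℕ) (e : RealExpr) (val : Fin m → Fin m → ℝ)
    (hm : s.natVar 0 = m)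
    (step : ∀ (a c : Fin m) s', Frame (fillReal A e) s s' → s'.natVar 7 = a →
      s'.natVar 8 = c → e.eval s' = val a c) :
    Runs (fillReal A e) s (m * (m * (e.steps + 12) + 16) + 7) fun s' =>
      ∀ a c : Fin m, s'.realArr A a c = val a c := by
  refine (runs_forN_const (fun k s' => ∀ a c : Fin m, a < k → s'.realArr A a c = val a c)
    (m * (3 + e.steps + 9) + 7) hm (by decide) (by simp [forN, Program.natVars])
    (by simp [forN, Program.natVars]) (fun _ _ _ h => h) (by simp) ?_).mono
    (by ring_nf; exact le_rfl) fun _ _ h a c => h a c a.2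
  intro a ha s' hf hi hI
  refine (runs_forN_const (m := m) (fun k s'' =>
    (∀ c : Fin m, c < k → s''.realArr A a c = val ⟨a, ha⟩ c) ∧
    ∀ a' c : Fin m, a' < a → s''.realArr A a' c = val a' c) (3 + e.steps)
    ((hf.natVar 0 (by simp [forN, Program.natVars])).trans hm) (by decide)
    (by simp [Program.natVars]) (by simp [Program.natVars]) (fun _ _ _ h => h) ⟨by simp, hI⟩
    ?_).mono le_rfl ?_
  · rintro c hc s'' hf' hc' ⟨hI1, hI2⟩
    have hv7 : s''.natVar 7 = a := (hf'.natVar 7 (by simp [forN, Program.natVars])).trans hi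
    have he := step ⟨a, ha⟩ ⟨c, hc⟩ s'' (hf.trans hf'.forN) hv7 hc'
    refine ⟨_, _, .putReal _ _ _ _ _, by simp [NatExpr.steps], fun c' hlt => ?_,
      fun a' c' ha' => ?_⟩
    · simp only [store, NatExpr.eval, hv7, hc', he, true_and]
      split_ifs with h
      · rw [show c' = ⟨c, hc⟩ from Fin.ext h]
      · exact hI1 c' (by omega)
    · simp only [store, NatExpr.eval, hv7, hc', he, true_and]
      rw [if_neg (by omega)]
      exact hI2 a' c' ha'
  · rintro s'' - ⟨h1, h2⟩ a' c ha'
    by_cases h : (a' : ℕ) = a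
    · rw [h, h1 c c.2]
      exact congrArg (val · c) (Fin.ext h.symm)
    · exact h2 a' c (by omega)

end Machine

/-! ### A program for Edmonds' algorithm

The natural variable `0` holds the number of nodes, `1` the root, `2` the current stage (the number of
contractions so far), `3` the front of the path, `4` a flag telling whether the search goes on, and
`5` the supernode from which the last chosen arc comes; `6`, `9` and `10` are auxiliary, `7` and `8`
are loop variables.

The natural array `4` holds the adjacency matrix. Indexed by stages in the first index, `5` holds the
labels of supernodes, `6` marks the supernodes of the contracted cycle, and `7` and `8` hold the tails
and the heads of the chosen arcs. The row `0` of `9` holds the statuses of the nodes, the entry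
`(x, u)` of `10` the head of a cheapest arc from `u` into the supernode `x`, the row `0` of `11` the
names of the contracted cycles by stages, and the rows `0` and `1` of `12` the tails and the heads of
the expanded arcs. The real array `1` holds the cost matrix and `2` the reductions by stage and head.
-/

section EdmondsProgram

/-- The test whether two numbers are equal. -/
def Test.natEq (e₁ e₂ : NatExpr) : Test := .and (.natLe e₁ e₂) (.natLe e₂ e₁)

theorem Test.holds_natEq {e₁ e₂ : NatExpr} {s : Memory} :
    (Test.natEq e₁ e₂).holds s ↔ e₁.eval s = e₂.eval s := by
  simp only [Test.natEq, Test.holds]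
  omega

/-- Search all tails `u` in the variable `7` for a cheapest arc into the supernode `h` in the
variable `3`; the cost of the cheapest arc so far is kept in the real variable `0` and its tail in
the variable `9`, and the variable `10` tells whether an arc has been found. -/
def chooseBody : Program :=
  .ite (.and (.not (.natEq (.get 5 (.var 2) (.var 7)) (.var 3)))
      (.natEq (.get 4 (.var 7) (.get 10 (.var 3) (.var 7))) (.const 1)))
    (.ite (.and (.natEq (.var 10) (.const 1))
        (.realLe (.var 0) (.sub (.get 1 (.var 7) (.get 10 (.var 3) (.var 7)))
          (.get 2 (.var 2) (.get 10 (.var 3) (.var 7))))))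
      .skip
      (.seq (.setReal 0 (.sub (.get 1 (.var 7) (.get 10 (.var 3) (.var 7)))
          (.get 2 (.var 2) (.get 10 (.var 3) (.var 7)))))
        (.seq (.setNat 9 (.var 7)) (.setNat 10 (.const 1)))))
    .skip

/-- Record the arc found and put the supernode of its tail into the variable `5`. -/
def recordChoice : Program :=
  .seq (.putNat 7 (.var 2) (.var 3) (.var 9))
    (.seq (.putNat 8 (.var 2) (.var 3) (.get 10 (.var 3) (.var 9)))
      (.setNat 5 (.get 5 (.var 2) (.var 9))))

/-- Choose a cheapest arc into the front `h` of the path. -/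
def choose : Program :=
  .seq (.setNat 10 (.const 0)) (.seq (forN 7 chooseBody) recordChoice)

/-- Mark the supernode in the variable `6` and pass to the supernode its chosen arc comes from. -/
def markBody : Program :=
  .seq (.putNat 6 (.var 2) (.var 6) (.const 1))
    (.setNat 6 (.get 5 (.var 2) (.get 7 (.var 2) (.var 6))))

/-- Mark in the array `6` the cycle of chosen arcs through the supernode in the variable `5`. -/
def markCycle : Program :=
  .seq (forN 7 (.putNat 6 (.var 2) (.var 7) (.const 0)))
    (.seq (.setNat 6 (.var 5)) (forN 7 markBody))

/-- The test whether the node in the variable `7` lies in a marked supernode. -/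
def inCycle : Test := .natEq (.get 6 (.var 2) (.get 5 (.var 2) (.var 7))) (.const 1)

/-- The labels of the next stage. -/
def nextLabelBody : Program :=
  .ite inCycle (.putNat 5 (.add (.var 2) (.const 1)) (.var 7) (.var 5))
    (.putNat 5 (.add (.var 2) (.const 1)) (.var 7) (.get 5 (.var 2) (.var 7)))

/-- The tail of the arc chosen for the supernode of the node in the variable `7`. -/
def chosenTail : NatExpr := .get 7 (.var 2) (.get 5 (.var 2) (.var 7))

/-- The head of the arc chosen for the supernode of the node in the variable `7`. -/
def chosenHead : NatExpr := .get 8 (.var 2) (.get 5 (.var 2) (.var 7))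

/-- The reductions by head of the next stage. -/
def nextReductionBody : Program :=
  .ite inCycle
    (.putReal 2 (.add (.var 2) (.const 1)) (.var 7)
      (.add (.get 2 (.var 2) (.var 7))
        (.sub (.get 1 chosenTail chosenHead) (.get 2 (.var 2) chosenHead))))
    (.putReal 2 (.add (.var 2) (.const 1)) (.var 7) (.get 2 (.var 2) (.var 7)))

/-- Copy the row of the current stage of an array to the next stage. -/
def copyBody (A : ℕ) : Program :=
  .putNat A (.add (.var 2) (.const 1)) (.var 7) (.get A (.var 2) (.var 7))

/-- For the tail `u` in the variable `8`, compare the best heads in the supernodes in the variables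
`5` and `7` and keep the better one for the former. -/
def mergeBody : Program :=
  .ite (.and (.natEq (.get 4 (.var 8) (.get 10 (.var 7) (.var 8))) (.const 1))
      (.not (.and (.natEq (.get 4 (.var 8) (.get 10 (.var 5) (.var 8))) (.const 1))
        (.realLe
          (.sub (.get 1 (.var 8) (.get 10 (.var 5) (.var 8)))
            (.get 2 (.add (.var 2) (.const 1)) (.get 10 (.var 5) (.var 8))))
          (.sub (.get 1 (.var 8) (.get 10 (.var 7) (.var 8)))
            (.get 2 (.add (.var 2) (.const 1)) (.get 10 (.var 7) (.var 8))))))))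
    (.putNat 10 (.var 5) (.var 8) (.get 10 (.var 7) (.var 8)))
    .skip

/-- Merge the best heads of all supernodes of the cycle. -/
def mergeCycle : Program :=
  forN 7 (.ite (.natEq (.get 6 (.var 2) (.var 7)) (.const 1)) (forN 8 mergeBody) .skip)

/-- Record the name of the new supernode, make it the front of the path and enter the next stage. -/
def nextStage : Program :=
  .seq (.putNat 11 (.const 0) (.var 2) (.var 5))
    (.seq (.setNat 2 (.add (.var 2) (.const 1))) (.setNat 3 (.var 5)))

/-- Contract the cycle of chosen arcs through the supernode in the variable `5`. -/
def contractCycle : Program :=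
  .seq markCycle (.seq (forN 7 nextLabelBody) (.seq (forN 7 nextReductionBody)
    (.seq (forN 7 (copyBody 7)) (.seq (forN 7 (copyBody 8)) (.seq mergeCycle nextStage)))))

/-- Look for an unvisited node. -/
def searchBody : Program :=
  .ite (.natEq (.get 9 (.const 0) (.var 7)) (.const 0))
    (.seq (.setNat 3 (.var 7)) (.setNat 4 (.const 1))) .skip

/-- Declare the nodes of the path finished. -/
def finishBody : Program :=
  .ite (.natEq (.get 9 (.const 0) (.var 7)) (.const 1))
    (.putNat 9 (.const 0) (.var 7) (.const 2)) .skip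

/-- Finish the path and start a new one at an unvisited node, if there is one; the variable `4` tells
whether there is. -/
def advance : Program :=
  .seq (.setNat 4 (.const 0)) (.seq (forN 7 searchBody) (.seq (forN 7 finishBody)
    (.ite (.natEq (.var 4) (.const 1)) (.putNat 9 (.const 0) (.var 3) (.const 1)) .skip)))

/-- The search: grow paths until all nodes are visited. -/
def search : Program :=
  .while (.natEq (.var 4) (.const 1))
    (.seq choose (.ite (.natEq (.get 9 (.const 0) (.var 5)) (.const 0))
      (.seq (.putNat 9 (.const 0) (.var 5) (.const 1)) (.setNat 3 (.var 5)))
      (.ite (.natEq (.get 9 (.const 0) (.var 5)) (.const 1)) contractCycle advance)))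

/-- Every node is a supernode of its own, and the root is the only visited node. -/
def setup : Program :=
  .seq (forN 7 (.putNat 5 (.const 0) (.var 7) (.var 7)))
  (.seq (forN 7 (.putNat 7 (.const 0) (.var 7) (.var 7)))
  (.seq (forN 7 (.putNat 8 (.const 0) (.var 7) (.var 7)))
  (.seq (forN 7 (.putReal 2 (.const 0) (.var 7) (.sub (.var 0) (.var 0))))
  (.seq (forN 7 (.putNat 9 (.const 0) (.var 7) (.const 0)))
  (.seq (fill 10 (.var 7))
  (.seq (.putNat 9 (.const 0) (.var 1) (.const 1)) (.setNat 2 (.const 0))))))))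

/-- Give the supernodes of the cycle of the current stage the arcs of the cycle; `A` is the array of
the tails or of the heads and `B` the row in which the result is collected. -/
def expandBody (A B : ℕ) : Program :=
  .ite (.natEq (.get 6 (.var 2) (.var 7)) (.const 1))
    (.putNat 12 (.const B) (.var 7) (.get A (.var 2) (.var 7))) .skip

/-- Go back to the previous stage and look up the arc that enters its contracted cycle and the
supernode at which it does. -/
def expandStart : Program :=
  .seq (.setNat 2 (.sub (.var 2) (.const 1)))
  (.seq (.setNat 5 (.get 11 (.const 0) (.var 2)))
  (.seq (.setNat 6 (.get 12 (.const 0) (.var 5)))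
  (.seq (.setNat 9 (.get 12 (.const 1) (.var 5)))
    (.setNat 10 (.get 5 (.var 2) (.var 9))))))

/-- Keep the entering arc. -/
def expandEnd : Program :=
  .seq (.putNat 12 (.const 0) (.var 10) (.var 6)) (.putNat 12 (.const 1) (.var 10) (.var 9))

/-- Expand all contracted cycles, the last one first. -/
def expand : Program :=
  .seq (forN 7 (.putNat 12 (.const 0) (.var 7) (.get 7 (.var 2) (.var 7))))
  (.seq (forN 7 (.putNat 12 (.const 1) (.var 7) (.get 8 (.var 2) (.var 7))))
  (.while (.natLe (.const 1) (.var 2))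
    (.seq expandStart (.seq (forN 7 (expandBody 7 0)) (.seq (forN 7 (expandBody 8 1))
      expandEnd)))))

/-- Edmonds' algorithm for the digraph in the natural array `4` and the costs in the real array `1`;
the tails of the arcs of the output are left in the row `0` of the array `12`. -/
def edmonds : Program := .seq setup (.seq advance (.seq search expand))

/-! ### Correctness of the program -/

variable {m : ℕ} {G : Digraph (Fin m)} {b : Fin m → Fin m → ℝ} {r : Fin m} {s s' : Memory}

open Classical in
/-- The memory holds the input of Edmonds' algorithm. -/
structure HoldsInput (G : Digraph (Fin m)) (b : Fin m → Fin m → ℝ) (r : Fin m) (s : Memory) :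
    Prop where
  size : s.natVar 0 = m
  root : s.natVar 1 = r
  adj : ∀ u v : Fin m, s.natArr 4 u v = if G.Adj u v then 1 else 0
  cost : ∀ u v : Fin m, s.realArr 1 u v = b u v

theorem HoldsInput.of_frame {p : Program} (h : HoldsInput G b r s) (hf : Frame p s s')
    (h0 : 0 ∉ p.natVars) (h1 : 1 ∉ p.natVars) (h4 : 4 ∉ p.natArrs) (hr : 1 ∉ p.realArrs) :
    HoldsInput G b r s' :=
  ⟨(hf.natVar 0 h0).trans h.size, (hf.natVar 1 h1).trans h.root,
    fun u v => by rw [hf.natArr 4 h4, h.adj], fun u v => by rw [hf.realArr 1 hr, h.cost]⟩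

theorem HoldsInput.adj_eq_one (h : HoldsInput G b r s) {u v : Fin m} :
    s.natArr 4 u v = 1 ↔ G.Adj u v := by
  rw [h.adj]
  split_ifs with h' <;> simp [h']

/-- The data recorded by the search, by stages: the number `k` of contractions, the labels of
supernodes, the reductions by head, the chosen arcs, the contracted cycles and their names. -/
structure Record (m : ℕ) where
  k : ℕ
  π : ℕ → Fin m → Fin m
  Y : ℕ → Fin m → ℝ
  f : ℕ → Fin m → Fin m × Fin m
  C : ℕ → Set (Fin m)
  z : ℕ → Fin m

open Classical in
/-- The memory holds the recorded data. -/
structure HoldsRecord (D : Record m) (s : Memory) : Prop where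
  count : s.natVar 2 = D.k
  label : ∀ j ≤ D.k, ∀ v : Fin m, s.natArr 5 j v = D.π j v
  reduction : ∀ j ≤ D.k, ∀ v : Fin m, s.realArr 2 j v = D.Y j v
  tail : ∀ j ≤ D.k, ∀ v : Fin m, s.natArr 7 j v = (D.f j v).1
  head : ∀ j ≤ D.k, ∀ v : Fin m, s.natArr 8 j v = (D.f j v).2
  cycle : ∀ j < D.k, ∀ v : Fin m, s.natArr 6 j v = if v ∈ D.C j then 1 else 0
  name : ∀ j < D.k, s.natArr 11 0 j = D.z j

/-- The memory holds the statuses of the nodes and the best heads. -/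
structure HoldsSearch (σ : Fin m → ℕ) (H : Fin m → Fin m → Fin m) (s : Memory) : Prop where
  status : ∀ v : Fin m, s.natArr 9 0 v = σ v
  best : ∀ x u : Fin m, s.natArr 10 x u = H x u

theorem HoldsSearch.of_frame {p : Program} {σ : Fin m → ℕ} {H : Fin m → Fin m → Fin m}
    (h : HoldsSearch σ H s) (hf : Frame p s s') (h9 : 9 ∉ p.natArrs) (h10 : 10 ∉ p.natArrs) :
    HoldsSearch σ H s' :=
  ⟨fun v => by rw [hf.natArr 9 h9, h.status], fun x u => by rw [hf.natArr 10 h10, h.best]⟩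

/-- The record after the supernode `h` has chosen the arc `a`. -/
def Record.choose (D : Record m) (h : Fin m) (a : Fin m × Fin m) : Record m :=
  { D with f := Function.update D.f D.k (Function.update (D.f D.k) h a) }

/-- A choice is a scan of the best heads in the front of the path. -/
theorem runs_choose {D : Record m} {σ : Fin m → ℕ} {H : Fin m → Fin m → Fin m} {h : Fin m}
    (hG : StronglyConnected G) (hI : HoldsInput G b r s) (hD : HoldsRecord D s)
    (hH : HoldsSearch σ H s) (hh : s.natVar 3 = h)
    (hS : OnPath G r (D.π D.k) (reducedCost b (D.Y D.k)) (D.f D.k) σ H h) :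
    Runs choose s (100 * (m + 1)) fun s' => ∃ a : Fin m × Fin m,
      CheapestEntering G (D.π D.k) (reducedCost b (D.Y D.k)) h a ∧
      s'.natVar 5 = D.π D.k a.1 ∧ HoldsRecord (D.choose h a) s' := by
  set π := D.π D.k
  set c := reducedCost b (D.Y D.k)
  have hloop : Runs (forN 7 chooseBody)
      { s with natVar := Function.update s.natVar 10 0 } (m * (chooseBody.bound + 9) + 7)
      fun s' => ∃ u : Fin m, s'.natVar 9 = u ∧ π u ≠ h ∧ G.Adj u (H h u) ∧
        ∀ u', π u' ≠ h → G.Adj u' (H h u') → c u (H h u) ≤ c u' (H h u') := by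
    refine (runs_forN_const (fun n s' =>
      (s'.natVar 10 = 0 ∧ ∀ u : Fin m, u < n → ¬ (π u ≠ h ∧ G.Adj u (H h u))) ∨
      s'.natVar 10 = 1 ∧ ∃ u : Fin m, s'.natVar 9 = u ∧ s'.realVar 0 = c u (H h u) ∧ π u ≠ h ∧
        G.Adj u (H h u) ∧ ∀ u' : Fin m, u' < n → π u' ≠ h → G.Adj u' (H h u') →
          c u (H h u) ≤ c u' (H h u')) chooseBody.bound (by simpa using hI.size) (by decide)
      (by decide) (by decide) (fun k s v h => by simpa using h) (by simp) ?_).mono le_rfl ?_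
    · intro k hk s' hf hi hinv
      refine (runs_of_loopFree chooseBody s' (by decide)).mono le_rfl ?_
      rintro s'' - rfl
      obtain ⟨x, rfl⟩ : ∃ x : Fin m, (x : ℕ) = k := ⟨⟨k, hk⟩, rfl⟩
      have h2 : s'.natVar 2 = D.k := (hf.natVar 2 (by decide)).trans (by simpa using hD.count)
      have h3 : s'.natVar 3 = h := (hf.natVar 3 (by decide)).trans (by simpa using hh)
      have h5 : s'.natArr 5 D.k x = π x := by
        rw [hf.natArr 5 (by decide)]; exact hD.label _ le_rfl x
      have h10 : s'.natArr 10 h x = H h x := by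
        rw [hf.natArr 10 (by decide)]; exact hH.best h x
      have h4 : s'.natArr 4 x (H h x) = 1 ↔ G.Adj x (H h x) := by
        rw [hf.natArr 4 (by decide)]; exact hI.adj_eq_one
      have hc : s'.realArr 1 x (H h x) - s'.realArr 2 D.k (H h x) = c x (H h x) := by
        rw [hf.realArr 1 (by decide), hf.realArr 2 (by decide)]
        exact congrArg₂ _ (hI.cost _ _) (hD.reduction _ le_rfl _)
      have hlt : ∀ u : Fin m, (u : ℕ) < x + 1 → u = x ∨ (u : ℕ) < x := fun u hu => by
        rcases Nat.lt_succ_iff_lt_or_eq.1 hu with h | h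
        · exact Or.inr h
        · exact Or.inl (Fin.ext h)
      by_cases hcand : π x ≠ h ∧ G.Adj x (H h x)
      · have htest : (Test.and (.not (.natEq (.get 5 (.var 2) (.var 7)) (.var 3)))
            (.natEq (.get 4 (.var 7) (.get 10 (.var 3) (.var 7))) (.const 1))).holds s' := by
          simp only [Test.holds, Test.holds_natEq, NatExpr.eval, h2, h3, hi, h5, h10, h4]
          exact ⟨fun h' => hcand.1 (Fin.ext h'), hcand.2⟩
        rw [chooseBody, Program.run, if_pos htest, Program.run]
        simp only [Test.holds, Test.holds_natEq, NatExpr.eval, RealExpr.eval, h2, h3, hi, h10, hc]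
        split_ifs with hle
        · obtain ⟨h0, -⟩ | ⟨-, u, hu, hr, hu1, hu2, hmin⟩ := hinv
          · rw [hle.1] at h0
            cases h0
          · refine Or.inr ⟨hle.1, u, hu, hr, hu1, hu2, fun u' hu' hc1 hc2 => ?_⟩
            obtain rfl | hu' := hlt u' hu'
            · rw [← hr]
              exact hle.2
            · exact hmin u' hu' hc1 hc2
        · refine Or.inr ⟨by simp [Program.run, NatExpr.eval], x, by
            simp [Program.run, NatExpr.eval, hi], by
            simp [Program.run, RealExpr.eval, NatExpr.eval, h2, h3, hi, h10, hc], hcand.1, hcand.2,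
            fun u' hu' hc1 hc2 => ?_⟩
          obtain rfl | hu' := hlt u' hu'
          · exact le_rfl
          · obtain ⟨-, hno⟩ | ⟨h1, u, hu, hr, hu1, hu2, hmin⟩ := hinv
            · exact absurd ⟨hc1, hc2⟩ (hno u' hu')
            · rw [hr] at hle
              exact (le_of_not_ge fun h' => hle ⟨h1, h'⟩).trans (hmin u' hu' hc1 hc2)
      · have htest : ¬ (Test.and (.not (.natEq (.get 5 (.var 2) (.var 7)) (.var 3)))
            (.natEq (.get 4 (.var 7) (.get 10 (.var 3) (.var 7))) (.const 1))).holds s' := by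
          simp only [Test.holds, Test.holds_natEq, NatExpr.eval, h2, h3, hi, h5, h10, h4]
          exact fun h' => hcand ⟨fun h'' => h'.1 (congrArg _ h''), h'.2⟩
        rw [chooseBody, Program.run, if_neg htest, Program.run]
        refine hinv.imp (fun ⟨h0, hno⟩ => ⟨h0, fun u hu => ?_⟩)
          fun ⟨h1, u, hu, hr, hu1, hu2, hmin⟩ => ⟨h1, u, hu, hr, hu1, hu2, fun u' hu' hc1 hc2 => ?_⟩
        · obtain rfl | hu := hlt u hu
          · exact hcand
          · exact hno u hu
        · obtain rfl | hu' := hlt u' hu'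
          · exact absurd ⟨hc1, hc2⟩ hcand
          · exact hmin u' hu' hc1 hc2
    · rintro s' - (⟨-, hno⟩ | ⟨-, u, hu, -, h1, h2, hmin⟩)
      · obtain ⟨u, hu⟩ := hS.exists_candidate hG
        exact absurd hu (hno u u.2)
      · exact ⟨u, hu, h1, h2, fun u' => hmin u' u'.2⟩
  have hb : chooseBody.bound ≤ 70 := by decide
  have hb' : recordChoice.bound ≤ 20 := by decide
  refine (Runs.seq (T' := m * (chooseBody.bound + 9) + 7 + recordChoice.bound)
    ⟨_, _, .setNat s 10 (.const 0), le_rfl, rfl⟩ fun s₁ hf₁ hs₁ => ?_).mono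
    (T := 1 + NatExpr.steps (.const 0) + (m * (chooseBody.bound + 9) + 7 + recordChoice.bound))
    (R := fun s' => ∃ a : Fin m × Fin m, CheapestEntering G π c h a ∧
      s'.natVar 5 = π a.1 ∧ HoldsRecord (D.choose h a) s') ?_ fun _ _ h => h
  · subst hs₁
    refine hloop.seq fun s₂ hf ⟨u, hu, hu1, hu2, hmin⟩ => ?_
    refine (runs_of_loopFree recordChoice s₂ (by decide)).mono le_rfl ?_
    rintro s₃ hf₃ rfl
    refine ⟨(u, H h u), hS.cheapestEntering hS.head hu1 hu2 hmin, ?_, ?_⟩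
    all_goals
      have h2 : s₂.natVar 2 = D.k := (hf.natVar 2 (by decide)).trans (by simpa using hD.count)
      have h3 : s₂.natVar 3 = h := (hf.natVar 3 (by decide)).trans (by simpa using hh)
      have h5 : s₂.natArr 5 = s.natArr 5 := hf.natArr 5 (by decide)
      have h10 : s₂.natArr 10 = s.natArr 10 := hf.natArr 10 (by decide)
    · have h5' : s.natArr 5 D.k u = π u := hD.label _ le_rfl u
      simp [recordChoice, Program.run, NatExpr.eval, store, h2, hu, h5, h5']
    · have hup : ∀ (j : ℕ) (v : Fin m), (D.choose h (u, H h u)).f j v =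
          if j = D.k ∧ v = h then (u, H h u) else D.f j v := by
        intro j v
        by_cases hj : j = D.k
        · subst hj
          by_cases hv : v = h <;> simp [Record.choose, hv]
        · simp [Record.choose, hj]
      refine ⟨h2 ▸ hf₃.natVar 2 (by decide), fun j hj v => ?_, fun j hj v => ?_, fun j hj v => ?_,
        fun j hj v => ?_, fun j hj v => ?_, fun j hj => ?_⟩
      · rw [hf₃.natArr 5 (by decide), h5]
        exact hD.label j hj v
      · rw [hf₃.realArr 2 (by decide), hf.realArr 2 (by decide)]
        exact hD.reduction j hj v
      · rw [hup]
        have := hD.tail j hj v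
        have h7 : s₂.natArr 7 = s.natArr 7 := hf.natArr 7 (by decide)
        simp only [recordChoice, Program.run, NatExpr.eval, store, h2, h3, hu]
        simp only [true_and, h7, Fin.ext_iff]
        split_ifs <;> simp_all
      · rw [hup]
        have := hD.head j hj v
        have h8 : s₂.natArr 8 = s.natArr 8 := hf.natArr 8 (by decide)
        have h10' := hH.best h u
        simp only [recordChoice, Program.run, NatExpr.eval, store, h2, h3, hu]
        simp only [true_and, h8, h10, h10', Fin.ext_iff]
        split_ifs <;> simp_all
      · rw [hf₃.natArr 6 (by decide), hf.natArr 6 (by decide)]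
        exact hD.cycle j hj v
      · rw [hf₃.natArr 11 (by decide), hf.natArr 11 (by decide)]
        exact hD.name j hj
  · simp only [NatExpr.steps]
    nlinarith

end EdmondsProgram

/-! ### Contraction of a cycle by the program -/

section EdmondsProgram

variable {m : ℕ} {G : Digraph (Fin m)} {b : Fin m → Fin m → ℝ} {r : Fin m} {s s' : Memory}

section Cycle

variable {k : ℕ} {π : Fin m → Fin m} {f : Fin m → Fin m × Fin m} {t : Fin m}

open Classical in
/-- The cycle is traversed in `m` steps, whatever its length. -/
theorem runs_markCycle (hm : s.natVar 0 = m) (h2 : s.natVar 2 = k) (h5 : s.natVar 5 = t)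
    (hπ : ∀ v : Fin m, s.natArr 5 k v = π v) (hf : ∀ v : Fin m, s.natArr 7 k v = (f v).1) :
    Runs markCycle s (60 * (m + 1)) fun s' => (∀ a, a ≠ k → s'.natArr 6 a = s.natArr 6 a) ∧
      ∀ v : Fin m, s'.natArr 6 k v = if v ∈ orbit π f t then 1 else 0 := by
  have hb : (Program.putNat 6 (.var 2) (.var 7) (.const 0)).bound ≤ 10 := by decide
  have hb' : markBody.bound ≤ 20 := by decide
  refine Runs.mono (T := (m * ((Program.putNat 6 (.var 2) (.var 7) (.const 0)).bound + 9) + 7) +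
    (2 + (m * (markBody.bound + 9) + 7))) (Runs.seq (runs_fillRow (fun s => s.natArr 6)
      (fun _ _ => rfl) k (fun _ : Fin m => 0) hm (by decide) rfl (by decide) (by decide) ?_) ?_)
    (by nlinarith) fun _ _ h => h
  · intro x s₁ hf₁ hi _ _ a c
    have h2' : s₁.natVar 2 = k := (hf₁.natVar 2 (by decide)).trans h2
    simp [Program.run, NatExpr.eval, store, h2', hi]
  rintro s₁ hf₁ ⟨hrow, hzero⟩
  refine Runs.seq (T := 2) (R := fun s' => s' = { s₁ with natVar := Function.update s₁.natVar 6 t })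
    ⟨_, _, .setNat s₁ 6 (.var 5), by simp [NatExpr.steps], by
      simp [NatExpr.eval, (hf₁.natVar 5 (by decide)).trans h5]⟩ ?_
  rintro s₂ hf₂ rfl
  have hm' : s₁.natVar 0 = m := (hf₁.natVar 0 (by decide)).trans hm
  refine (runs_forN_const (i := 7) (p := markBody) (m := m)
    (s := { s₁ with natVar := Function.update s₁.natVar 6 t })
    (fun n s' => s'.natVar 6 = ((pred π f)^[n] t : Fin m) ∧
    (∀ a, a ≠ k → s'.natArr 6 a = s.natArr 6 a) ∧
    ∀ v : Fin m, s'.natArr 6 k v = if ∃ i < n, (pred π f)^[i] t = v then 1 else 0)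
    markBody.bound (by simpa using hm') (by decide) (by decide) (by decide)
    (fun n s v h => by simpa using h) ⟨by simp, hrow, by simpa using hzero⟩ ?_).mono le_rfl ?_
  · rintro n hn s₃ hf₃ - ⟨h6, hr, hmark⟩
    refine (runs_of_loopFree markBody s₃ rfl).mono le_rfl ?_
    rintro s₄ - rfl
    have h2' : s₃.natVar 2 = k := (hf₃.natVar 2 (by decide)).trans
      (by simpa using (hf₁.natVar 2 (by decide)).trans h2)
    have h7 : s₃.natArr 7 = s.natArr 7 := (hf₃.natArr 7 (by decide)).trans
      (hf₁.natArr 7 (by decide))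
    have h5' : s₃.natArr 5 = s.natArr 5 := (hf₃.natArr 5 (by decide)).trans
      (hf₁.natArr 5 (by decide))
    refine ⟨?_, fun a ha => ?_, fun v => ?_⟩
    · simp [markBody, Program.run, NatExpr.eval, store, h2', h6, h5', h7, hf, hπ,
        Function.iterate_succ_apply', -Function.iterate_succ, pred]
    · rw [← hr a ha]
      ext c
      simp [markBody, Program.run, NatExpr.eval, store, h2', ha]
    · have : (∃ i < n + 1, (pred π f)^[i] t = v) ↔
          (v : ℕ) = ((pred π f)^[n] t : Fin m) ∨ ∃ i < n, (pred π f)^[i] t = v := by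
        simp only [Nat.lt_succ_iff_lt_or_eq, or_and_right, exists_or, exists_eq_left, Fin.ext_iff]
        rw [or_comm, eq_comm]
      simp only [this, markBody, Program.run, NatExpr.eval, store, h2', h6, true_and, hmark]
      by_cases h1 : (v : ℕ) = ((pred π f)^[n] t : Fin m)
      · rw [if_pos h1, if_pos (Or.inl h1)]
      by_cases h3 : ∃ i < n, (pred π f)^[i] t = v
      · rw [if_neg h1, if_pos h3, if_pos (Or.inr h3)]
      · rw [if_neg h1, if_neg h3, if_neg (not_or.2 ⟨h1, h3⟩)]
  · rintro s₃ - ⟨-, hr, hmark⟩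
    refine ⟨hr, fun v => ?_⟩
    rw [hmark]
    simp only [mem_orbit_iff_lt, Fintype.card_fin]

variable {C : Set (Fin m)}

theorem holds_inCycle_iff [DecidablePred (· ∈ C)] (h2 : s.natVar 2 = k) {x : Fin m}
    (h7 : s.natVar 7 = x) (hπ : s.natArr 5 k x = π x)
    (hM : s.natArr 6 k (π x) = if π x ∈ C then 1 else 0) : inCycle.holds s ↔ π x ∈ C := by
  simp only [inCycle, Test.holds_natEq, NatExpr.eval, h2, h7, hπ, hM]
  split_ifs with h <;> simp [h]

theorem runs_nextLabel [DecidablePred (· ∈ C)] (hm : s.natVar 0 = m) (h2 : s.natVar 2 = k)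
    (h5 : s.natVar 5 = t) (hπ : ∀ v : Fin m, s.natArr 5 k v = π v)
    (hM : ∀ v : Fin m, s.natArr 6 k v = if v ∈ C then 1 else 0) :
    Runs (forN 7 nextLabelBody) s (60 * (m + 1)) fun s' =>
      (∀ a, a ≠ k + 1 → s'.natArr 5 a = s.natArr 5 a) ∧
      ∀ v : Fin m, s'.natArr 5 (k + 1) v = contractMap π C t v := by
  have hb : nextLabelBody.bound ≤ 50 := by decide
  refine Runs.mono (runs_fillRow (fun s => s.natArr 5) (fun _ _ => rfl) (k + 1)
    (fun v : Fin m => ((contractMap π C t v : Fin m) : ℕ)) hm (by decide) rfl (by decide)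
    (by decide) ?_) (by nlinarith) fun _ _ h => h
  intro x s₁ hf₁ hi hrow _ a c
  have h2' : s₁.natVar 2 = k := (hf₁.natVar 2 (by decide)).trans h2
  have h5' : s₁.natVar 5 = t := (hf₁.natVar 5 (by decide)).trans h5
  have hπ' : s₁.natArr 5 k x = π x := by rw [hrow k (by omega), hπ]
  have hc := holds_inCycle_iff (C := C) h2' hi hπ' (by rw [hf₁.natArr 6 (by decide), hM])
  by_cases hx : π x ∈ C
  · simp [nextLabelBody, Program.run, hc, hx, NatExpr.eval, store, h2', h5', hi, contractMap]
  · simp [nextLabelBody, Program.run, hc, hx, NatExpr.eval, store, h2', hi, hπ', contractMap]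

theorem runs_nextReduction {Y : Fin m → ℝ} [DecidablePred (· ∈ C)] (hI : HoldsInput G b r s)
    (h2 : s.natVar 2 = k)
    (hπ : ∀ v : Fin m, s.natArr 5 k v = π v) (hY : ∀ v : Fin m, s.realArr 2 k v = Y v)
    (hft : ∀ v : Fin m, s.natArr 7 k v = (f v).1) (hfh : ∀ v : Fin m, s.natArr 8 k v = (f v).2)
    (hM : ∀ v : Fin m, s.natArr 6 k v = if v ∈ C then 1 else 0) :
    Runs (forN 7 nextReductionBody) s (90 * (m + 1)) fun s' =>
      (∀ a, a ≠ k + 1 → s'.realArr 2 a = s.realArr 2 a) ∧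
      ∀ v : Fin m, s'.realArr 2 (k + 1) v = contractReduction π b Y f C v := by
  have hb : nextReductionBody.bound ≤ 80 := by decide
  refine Runs.mono (runs_fillRow (fun s => s.realArr 2) (fun _ _ => rfl) (k + 1)
    (fun v : Fin m => contractReduction π b Y f C v) hI.size (by decide) rfl (by decide)
    (by decide) ?_) (by nlinarith) fun _ _ h => h
  intro x s₁ hf₁ hi hrow _ a c
  have h2' : s₁.natVar 2 = k := (hf₁.natVar 2 (by decide)).trans h2
  have hπ' : ∀ v : Fin m, s₁.natArr 5 k v = π v := fun v => by
    rw [hf₁.natArr 5 (by decide), hπ]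
  have hft' : ∀ v : Fin m, s₁.natArr 7 k v = (f v).1 := fun v => by
    rw [hf₁.natArr 7 (by decide), hft]
  have hfh' : ∀ v : Fin m, s₁.natArr 8 k v = (f v).2 := fun v => by
    rw [hf₁.natArr 8 (by decide), hfh]
  have hY' : ∀ v : Fin m, s₁.realArr 2 k v = Y v := fun v => by rw [hrow k (by omega), hY]
  have hb' : ∀ u v : Fin m, s₁.realArr 1 u v = b u v := fun u v => by
    rw [hf₁.realArr 1 (by decide), hI.cost]
  have hc := holds_inCycle_iff (C := C) h2' hi (hπ' x) (by rw [hf₁.natArr 6 (by decide), hM])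
  by_cases hx : π x ∈ C
  · simp [nextReductionBody, Program.run, hc, hx, NatExpr.eval, RealExpr.eval, store, h2', hi,
      contractReduction, chosenTail, chosenHead, hπ', hft', hfh', hY', hb', reducedCost]
  · simp [nextReductionBody, Program.run, hc, hx, NatExpr.eval, RealExpr.eval, store, h2', hi,
      hY', contractReduction]

theorem runs_copy {A : ℕ} {g : Fin m → Fin m} (hm : s.natVar 0 = m) (h2 : s.natVar 2 = k)
    (hA : ∀ v : Fin m, s.natArr A k v = g v) :
    Runs (forN 7 (copyBody A)) s (30 * (m + 1)) fun s' =>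
      (∀ a, a ≠ k + 1 → s'.natArr A a = s.natArr A a) ∧
      ∀ v : Fin m, s'.natArr A (k + 1) v = g v := by
  have hb : (copyBody A).bound ≤ 20 := by simp [copyBody, Program.bound, NatExpr.steps]
  refine Runs.mono (runs_fillRow (fun s => s.natArr A) (fun _ _ => rfl) (k + 1)
    (fun v : Fin m => (g v : ℕ)) hm (by decide) rfl (by simp [copyBody, Program.natVars])
    (by simp [copyBody, Program.natVars]) ?_) (by nlinarith) fun _ _ h => h
  intro x s₁ hf₁ hi hrow _ a c
  have h2' : s₁.natVar 2 = k :=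
    (hf₁.natVar 2 (by simp [forN, copyBody, Program.natVars])).trans h2
  have hA' : s₁.natArr A k x = g x := by rw [hrow k (by omega), hA]
  simp [copyBody, Program.run, NatExpr.eval, store, h2', hi, hA']

end Cycle

section Merge

variable {k : ℕ} {π : Fin m → Fin m} {C : Set (Fin m)} {t : Fin m} {Y : Fin m → ℝ}

theorem BestHead.congr_set {V : Type*} {G : Digraph V} {c : V → V → ℝ} {S T : Set V} {u v : V}
    (h : BestHead G c S u v) (hST : S = T) : BestHead G c T u v := hST ▸ h

/-- Merging the best heads `w` in the row `x` into the best heads `g` in the row `t`. -/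
theorem runs_mergeRow {x : Fin m} {S T : Set (Fin m)} {g w : Fin m → Fin m}
    (hI : HoldsInput G b r s) (h2 : s.natVar 2 = k) (h5 : s.natVar 5 = t) (h7 : s.natVar 7 = x)
    (hY : ∀ v : Fin m, s.realArr 2 (k + 1) v = Y v)
    (hw : ∀ u : Fin m, s.natArr 10 x u = w u) (hbw : ∀ u, BestHead G (reducedCost b Y) T u (w u))
    (hg : ∀ u : Fin m, s.natArr 10 t u = g u) (hbg : ∀ u, BestHead G (reducedCost b Y) S u (g u)) :
    Runs (forN 8 mergeBody) s (100 * (m + 1)) fun s' =>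
      (∀ a, a ≠ (t : ℕ) → s'.natArr 10 a = s.natArr 10 a) ∧ ∃ g' : Fin m → Fin m,
        (∀ u : Fin m, s'.natArr 10 t u = g' u) ∧
        ∀ u, BestHead G (reducedCost b Y) (S ∪ T) u (g' u) := by
  classical
  have hb : mergeBody.bound ≤ 90 := by decide
  let c := reducedCost b Y
  let better : Fin m → Prop := fun u =>
    G.Adj u (w u) ∧ ¬ (G.Adj u (g u) ∧ c u (g u) ≤ c u (w u))
  refine Runs.mono (runs_fillRow (fun s => s.natArr 10) (fun _ _ => rfl) (t : ℕ)
    (fun u : Fin m => ((if better u then w u else g u : Fin m) : ℕ)) hI.size (by decide) rfl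
    (by decide) (by decide) ?_) (by nlinarith) ?_
  · intro u s₁ hf₁ hi hrow hrow' a e
    have h2' : s₁.natVar 2 = k := (hf₁.natVar 2 (by decide)).trans h2
    have h5' : s₁.natVar 5 = t := (hf₁.natVar 5 (by decide)).trans h5
    have h7' : s₁.natVar 7 = x := (hf₁.natVar 7 (by decide)).trans h7
    have hg' : s₁.natArr 10 t u = g u := by rw [hrow' u le_rfl, hg]
    have hw' : s₁.natArr 10 x u = w u := by
      by_cases hxt : (x : ℕ) = t
      · rw [← hw, hxt, hrow' u le_rfl]
      · rw [hrow x hxt, hw]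
    have hI' := hI.of_frame hf₁ (by decide) (by decide) (by decide) (by decide)
    have hY' : ∀ v : Fin m, s₁.realArr 2 (k + 1) v = Y v := fun v => by
      rw [hf₁.realArr 2 (by decide), hY]
    have hc : ∀ v : Fin m, s₁.realArr 1 u v - s₁.realArr 2 (k + 1) v = c u v := fun v => by
      rw [hY', hI'.cost]
      rfl
    rw [mergeBody, Program.run]
    simp only [Test.holds, Test.holds_natEq, NatExpr.eval, RealExpr.eval, h2', h5', h7', hi, hg',
      hw', hI'.adj_eq_one, hc]
    by_cases hbet : better u
    · rw [if_pos hbet]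
      simp [Program.run, NatExpr.eval, store, h5', h7', hi, hw', hbet]
    · rw [if_neg hbet]
      simp only [Program.run, if_neg hbet]
      split_ifs with h
      · rw [h.1, h.2, hg']
      · rfl
  · rintro s₁ - ⟨hrow, hval⟩
    refine ⟨hrow, _, hval, fun u => ?_⟩
    by_cases hbet : better u
    · rw [if_pos hbet, Set.union_comm]
      refine (hbw u).union (hbg u) (fun _ => ?_) fun _ => hbet.1
      by_cases hadj : G.Adj u (g u)
      · exact Or.inl (le_of_not_ge fun h => hbet.2 ⟨hadj, h⟩)
      · exact Or.inr hadj
    · rw [if_neg hbet]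
      have : G.Adj u (w u) → G.Adj u (g u) ∧ c u (g u) ≤ c u (w u) := fun h => by
        by_contra h'
        exact hbet ⟨h, h'⟩
      refine (hbg u).union (hbw u) (fun _ => ?_) fun h => (this h).1
      by_cases hadj : G.Adj u (w u)
      · exact Or.inl (this hadj).2
      · exact Or.inr hadj

open Classical in
/-- The time is proportional to `m` times the number of supernodes on the cycle: the rows of the other
supernodes are skipped after one test. -/
theorem runs_mergeCycle {H : Fin m → Fin m → Fin m} {C : Finset (Fin m)}
    (hI : HoldsInput G b r s) (h2 : s.natVar 2 = k) (h5 : s.natVar 5 = t) (htC : t ∈ C)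
    (hY : ∀ v : Fin m, s.realArr 2 (k + 1) v = Y v)
    (hM : ∀ v : Fin m, s.natArr 6 k v = if v ∈ C then 1 else 0)
    (hH : ∀ x u : Fin m, s.natArr 10 x u = H x u)
    (hb : ∀ x ∈ C, ∀ u, BestHead G (reducedCost b Y) {v | π v = x} u (H x u)) :
    Runs mergeCycle s (100 * (m + 1) * (C.card + 1)) fun s' =>
      ∃ H' : Fin m → Fin m → Fin m, (∀ x u : Fin m, s'.natArr 10 x u = H' x u) ∧
        (∀ x, x ≠ t → H' x = H x) ∧
        ∀ u, BestHead G (reducedCost b Y) {v | π v ∈ (C : Set (Fin m))} u (H' t u) := by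
  have hm := hI.size
  -- the time spent on the row `n`, apart from the loop and the test
  let T : ℕ → ℕ := fun n => if ∃ h : n < m, (⟨n, h⟩ : Fin m) ∈ C then 100 * (m + 1) else 1
  have hsum : ∑ n ∈ Finset.range m, (12 + T n + 9) + 7 ≤ 100 * (m + 1) * (C.card + 1) := by
    have h1 : ∀ x : Fin m, 12 + T x + 9 ≤ 22 + if x ∈ C then 100 * (m + 1) else 0 := by
      intro x
      have : (∃ h : (x : ℕ) < m, (⟨x, h⟩ : Fin m) ∈ C) ↔ x ∈ C := by simp
      simp only [T, this]
      split_ifs <;> omega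
    have h2 : ∑ x : Fin m, (22 + if x ∈ C then 100 * (m + 1) else 0) =
        m * 22 + C.card * (100 * (m + 1)) := by
      rw [Finset.sum_add_distrib, Finset.sum_ite_mem]
      simp
    rw [Finset.sum_range]
    have h3 := Finset.sum_le_sum fun (x : Fin m) (_ : x ∈ Finset.univ) => h1 x
    rw [h2] at h3
    nlinarith
  refine (runs_forN (m := m) (fun n s' => (∀ a, a ≠ (t : ℕ) → s'.natArr 10 a = s.natArr 10 a) ∧
    ∃ g : Fin m → Fin m, (∀ u : Fin m, s'.natArr 10 t u = g u) ∧
      ∀ u, BestHead G (reducedCost b Y) {v | π v = t ∨ π v ∈ C ∧ (π v : ℕ) < n} u (g u))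
    (fun n => 12 + T n) hm (by decide) (by decide) (by decide) (fun _ _ _ h => h)
    ⟨fun _ _ => rfl, H t, hH t, fun u => (hb t htC u).congr_set (by simp)⟩ ?_).mono hsum ?_
  · rintro n hn s₁ hf₁ hi ⟨hrow, g, hg, hbg⟩
    obtain ⟨x, rfl⟩ : ∃ x : Fin m, (x : ℕ) = n := ⟨⟨n, hn⟩, rfl⟩
    have h2' : s₁.natVar 2 = k := (hf₁.natVar 2 (by decide)).trans h2
    have h5' : s₁.natVar 5 = t := (hf₁.natVar 5 (by decide)).trans h5
    have hI' := hI.of_frame hf₁ (by decide) (by decide) (by decide) (by decide)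
    have hY' : ∀ v : Fin m, s₁.realArr 2 (k + 1) v = Y v := fun v => by
      rw [hf₁.realArr 2 (by decide), hY]
    have hM' : s₁.natArr 6 k x = if x ∈ C then 1 else 0 := by
      rw [hf₁.natArr 6 (by decide), hM]
    have htest : (Test.natEq (.get 6 (.var 2) (.var 7)) (.const 1)).holds s₁ ↔ x ∈ C := by
      simp only [Test.holds_natEq, NatExpr.eval, h2', hi, hM']
      split_ifs with h <;> simp [h]
    have hT : T x = if x ∈ C then 100 * (m + 1) else 1 := by
      have : (∃ h : (x : ℕ) < m, (⟨x, h⟩ : Fin m) ∈ C) ↔ x ∈ C := by simp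
      simp only [T, this]
    refine (Runs.ite (T := T x) (fun h => ?_) fun h => ?_).mono
      (by simp [Test.steps, Test.natEq, NatExpr.steps]) fun _ _ h => h
    · rw [htest] at h
      rw [hT, if_pos h]
      -- The row of `t` itself is merged into itself, which does no harm.
      by_cases hxt : x = t
      · subst hxt
        refine (runs_mergeRow hI' h2' h5' hi hY' hg hbg hg hbg).mono le_rfl ?_
        rintro s₂ - ⟨hrow₂, g', hg', hbg'⟩
        refine ⟨fun a ha => (hrow₂ a ha).trans (hrow a ha), g', hg', fun u => ?_⟩
        refine (hbg' u).congr_set (Set.ext fun v => ?_)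
        simp only [Set.union_self, Set.mem_ofPred_eq, Nat.lt_succ_iff_lt_or_eq, Fin.ext_iff]
        tauto
      · refine (runs_mergeRow hI' h2' h5' hi hY' (w := H x) (fun u => ?_) (hb x h) hg hbg).mono
          le_rfl ?_
        · rw [hrow x fun h => hxt (Fin.ext h), hH]
        rintro s₂ - ⟨hrow₂, g', hg', hbg'⟩
        refine ⟨fun a ha => (hrow₂ a ha).trans (hrow a ha), g', hg', fun u => ?_⟩
        refine (hbg' u).congr_set (Set.ext fun v => ?_)
        simp only [Set.mem_union, Set.mem_ofPred_eq, Nat.lt_succ_iff_lt_or_eq, ← Fin.ext_iff]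
        constructor
        · rintro ((h' | ⟨h1, h3⟩) | h')
          · exact Or.inl h'
          · exact Or.inr ⟨h1, Or.inl h3⟩
          · exact Or.inr ⟨h' ▸ h, Or.inr h'⟩
        · rintro (h' | ⟨h1, h3 | h3⟩)
          · exact Or.inl (Or.inl h')
          · exact Or.inl (Or.inr ⟨h1, h3⟩)
          · exact Or.inr h3
    · rw [htest] at h
      rw [hT, if_neg h]
      refine ⟨_, _, .skip s₁, le_rfl, hrow, g, hg, fun u => (hbg u).congr_set (Set.ext fun v => ?_)⟩
      simp only [Set.mem_ofPred_eq, Nat.lt_succ_iff_lt_or_eq, ← Fin.ext_iff]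
      refine or_congr_right (and_congr_right fun h1 => ?_)
      exact ⟨Or.inl, fun h' => h'.resolve_right fun h3 => h (h3 ▸ h1)⟩
  · rintro s₁ - ⟨hrow, g, hg, hbg⟩
    refine ⟨Function.update H t g, fun x u => ?_, fun x hx => Function.update_of_ne hx _ _,
      fun u => ?_⟩
    · by_cases hxt : x = t
      · rw [hxt, hg, Function.update_self]
      · rw [Function.update_of_ne hxt, hrow x fun h => hxt (Fin.ext h), hH]
    · rw [Function.update_self]
      refine (hbg u).congr_set (Set.ext fun v => ?_)
      simp only [Set.mem_ofPred_eq, (π v).2, and_true, Finset.mem_coe]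
      exact ⟨fun h => h.elim (fun h => h ▸ htC) id, Or.inr⟩

end Merge

/-- The record after the contraction of the cycle `C` to a supernode `t`. -/
noncomputable def Record.contract (D : Record m) (b : Fin m → Fin m → ℝ) (C : Set (Fin m))
    (t : Fin m) : Record m where
  k := D.k + 1
  π := Function.update D.π (D.k + 1) (contractMap (D.π D.k) C t)
  Y := Function.update D.Y (D.k + 1) (contractReduction (D.π D.k) b (D.Y D.k) (D.f D.k) C)
  f := Function.update D.f (D.k + 1) (D.f D.k)
  C := Function.update D.C D.k C
  z := Function.update D.z D.k t

theorem runs_contractCycle {D : Record m} {σ : Fin m → ℕ} {H : Fin m → Fin m → Fin m} {t : Fin m}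
    {C : Finset (Fin m)} (hI : HoldsInput G b r s) (hD : HoldsRecord D s) (hH : HoldsSearch σ H s)
    (h5 : s.natVar 5 = t) (hC : (C : Set (Fin m)) = orbit (D.π D.k) (D.f D.k) t)
    (hb : ∀ x ∈ C, ∀ u, BestHead G (contractCost (D.π D.k) (reducedCost b (D.Y D.k)) (D.f D.k) C)
      {v | D.π D.k v = x} u (H x u)) :
    Runs contractCycle s (500 * (m + 1) * (C.card + 1)) fun s' =>
      ∃ H' : Fin m → Fin m → Fin m, HoldsRecord (D.contract b C t) s' ∧ HoldsSearch σ H' s' ∧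
        s'.natVar 3 = t ∧ (∀ x, x ≠ t → H' x = H x) ∧
        ∀ u, BestHead G (contractCost (D.π D.k) (reducedCost b (D.Y D.k)) (D.f D.k) C)
          {v | D.π D.k v ∈ (C : Set (Fin m))} u (H' t u) := by
  classical
  have htC : t ∈ C := by
    rw [← Finset.mem_coe, hC]
    exact mem_orbit_self t
  rw [contractCost_reducedCost] at hb ⊢
  set π := D.π D.k
  set f := D.f D.k
  have hπ := hD.label D.k le_rfl
  have hft := hD.tail D.k le_rfl
  have hfh := hD.head D.k le_rfl
  have hY := hD.reduction D.k le_rfl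
  have hnb : nextStage.bound ≤ 20 := by decide
  refine Runs.mono (T := 60 * (m + 1) + (60 * (m + 1) + (90 * (m + 1) + (30 * (m + 1) +
    (30 * (m + 1) + (100 * (m + 1) * (C.card + 1) + nextStage.bound)))))) ?_ (by nlinarith)
    fun _ _ h => h
  refine (runs_markCycle hI.size hD.count h5 hπ hft).seq fun s₁ e₁ ⟨hrow₁, hM₁⟩ => ?_
  have hI₁ := hI.of_frame e₁ (by decide) (by decide) (by decide) (by decide)
  have hM₁' : ∀ v : Fin m, s₁.natArr 6 D.k v = if v ∈ (C : Set (Fin m)) then 1 else 0 := fun v => by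
    simp only [hM₁, hC]
    rfl
  have c₁ : s₁.natVar 2 = D.k := (e₁.natVar 2 (by decide)).trans hD.count
  have t₁ : s₁.natVar 5 = t := (e₁.natVar 5 (by decide)).trans h5
  refine (runs_nextLabel (π := π) hI₁.size c₁ t₁ (by rwa [e₁.natArr 5 (by decide)]) hM₁').seq
    fun s₂ e₂ ⟨hrow₂, hπ₂⟩ => ?_
  have hI₂ := hI₁.of_frame e₂ (by decide) (by decide) (by decide) (by decide)
  have c₂ : s₂.natVar 2 = D.k := (e₂.natVar 2 (by decide)).trans c₁
  refine (runs_nextReduction (C := C) hI₂ c₂ (π := π) (f := f) (Y := D.Y D.k) (fun v => ?_)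
    (fun v => ?_) (fun v => ?_) (fun v => ?_) (fun v => ?_)).seq fun s₃ e₃ ⟨hrow₃, hY₃⟩ => ?_
  · rw [hrow₂ D.k (by omega), e₁.natArr 5 (by decide), hπ]
  · rw [e₂.realArr 2 (by decide), e₁.realArr 2 (by decide), hY]
  · rw [e₂.natArr 7 (by decide), e₁.natArr 7 (by decide), hft]
  · rw [e₂.natArr 8 (by decide), e₁.natArr 8 (by decide), hfh]
  · rw [e₂.natArr 6 (by decide), hM₁']
  have hI₃ := hI₂.of_frame e₃ (by decide) (by decide) (by decide) (by decide)
  have c₃ : s₃.natVar 2 = D.k := (e₃.natVar 2 (by decide)).trans c₂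
  refine (runs_copy hI₃.size c₃ (A := 7) (g := fun v => (f v).1) fun v => ?_).seq
    fun s₄ e₄ ⟨hrow₄, hft₄⟩ => ?_
  · rw [e₃.natArr 7 (by decide), e₂.natArr 7 (by decide), e₁.natArr 7 (by decide), hft]
  have hI₄ := hI₃.of_frame e₄ (by decide) (by decide) (by decide) (by decide)
  have c₄ : s₄.natVar 2 = D.k := (e₄.natVar 2 (by decide)).trans c₃
  refine (runs_copy hI₄.size c₄ (A := 8) (g := fun v => (f v).2) fun v => ?_).seq
    fun s₅ e₅ ⟨hrow₅, hfh₅⟩ => ?_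
  · rw [e₄.natArr 8 (by decide), e₃.natArr 8 (by decide), e₂.natArr 8 (by decide),
      e₁.natArr 8 (by decide), hfh]
  have hI₅ := hI₄.of_frame e₅ (by decide) (by decide) (by decide) (by decide)
  have c₅ : s₅.natVar 2 = D.k := (e₅.natVar 2 (by decide)).trans c₄
  have t₅ : s₅.natVar 5 = t := by
    rw [e₅.natVar 5 (by decide), e₄.natVar 5 (by decide), e₃.natVar 5 (by decide),
      e₂.natVar 5 (by decide), t₁]
  have hM₅ : ∀ v : Fin m, s₅.natArr 6 D.k v = if v ∈ C then 1 else 0 := fun v => by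
    rw [e₅.natArr 6 (by decide), e₄.natArr 6 (by decide), e₃.natArr 6 (by decide),
      e₂.natArr 6 (by decide), hM₁']
    simp only [Finset.mem_coe]
  have hY₅ : ∀ v : Fin m, s₅.realArr 2 (D.k + 1) v =
      contractReduction π b (D.Y D.k) f C v := fun v => by
    rw [e₅.realArr 2 (by decide), e₄.realArr 2 (by decide), hY₃]
  have hH₅ : HoldsSearch σ H s₅ :=
    ((((hH.of_frame e₁ (by decide) (by decide)).of_frame e₂ (by decide) (by decide)).of_frame e₃
      (by decide) (by decide)).of_frame e₄ (by decide) (by decide)).of_frame e₅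
      (by decide) (by decide)
  refine (runs_mergeCycle hI₅ c₅ t₅ htC hY₅ hM₅ hH₅.best hb).seq
    fun s₆ e₆ ⟨H', hH', hne, hbest⟩ => ?_
  have c₆ : s₆.natVar 2 = D.k := (e₆.natVar 2 (by decide)).trans c₅
  have t₆ : s₆.natVar 5 = t := (e₆.natVar 5 (by decide)).trans t₅
  refine (runs_of_loopFree nextStage s₆ rfl).mono le_rfl ?_
  rintro s₇ e₇ rfl
  have hk : ∀ {j : ℕ}, j ≤ D.k + 1 → j = D.k + 1 ∨ j ≤ D.k ∧ j ≠ D.k + 1 := fun h => by omega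
  have hk' : ∀ {j : ℕ}, j < D.k + 1 → j = D.k ∨ j < D.k ∧ j ≠ D.k := fun h => by omega
  refine ⟨H', ⟨?_, fun j hj v => ?_, fun j hj v => ?_, fun j hj v => ?_, fun j hj v => ?_,
    fun j hj v => ?_, fun j hj => ?_⟩, ⟨fun v => ?_, fun x u => ?_⟩, ?_, hne, hbest⟩
  · simp [nextStage, Program.run, NatExpr.eval, Record.contract, c₆]
  · rw [e₇.natArr 5 (by decide), e₆.natArr 5 (by decide), e₅.natArr 5 (by decide),
      e₄.natArr 5 (by decide), e₃.natArr 5 (by decide)]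
    obtain rfl | ⟨hj, hjk⟩ := hk hj
    · rw [hπ₂]
      simp [Record.contract, π]
    · rw [hrow₂ j hjk, e₁.natArr 5 (by decide), hD.label j hj]
      simp [Record.contract, hjk]
  · rw [e₇.realArr 2 (by decide), e₆.realArr 2 (by decide), e₅.realArr 2 (by decide),
      e₄.realArr 2 (by decide)]
    obtain rfl | ⟨hj, hjk⟩ := hk hj
    · rw [hY₃]
      simp [Record.contract, π, f]
    · rw [hrow₃ j hjk, e₂.realArr 2 (by decide), e₁.realArr 2 (by decide), hD.reduction j hj]
      simp [Record.contract, hjk]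
  · rw [e₇.natArr 7 (by decide), e₆.natArr 7 (by decide), e₅.natArr 7 (by decide)]
    obtain rfl | ⟨hj, hjk⟩ := hk hj
    · rw [hft₄]
      simp [Record.contract, f]
    · rw [hrow₄ j hjk, e₃.natArr 7 (by decide), e₂.natArr 7 (by decide), e₁.natArr 7 (by decide),
        hD.tail j hj]
      simp [Record.contract, hjk]
  · rw [e₇.natArr 8 (by decide), e₆.natArr 8 (by decide)]
    obtain rfl | ⟨hj, hjk⟩ := hk hj
    · rw [hfh₅]
      simp [Record.contract, f]
    · rw [hrow₅ j hjk, e₄.natArr 8 (by decide), e₃.natArr 8 (by decide), e₂.natArr 8 (by decide),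
        e₁.natArr 8 (by decide), hD.head j hj]
      simp [Record.contract, hjk]
  · rw [e₇.natArr 6 (by decide), e₆.natArr 6 (by decide)]
    obtain rfl | ⟨hj, hjk⟩ := hk' hj
    · rw [hM₅]
      simp [Record.contract]
    · rw [e₅.natArr 6 (by decide), e₄.natArr 6 (by decide), e₃.natArr 6 (by decide),
        e₂.natArr 6 (by decide), hrow₁ j hjk, hD.cycle j hj]
      simp [Record.contract, hjk]
  · have h11 : s₆.natArr 11 = s.natArr 11 := by
      rw [e₆.natArr 11 (by decide), e₅.natArr 11 (by decide), e₄.natArr 11 (by decide),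
        e₃.natArr 11 (by decide), e₂.natArr 11 (by decide), e₁.natArr 11 (by decide)]
    obtain rfl | ⟨hj, hjk⟩ := hk' hj
    · simp [nextStage, Program.run, NatExpr.eval, store, c₆, t₆, Record.contract]
    · simp [nextStage, Program.run, NatExpr.eval, store, c₆, h11, Record.contract, hjk,
        hD.name j hj]
  · rw [e₇.natArr 9 (by decide), e₆.natArr 9 (by decide), hH₅.status]
  · rw [e₇.natArr 10 (by decide), hH']
  · simp [nextStage, Program.run, NatExpr.eval, t₆]

end EdmondsProgram

/-! ### The search by the program -/

section EdmondsProgram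

variable {m : ℕ} {G : Digraph (Fin m)} {b : Fin m → Fin m → ℝ} {r : Fin m} {s s' : Memory}

theorem HoldsRecord.of_frame {p : Program} {D : Record m} (h : HoldsRecord D s) (hf : Frame p s s')
    (h2 : 2 ∉ p.natVars) (h5 : 5 ∉ p.natArrs) (h6 : 6 ∉ p.natArrs) (h7 : 7 ∉ p.natArrs)
    (h8 : 8 ∉ p.natArrs) (h11 : 11 ∉ p.natArrs) (hr : 2 ∉ p.realArrs) : HoldsRecord D s' := by
  refine ⟨(hf.natVar 2 h2).trans h.count, ?_, ?_, ?_, ?_, ?_, ?_⟩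
  · rw [hf.natArr 5 h5]; exact h.label
  · rw [hf.realArr 2 hr]; exact h.reduction
  · rw [hf.natArr 7 h7]; exact h.tail
  · rw [hf.natArr 8 h8]; exact h.head
  · rw [hf.natArr 6 h6]; exact h.cycle
  · rw [hf.natArr 11 h11]; exact h.name

/-- Either a new path is started, and the number of unvisited nodes drops, or all nodes are visited. -/
theorem runs_advance {π : Fin m → Fin m} {c : Fin m → Fin m → ℝ} {f : Fin m → Fin m × Fin m}
    {σ : Fin m → ℕ} {H : Fin m → Fin m → Fin m} (hm : s.natVar 0 = m) (hH : HoldsSearch σ H s)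
    (hS : PathClosed G r π c f σ H) :
    Runs advance s (100 * (m + 1)) fun s' => ∃ σ', HoldsSearch σ' H s' ∧
      ((s'.natVar 4 = 1 ∧ ∃ h : Fin m, s'.natVar 3 = h ∧ OnPath G r π c f σ' H h ∧
        (Finset.univ.filter fun v => σ' v = 0).card + 1 ≤
          (Finset.univ.filter fun v => σ v = 0).card) ∨
      (s'.natVar 4 = 0 ∧ ∀ v, σ v ≠ 0)) := by
  have hsb : searchBody.bound ≤ 30 := by decide
  have hfb : finishBody.bound ≤ 30 := by decide
  refine Runs.mono (T := 2 + (m * (searchBody.bound + 9) + 7 + (m * (finishBody.bound + 9) + 7 +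
    (Program.ite (.natEq (.var 4) (.const 1))
      (.putNat 9 (.const 0) (.var 3) (.const 1)) .skip).bound))) ?_
    (by simp [Program.bound, Test.natEq, Test.steps, NatExpr.steps]; nlinarith) fun _ _ h => h
  refine Runs.seq (R := fun s' => s' = { s with natVar := Function.update s.natVar 4 0 })
    ⟨_, _, .setNat s 4 (.const 0), by simp [NatExpr.steps], rfl⟩ ?_
  rintro s₁ - rfl
  refine Runs.seq (R := fun s' => (s'.natVar 4 = 1 ∧ ∃ h : Fin m, s'.natVar 3 = h ∧ σ h = 0) ∨
    (s'.natVar 4 = 0 ∧ ∀ v, σ v ≠ 0)) ?_ ?_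
  · refine (runs_forN_const (fun n s' =>
      (s'.natVar 4 = 1 ∧ ∃ h : Fin m, s'.natVar 3 = h ∧ σ h = 0) ∨
      (s'.natVar 4 = 0 ∧ ∀ v : Fin m, v < n → σ v ≠ 0)) searchBody.bound (by simpa using hm)
      (by decide) (by decide) (by decide) (fun k s v h => by simpa using h) (by simp) ?_).mono
      le_rfl fun s' _ h => h.imp_right fun h => ⟨h.1, fun v => h.2 v v.2⟩
    intro n hn s₂ hf hi hinv
    obtain ⟨x, rfl⟩ : ∃ x : Fin m, (x : ℕ) = n := ⟨⟨n, hn⟩, rfl⟩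
    refine (runs_of_loopFree searchBody s₂ rfl).mono le_rfl ?_
    rintro s₃ - rfl
    have h9 : s₂.natArr 9 0 x = σ x := by
      rw [hf.natArr 9 (by decide)]
      exact hH.status x
    simp only [searchBody, Program.run, Test.holds_natEq, NatExpr.eval, hi, h9]
    by_cases hx : σ x = 0
    · rw [if_pos hx]
      exact Or.inl ⟨by simp, x, by simp, hx⟩
    · rw [if_neg hx]
      refine hinv.imp_right fun ⟨h4, h⟩ => ⟨h4, fun v hv => ?_⟩
      obtain hv | hv := Nat.lt_succ_iff_lt_or_eq.1 hv
      · exact h v hv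
      · rwa [Fin.ext hv]
  intro s₂ e₂ hs₂
  have h9 : s₂.natArr 9 = s.natArr 9 := e₂.natArr 9 (by decide)
  have h10 : s₂.natArr 10 = s.natArr 10 := e₂.natArr 10 (by decide)
  have hm₂ : s₂.natVar 0 = m := (e₂.natVar 0 (by decide)).trans (by simpa using hm)
  refine (runs_fillRow (fun s => s.natArr 9) (fun _ _ => rfl) 0
    (fun v : Fin m => if σ v = 1 then 2 else σ v) hm₂ (by decide) rfl (by decide)
    (by decide) ?_).seq fun s₃ e₃ ⟨hrow, hval⟩ => ?_
  · intro x s₃ hf hi _ hrow a c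
    have h9' : s₃.natArr 9 0 x = σ x := by rw [hrow x le_rfl, h9, hH.status]
    simp only [finishBody, Program.run, Test.holds_natEq, NatExpr.eval, hi, h9']
    by_cases hx : σ x = 1
    · simp only [if_pos hx, store, true_and]
    · simp only [if_neg hx]
      split_ifs with h
      · rw [h.1, h.2, h9']
      · rfl
  have h10₃ : ∀ x u : Fin m, s₃.natArr 10 x u = H x u := fun x u => by
    rw [e₃.natArr 10 (by decide), h10, hH.best]
  have h4₃ : s₃.natVar 4 = s₂.natVar 4 := e₃.natVar 4 (by decide)
  have h3₃ : s₃.natVar 3 = s₂.natVar 3 := e₃.natVar 3 (by decide)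
  refine (runs_of_loopFree _ s₃ rfl).mono le_rfl ?_
  rintro s₄ - rfl
  simp only [Program.run, Test.holds_natEq, NatExpr.eval, h4₃, h3₃]
  obtain ⟨h4, h, h3, hh⟩ | ⟨h4, hall⟩ := hs₂
  · rw [if_pos h4]
    refine ⟨Function.update (fun x => if σ x = 1 then 2 else σ x) h 1, ⟨fun v => ?_, fun x u => ?_⟩,
      Or.inl ⟨h4₃.trans h4, h, h3₃.trans h3, hS.start hh, ?_⟩⟩
    · simp only [store, h3, true_and, hval, Function.update_apply, Fin.ext_iff]
    · simp [store, h10₃]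
    · refine Finset.card_lt_card (Finset.ssubset_iff_of_subset (fun v hv => ?_) |>.2
        ⟨h, by simpa using hh, by simp⟩)
      rw [Finset.mem_filter] at hv ⊢
      refine ⟨hv.1, ?_⟩
      have hv2 := hv.2
      by_cases hvh : v = h
      · rw [hvh, hh]
      · rw [Function.update_of_ne hvh] at hv2
        split_ifs at hv2
        exact hv2
  · rw [if_neg (by omega)]
    exact ⟨_, ⟨hval, h10₃⟩, Or.inr ⟨h4₃.trans h4, hall⟩⟩

/-- The recorded stages are a history of contractions. -/
abbrev Record.Valid (D : Record m) (G : Digraph (Fin m)) (r : Fin m) (b : Fin m → Fin m → ℝ) :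
    Prop :=
  IsHistory G r b D.π D.Y D.f D.C D.z D.k

theorem Record.choose_f_self (D : Record m) (h : Fin m) (a : Fin m × Fin m) :
    (D.choose h a).f D.k = Function.update (D.f D.k) h a :=
  Function.update_self _ _ _

theorem Record.Valid.choose {D : Record m} (hD : D.Valid G r b) (h : Fin m) (a : Fin m × Fin m) :
    (D.choose h a).Valid G r b := by
  have hf : ∀ j < D.k, (D.choose h a).f j = D.f j := fun j hj =>
    Function.update_of_ne hj.ne _ _
  exact { label_zero := hD.label_zero, reduction_zero := hD.reduction_zero, name := hD.name,
          label_succ := hD.label_succ,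
          cheapest := fun j hj => by rw [hf j hj]; exact hD.cheapest j hj
          cycle := fun j hj => by rw [hf j hj]; exact hD.cycle j hj
          reduction_succ := fun j hj => by rw [hf j hj]; exact hD.reduction_succ j hj }

theorem Record.Valid.contract {D : Record m} (hD : D.Valid G r b) {C : Set (Fin m)} {t : Fin m}
    (hC : ∀ x ∈ C, x ≠ D.π D.k r ∧
      CheapestEntering G (D.π D.k) (reducedCost b (D.Y D.k)) x (D.f D.k x))
    (cycle : ∀ x ∈ C, ∀ y, y ∈ C ↔ ∃ n : ℕ, (pred (D.π D.k) (D.f D.k))^[n] x = y) (ht : t ∈ C) :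
    (D.contract b C t).Valid G r b := by
  have hπ : ∀ j ≤ D.k, (D.contract b C t).π j = D.π j := fun j hj =>
    Function.update_of_ne (by omega) _ _
  have hY : ∀ j ≤ D.k, (D.contract b C t).Y j = D.Y j := fun j hj =>
    Function.update_of_ne (by omega) _ _
  have hf : ∀ j ≤ D.k, (D.contract b C t).f j = D.f j := fun j hj =>
    Function.update_of_ne (by omega) _ _
  have hCj : ∀ j < D.k, (D.contract b C t).C j = D.C j := fun j hj =>
    Function.update_of_ne hj.ne _ _
  have hz : ∀ j < D.k, (D.contract b C t).z j = D.z j := fun j hj =>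
    Function.update_of_ne hj.ne _ _
  have hCk : (D.contract b C t).C D.k = C := Function.update_self _ _ _
  have hzk : (D.contract b C t).z D.k = t := Function.update_self _ _ _
  have hcase : ∀ {j}, j < D.k + 1 → j < D.k ∨ j = D.k := fun h => by omega
  refine ⟨by rw [hπ 0 (by omega), hD.label_zero], by rw [hY 0 (by omega), hD.reduction_zero],
    fun j hj => ?_, fun j hj => ?_, fun j hj => ?_, fun j hj => ?_, fun j hj => ?_⟩
  all_goals obtain hj | rfl := hcase hj
  · rw [hCj j hj, hπ j hj.le, hY j hj.le, hf j hj.le]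
    exact hD.cheapest j hj
  · rw [hCk, hπ _ le_rfl, hY _ le_rfl, hf _ le_rfl]
    exact hC
  · rw [hCj j hj, hπ j hj.le, hf j hj.le]
    exact hD.cycle j hj
  · rw [hCk, hπ _ le_rfl, hf _ le_rfl]
    exact cycle
  · rw [hCj j hj, hz j hj]
    exact hD.name j hj
  · rw [hCk, hzk]
    exact ht
  · rw [hCj j hj, hz j hj, hπ j hj.le, hπ (j + 1) hj]
    exact hD.label_succ j hj
  · rw [hCk, hzk, hπ _ le_rfl]
    exact Function.update_self _ _ _
  · rw [hCj j hj, hY j hj.le, hf j hj.le, hπ j hj.le, hY (j + 1) hj]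
    exact hD.reduction_succ j hj
  · rw [hCk, hY _ le_rfl, hf _ le_rfl, hπ _ le_rfl]
    exact Function.update_self _ _ _

/-- The number of supernodes. -/
def Record.size (D : Record m) : ℕ := (Finset.univ.filter fun x => D.π D.k x = x).card

/-- The invariant of the search, with a budget `n` for the remaining time. An extension or the end of
a path lowers the number of unvisited nodes; the contraction of a cycle of `l` supernodes takes time
proportional to `m * l` and lowers the number of supernodes by `l - 1`. -/
def SearchInv (G : Digraph (Fin m)) (b : Fin m → Fin m → ℝ) (r : Fin m) (n : ℕ) (s : Memory) :
    Prop :=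
  ∃ (D : Record m) (σ : Fin m → ℕ) (H : Fin m → Fin m → Fin m), HoldsInput G b r s ∧
    HoldsRecord D s ∧ HoldsSearch σ H s ∧ D.Valid G r b ∧ D.k + D.size ≤ m ∧
    ((s.natVar 4 = 1 ∧ ∃ h : Fin m, s.natVar 3 = h ∧
        OnPath G r (D.π D.k) (reducedCost b (D.Y D.k)) (D.f D.k) σ H h ∧
        800 * (m + 1) * ((Finset.univ.filter fun v => σ v = 0).card + 3 * D.size + 1) ≤ n) ∨
      (s.natVar 4 = 0 ∧ IsOutput G r (D.π D.k) (reducedCost b (D.Y D.k)) (D.f D.k)))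

/-- One round of the search. The budget pays for it: with `l` supernodes on a contracted cycle the
contraction takes at most `500 (m + 1) (l + 1)` steps, and three times the number of supernodes drops
by `3 (l - 1) ≥ l + 1` as `l ≥ 2`. -/
theorem SearchInv.step (hG : StronglyConnected G) {n : ℕ} (hI : SearchInv G b r n s)
    (h4 : s.natVar 4 = 1) :
    ∃ s' T n', Exec (.seq choose (.ite (.natEq (.get 9 (.const 0) (.var 5)) (.const 0))
      (.seq (.putNat 9 (.const 0) (.var 5) (.const 1)) (.setNat 3 (.var 5)))
      (.ite (.natEq (.get 9 (.const 0) (.var 5)) (.const 1)) contractCycle advance))) s s' T ∧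
      SearchInv G b r n' s' ∧ 20 + T + n' ≤ n := by
  classical
  obtain ⟨D, σ, H, hin, hD, hH, hV, hsize, ⟨-, h, h3, hS, hn⟩ | ⟨h0, -⟩⟩ := hI
  swap
  · omega
  obtain ⟨s₁, T₁, ex₁, hT₁, a, ha, h5, hD₁⟩ := runs_choose hG hin hD hH h3 hS
  have e₁ := ex₁.frame
  have hin₁ := hin.of_frame e₁ (by decide) (by decide) (by decide) (by decide)
  have hH₁ := hH.of_frame e₁ (by decide) (by decide)
  have hV₁ := hV.choose h a
  have hst : s₁.natArr 9 0 (D.π D.k a.1) = σ (D.π D.k a.1) := hH₁.status _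
  have htest : ∀ i : ℕ, (Test.natEq (.get 9 (.const 0) (.var 5)) (.const i)).holds s₁ ↔
      σ (D.π D.k a.1) = i := fun i => by
    simp only [Test.holds_natEq, NatExpr.eval, h5, hst]
  have hle := hS.le_two (D.π D.k a.1)
  have hsteps : ∀ i : ℕ, (Test.natEq (.get 9 (.const 0) (.var 5)) (.const i)).steps = 11 :=
    fun i => rfl
  set N := (Finset.univ.filter fun v => σ v = 0).card
  obtain ht | ht | ht : σ (D.π D.k a.1) = 0 ∨ σ (D.π D.k a.1) = 1 ∨ σ (D.π D.k a.1) = 2 := by omega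
  · let p : Program := .seq (.putNat 9 (.const 0) (.var 5) (.const 1)) (.setNat 3 (.var 5))
    obtain ⟨s₂, T₂, ex₂, hT₂, hs₂⟩ := runs_of_loopFree p s₁ rfl
    have e₂ := ex₂.frame
    have hpb : p.bound ≤ 20 := by decide
    have hcard : (Finset.univ.filter fun v => Function.update σ (D.π D.k a.1) 1 v = 0).card + 1 ≤
        N := by
      refine Finset.card_lt_card (Finset.ssubset_iff_of_subset (fun v hv => ?_) |>.2
        ⟨D.π D.k a.1, by simpa using ht, by simp⟩)
      rw [Finset.mem_filter, Function.update_apply] at hv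
      rw [Finset.mem_filter]
      refine ⟨hv.1, ?_⟩
      have hv2 := hv.2
      split_ifs at hv2
      exact hv2
    refine ⟨s₂, _, _, .seq _ _ _ _ _ _ _ ex₁ (.iteTrue _ _ _ _ _ _ ((htest 0).2 ht) ex₂),
      ⟨D.choose h a, Function.update σ (D.π D.k a.1) 1, H,
        hin₁.of_frame e₂ (by decide) (by decide) (by decide) (by decide),
        hD₁.of_frame e₂ (by decide) (by decide) (by decide) (by decide) (by decide) (by decide)
          (by decide), ⟨fun v => ?_, fun x u => ?_⟩, hV₁, hsize,
        Or.inl ⟨?_, D.π D.k a.1, ?_, ?_, le_rfl⟩⟩, ?_⟩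
    · rw [hs₂]
      simp only [p, Program.run, NatExpr.eval, store, h5, hH₁.status, Function.update_apply,
        Fin.ext_iff, true_and]
    · rw [e₂.natArr 10 (by decide), hH₁.best]
    · rw [e₂.natVar 4 (by decide), e₁.natVar 4 (by decide), h4]
    · rw [hs₂]
      simp [p, Program.run, NatExpr.eval, h5]
    · rw [show (D.choose h a).k = D.k from rfl, D.choose_f_self]
      exact hS.extend ha ht
    · rw [hsteps, show (D.choose h a).size = D.size from rfl]
      nlinarith
  · set D₁ := D.choose h a with hD₁def
    let C := (orbit (D.π D.k) (Function.update (D.f D.k) h a) (D.π D.k a.1)).toFinset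
    have hC : (C : Set (Fin m)) =
        orbit (D.π D.k) (Function.update (D.f D.k) h a) (D.π D.k a.1) := Set.coe_toFinset _
    have hfD : D₁.f D₁.k = Function.update (D.f D.k) h a := D.choose_f_self h a
    have hsub := hS.orbit_subset (a := a) ht
    have hcheap := hS.cheapest_orbit ha ht
    have hcyc := hS.isCycle (a := a) ht
    rw [← hC] at hsub hcheap hcyc
    have htC : D.π D.k a.1 ∈ C := by
      rw [← Finset.mem_coe, hC]
      exact mem_orbit_self _
    have hbest : ∀ x ∈ C, ∀ u, BestHead G (contractCost (D₁.π D₁.k) (reducedCost b (D₁.Y D₁.k))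
        (D₁.f D₁.k) C) {v | D₁.π D₁.k v = x} u (H x u) := by
      intro x hx u
      obtain ⟨h1, h2⟩ := hS.best x u (hsub x hx).1
      have hc : ∀ v, D.π D.k v = x → contractCost (D₁.π D₁.k) (reducedCost b (D₁.Y D₁.k))
          (D₁.f D₁.k) C u v = reducedCost b (D.Y D.k) u v -
            reducedCost b (D.Y D.k) (D₁.f D₁.k x).1 (D₁.f D₁.k x).2 := by
        rintro v rfl
        exact if_pos hx
      refine ⟨h1, fun v' hv' hadj => ?_⟩
      rw [hc _ h1, hc _ hv']
      exact ⟨(h2 v' hv' hadj).1, sub_le_sub_right (h2 v' hv' hadj).2 _⟩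
    obtain ⟨s₂, T₂, ex₂, hT₂, H', hD₂, hH₂, h3₂, hne, hbest₂⟩ :=
      runs_contractCycle hin₁ hD₁ hH₁ h5 (C := C) (by rw [hfD]; exact hC) hbest
    have e₂ := ex₂.frame
    have hcard := card_filter_contractMap htC fun x hx => (hsub x hx).1
    have htwo := hS.two_le_card_orbit ha ht hC
    have hsize₂ : (D₁.contract b C (D.π D.k a.1)).size + C.card = D.size + 1 := by
      have : (D₁.contract b C (D.π D.k a.1)).π (D₁.contract b C (D.π D.k a.1)).k =
          contractMap (D.π D.k) C (D.π D.k a.1) := Function.update_self _ _ _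
      rw [Record.size, this]
      exact hcard
    refine ⟨s₂, _, _, .seq _ _ _ _ _ _ _ ex₁ (.iteFalse _ _ _ _ _ _
        (fun h => by have := (htest 0).1 h; omega)
        (.iteTrue _ _ _ _ _ _ ((htest 1).2 ht) ex₂)),
      ⟨D₁.contract b C (D.π D.k a.1), σ, H', ?_, hD₂, hH₂, hV₁.contract ?_ ?_ htC, ?_,
        Or.inl ⟨?_, D.π D.k a.1, h3₂, ?_, le_rfl⟩⟩, ?_⟩
    · exact hin₁.of_frame e₂ (by decide) (by decide) (by decide) (by decide)
    · rw [hfD]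
      exact hcheap
    · rw [hfD]
      exact hcyc
    · have : (D₁.contract b C (D.π D.k a.1)).k = D.k + 1 := rfl
      omega
    · rw [e₂.natVar 4 (by decide), e₁.natVar 4 (by decide), h4]
    · have h1 : (D₁.contract b C (D.π D.k a.1)).k = D.k + 1 := rfl
      have h2 : (D₁.contract b C (D.π D.k a.1)).π (D.k + 1) =
          contractMap (D.π D.k) C (D.π D.k a.1) := Function.update_self _ _ _
      have h3 : (D₁.contract b C (D.π D.k a.1)).Y (D.k + 1) =
          contractReduction (D.π D.k) b (D.Y D.k) (D₁.f D₁.k) C := Function.update_self _ _ _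
      have h4 : (D₁.contract b C (D.π D.k a.1)).f (D.k + 1) = D₁.f D₁.k :=
        Function.update_self _ _ _
      rw [h1, h2, h3, h4, ← contractCost_reducedCost, hfD]
      rw [hfD] at hbest₂
      exact hS.contract ha ht hC hbest₂ hne
    · rw [hsteps, hsteps]
      have h1 : (D₁.contract b C (D.π D.k a.1)).size = D.size + 1 - C.card := by omega
      obtain ⟨l, hl⟩ : ∃ l, C.card = l + 2 := ⟨C.card - 2, by omega⟩
      obtain ⟨q, hq⟩ : ∃ q, D.size = q + l + 1 := ⟨D.size - l - 1, by omega⟩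
      have h2 : (D₁.contract b C (D.π D.k a.1)).size = q := by omega
      rw [h2]
      rw [hl] at hT₂
      rw [hq] at hn
      change _ + 800 * (m + 1) * (N + 3 * q + 1) ≤ n
      nlinarith [Nat.zero_le (m * l)]
  · have hPC := hS.close ha ht
    obtain ⟨s₂, T₂, ex₂, hT₂, σ', hH₂, hcase⟩ := runs_advance hin₁.size hH₁ hPC
    have e₂ := ex₂.frame
    have ex := Exec.seq _ _ _ _ _ _ _ ex₁ (.iteFalse _
        (.seq (.putNat 9 (.const 0) (.var 5) (.const 1)) (.setNat 3 (.var 5))) _ _ _ _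
        (fun h => by have := (htest 0).1 h; omega)
        (.iteFalse _ contractCycle _ _ _ _ (fun h => by have := (htest 1).1 h; omega) ex₂))
    have hfD : (D.choose h a).f (D.choose h a).k = Function.update (D.f D.k) h a :=
      D.choose_f_self h a
    rw [hsteps, hsteps] at ex
    refine ⟨s₂, _, 800 * (m + 1) * (N + 3 * D.size), ex, ⟨D.choose h a, σ', H,
      hin₁.of_frame e₂ (by decide) (by decide) (by decide) (by decide),
      hD₁.of_frame e₂ (by decide) (by decide) (by decide) (by decide) (by decide) (by decide)
        (by decide), hH₂, hV₁, hsize, ?_⟩, ?_⟩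
    · rw [hfD]
      refine hcase.imp (fun ⟨h4', h', h3', hS', hc⟩ => ⟨h4', h', h3', hS', ?_⟩)
        fun ⟨h4', hall⟩ => ⟨h4', hPC.isOutput hall⟩
      rw [show (D.choose h a).size = D.size from rfl]
      have hc' : _ + 1 ≤ N := hc
      exact Nat.mul_le_mul_left _ (by omega)
    · nlinarith

theorem runs_search (hG : StronglyConnected G) {n : ℕ} (hI : SearchInv G b r n s) :
    Runs search s (n + 20) fun s' => ∃ D : Record m, HoldsInput G b r s' ∧ HoldsRecord D s' ∧
      D.Valid G r b ∧ D.k ≤ m ∧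
      IsOutput G r (D.π D.k) (reducedCost b (D.Y D.k)) (D.f D.k) := by
  have hstep : (Test.natEq (.var 4) (.const 1)).steps = 7 := rfl
  refine (runs_while (I := SearchInv G b r) (fun n s hI ht => ?_) hI).mono (by omega) ?_
  · obtain ⟨s', T, n', ex, hI', hn⟩ := hI.step hG (Test.holds_natEq.1 ht)
    exact ⟨s', T, n', ex, hI', by omega⟩
  · rintro s' - ⟨⟨n', D, σ, H, hin, hD, -, hV, hsize, ⟨h4, -⟩ | ⟨-, hout⟩⟩, ht⟩
    · exact absurd ((Test.holds_natEq (e₁ := .var 4) (e₂ := .const 1)).2 h4) ht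
    · exact ⟨D, hin, hD, hV, by omega, hout⟩

end EdmondsProgram

/-! ### Initialization, expansion and the whole algorithm -/

section EdmondsProgram

variable {m : ℕ} {G : Digraph (Fin m)} {b : Fin m → Fin m → ℝ} {r : Fin m} {s s' : Memory}

/-- The record before the first contraction. -/
def Record.initial (m : ℕ) (z : Fin m) : Record m where
  k := 0
  π _ := id
  Y _ _ := 0
  f _ v := (v, v)
  C _ := ∅
  z _ := z

theorem Record.valid_initial (z : Fin m) : (Record.initial m z).Valid G r b where
  label_zero := rfl
  reduction_zero := rfl
  cheapest j hj := absurd hj (Nat.not_lt_zero j)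
  cycle j hj := absurd hj (Nat.not_lt_zero j)
  name j hj := absurd hj (Nat.not_lt_zero j)
  label_succ j hj := absurd hj (Nat.not_lt_zero j)
  reduction_succ j hj := absurd hj (Nat.not_lt_zero j)

theorem pathClosed_initial (c : Fin m → Fin m → ℝ) (f : Fin m → Fin m × Fin m) :
    PathClosed G r id c f (fun v => if v = r then 1 else 0) (fun x _ => x) where
  idem _ := rfl
  root := rfl
  single _ _ := rfl
  le_two v := by split_ifs <;> omega
  best x u _ := ⟨rfl, fun v' (hv' : v' = x) h => by rw [hv'] at h ⊢; exact ⟨h, le_rfl⟩⟩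
  status_root := by simp
  cheapest x _ hx h := absurd (if_neg hx) h
  done x _ h := by
    by_cases hx : x = r
    · rw [hx]
    · exact absurd (if_neg hx) h

theorem runs_setup (hI : HoldsInput G b r s) :
    Runs setup s (200 * (m + 1) ^ 2) fun s' => HoldsRecord (Record.initial m r) s' ∧
      HoldsSearch (fun v => if v = r then 1 else 0) (fun x _ => x) s' := by
  let last : Program := .seq (.putNat 9 (.const 0) (.var 1) (.const 1)) (.setNat 2 (.const 0))
  refine Runs.mono (T := (m * (4 + 9) + 7) + ((m * (4 + 9) + 7) + ((m * (4 + 9) + 7) +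
    ((m * (6 + 9) + 7) + ((m * (4 + 9) + 7) + (m * (m * (1 + 12) + 16) + 7 + 6))))))
    ?_ (by nlinarith) fun _ _ h => h
  have hid : ∀ (A : ℕ) (s : Memory), s.natVar 0 = m →
      Runs (forN 7 (.putNat A (.const 0) (.var 7) (.var 7))) s (m * (4 + 9) + 7) fun s' =>
        ∀ v : Fin m, s'.natArr A 0 v = v := by
    intro A s hm
    refine (runs_fillRow (fun s => s.natArr A) (fun _ _ => rfl) 0 (fun v : Fin m => (v : ℕ)) hm
      (by decide) rfl (by simp [Program.natVars]) (by simp [Program.natVars]) ?_).mono le_rfl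
      fun _ _ h => h.2
    intro x s' _ hi _ _ a c
    simp [Program.run, NatExpr.eval, store, hi]
  refine (hid 5 s hI.size).seq fun s₁ e₁ h5 => ?_
  have hI₁ := hI.of_frame e₁ (by decide) (by decide) (by decide) (by decide)
  refine (hid 7 s₁ hI₁.size).seq fun s₂ e₂ h7 => ?_
  have hI₂ := hI₁.of_frame e₂ (by decide) (by decide) (by decide) (by decide)
  refine (hid 8 s₂ hI₂.size).seq fun s₃ e₃ h8 => ?_
  have hI₃ := hI₂.of_frame e₃ (by decide) (by decide) (by decide) (by decide)
  refine (runs_fillRow (fun s => s.realArr 2) (fun _ _ => rfl) 0 (fun _ : Fin m => (0 : ℝ)) hI₃.size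
    (by decide) rfl (by decide) (by decide) ?_).seq fun s₄ e₄ ⟨_, hY⟩ => ?_
  · intro x s' _ hi _ _ a c
    simp [Program.run, NatExpr.eval, RealExpr.eval, store, hi]
  have hI₄ := hI₃.of_frame e₄ (by decide) (by decide) (by decide) (by decide)
  refine (runs_fillRow (fun s => s.natArr 9) (fun _ _ => rfl) 0 (fun _ : Fin m => 0) hI₄.size
    (by decide) rfl (by decide) (by decide) ?_).seq fun s₅ e₅ ⟨_, h9⟩ => ?_
  · intro x s' _ hi _ _ a c
    simp [Program.run, NatExpr.eval, store, hi]
  have hI₅ := hI₄.of_frame e₅ (by decide) (by decide) (by decide) (by decide)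
  refine (runs_fill 10 (.var 7) (fun a _ => a) hI₅.size fun a c s' _ h _ => h).seq
    fun s₆ e₆ h10 => ?_
  have hI₆ := hI₅.of_frame e₆ (by decide) (by decide) (by decide) (by decide)
  refine (runs_of_loopFree last s₆ rfl).mono le_rfl ?_
  rintro s₇ e₇ rfl
  refine ⟨⟨rfl, fun j hj v => ?_, fun j hj v => ?_, fun j hj v => ?_, fun j hj v => ?_,
    fun j hj => absurd hj (Nat.not_lt_zero j), fun j hj => absurd hj (Nat.not_lt_zero j)⟩,
    fun v => ?_, fun x u => ?_⟩
  · obtain rfl : j = 0 := Nat.le_zero.1 hj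
    rw [e₇.natArr 5 (by decide), e₆.natArr 5 (by decide), e₅.natArr 5 (by decide),
      e₄.natArr 5 (by decide), e₃.natArr 5 (by decide), e₂.natArr 5 (by decide)]
    exact h5 v
  · obtain rfl : j = 0 := Nat.le_zero.1 hj
    rw [e₇.realArr 2 (by decide), e₆.realArr 2 (by decide), e₅.realArr 2 (by decide)]
    exact hY v
  · obtain rfl : j = 0 := Nat.le_zero.1 hj
    rw [e₇.natArr 7 (by decide), e₆.natArr 7 (by decide), e₅.natArr 7 (by decide),
      e₄.natArr 7 (by decide), e₃.natArr 7 (by decide)]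
    exact h7 v
  · obtain rfl : j = 0 := Nat.le_zero.1 hj
    rw [e₇.natArr 8 (by decide), e₆.natArr 8 (by decide), e₅.natArr 8 (by decide),
      e₄.natArr 8 (by decide)]
    exact h8 v
  · have h9' : s₆.natArr 9 0 v = 0 := by rw [e₆.natArr 9 (by decide)]; exact h9 v
    simp [last, Program.run, NatExpr.eval, store, hI₆.root, h9', Fin.ext_iff]
  · rw [e₇.natArr 10 (by decide)]
    exact h10 x u

/-- The first `j` stages of a record. -/
def Record.take (D : Record m) (j : ℕ) : Record m := { D with k := j }

theorem runs_expandRow {A B : ℕ} {D : Record m} {i : ℕ} {g w : Fin m → Fin m}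
    [DecidablePred (· ∈ D.C i)] (hm : s.natVar 0 = m)
    (h2 : s.natVar 2 = i) (hAB : A ≠ 12)
    (hC : ∀ v : Fin m, s.natArr 6 i v = if v ∈ D.C i then 1 else 0)
    (hA : ∀ v : Fin m, s.natArr A i v = g v) (hX : ∀ v : Fin m, s.natArr 12 B v = w v) :
    Runs (forN 7 (expandBody A B)) s (50 * (m + 1)) fun s' =>
      (∀ a, a ≠ B → s'.natArr 12 a = s.natArr 12 a) ∧
      ∀ v : Fin m, s'.natArr 12 B v = ((if v ∈ D.C i then g v else w v : Fin m) : ℕ) := by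
  have hb : (expandBody A B).bound ≤ 30 := by
    simp [expandBody, Program.bound, Test.natEq, Test.steps, NatExpr.steps]
  refine (runs_fillRow (fun s => s.natArr 12) (fun _ _ => rfl) B
    (fun v : Fin m => ((if v ∈ D.C i then g v else w v : Fin m) : ℕ)) hm (by decide) rfl
    (by simp [expandBody, Program.natVars]) (by simp [expandBody, Program.natVars]) ?_).mono
    (by nlinarith) fun _ _ h => h
  intro x s' hf hi _ hrow a c
  have h2' : s'.natVar 2 = i :=
    (hf.natVar 2 (by simp [forN, expandBody, Program.natVars])).trans h2
  have hC' : s'.natArr 6 i x = if x ∈ D.C i then 1 else 0 := by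
    rw [hf.natArr 6 (by simp [forN, expandBody, Program.natArrs]), hC]
  have hA' : s'.natArr A i x = g x := by
    rw [hf.natArr A (by simp [forN, expandBody, Program.natArrs, hAB]), hA]
  have hX' : s'.natArr 12 B x = w x := by rw [hrow x le_rfl, hX]
  simp only [expandBody, Program.run, Test.holds_natEq, NatExpr.eval, h2', hi, hC', hA']
  by_cases hx : x ∈ D.C i
  · simp [hx, store]
  · simp only [hx, if_false, zero_ne_one]
    split_ifs with h
    · rw [h.1, h.2, hX']
    · rfl

/-- The invariant of the expansion, with a budget `n` for the remaining time. -/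
def ExpandInv (G : Digraph (Fin m)) (b : Fin m → Fin m → ℝ) (r : Fin m) (D : Record m) (n : ℕ)
    (s : Memory) : Prop :=
  ∃ (j : ℕ) (X : Fin m → Fin m × Fin m), j ≤ D.k ∧ s.natVar 0 = m ∧ HoldsRecord (D.take j) s ∧
    (∀ v : Fin m, s.natArr 12 0 v = (X v).1) ∧ (∀ v : Fin m, s.natArr 12 1 v = (X v).2) ∧
    IsOutput G r (D.π j) (reducedCost b (D.Y j)) X ∧ 300 * (m + 1) * j ≤ n

theorem ExpandInv.step {D : Record m} (hV : D.Valid G r b) {n : ℕ} (hI : ExpandInv G b r D n s)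
    (h1 : 1 ≤ s.natVar 2) :
    ∃ s' T n', Exec (.seq expandStart (.seq (forN 7 (expandBody 7 0))
      (.seq (forN 7 (expandBody 8 1)) expandEnd))) s s' T ∧ ExpandInv G b r D n' s' ∧
      4 + T + n' ≤ n := by
  classical
  obtain ⟨j, X, hj, hm, hD, hX1, hX2, hout, hn⟩ := hI
  obtain ⟨i, rfl⟩ : ∃ i, j = i + 1 := ⟨j - 1, by have : s.natVar 2 = j := hD.count; omega⟩
  have hik : i < D.k := hj
  set z := D.z i
  set y := D.π i (X z).2
  have hz : s.natArr 11 0 i = z := hD.name i (Nat.lt_succ_self i)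
  have hπ : s.natArr 5 i (X z).2 = y := hD.label i (Nat.le_succ i) _
  have hc : s.natVar 2 = i + 1 := hD.count
  have hsb : expandStart.bound ≤ 40 := by decide
  have heb : expandEnd.bound ≤ 20 := by decide
  have main : Runs (.seq expandStart (.seq (forN 7 (expandBody 7 0))
      (.seq (forN 7 (expandBody 8 1)) expandEnd))) s
      (expandStart.bound + (50 * (m + 1) + (50 * (m + 1) + expandEnd.bound)))
      fun s' => s'.natVar 2 = i ∧
        (∀ v : Fin m, s'.natArr 12 0 v = (expandArcs (D.π i) (D.f i) (D.C i) z X v).1) ∧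
        (∀ v : Fin m, s'.natArr 12 1 v = (expandArcs (D.π i) (D.f i) (D.C i) z X v).2) := by
    refine (runs_of_loopFree expandStart s rfl).seq ?_
    rintro s₁ e₁ hs₁
    have c₁ : s₁.natVar 2 = i := by
      rw [hs₁]
      simp [expandStart, Program.run, NatExpr.eval, hc]
    have v6 : s₁.natVar 6 = (X z).1 := by
      rw [hs₁]
      simp [expandStart, Program.run, NatExpr.eval, hc, hz, hX1]
    have v9 : s₁.natVar 9 = (X z).2 := by
      rw [hs₁]
      simp [expandStart, Program.run, NatExpr.eval, hc, hz, hX2]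
    have v10 : s₁.natVar 10 = y := by
      rw [hs₁]
      simp [expandStart, Program.run, NatExpr.eval, hc, hz, hX2, hπ]
    clear hs₁
    refine (runs_expandRow (A := 7) (B := 0) (D := D) (i := i) (g := fun v => (D.f i v).1)
      (w := fun v => (X v).1) ((e₁.natVar 0 (by decide)).trans hm) c₁ (by decide) (fun v => ?_)
      (fun v => ?_) fun v => ?_).seq fun s₂ e₂ ⟨hr₂, hv₂⟩ => ?_
    · rw [e₁.natArr 6 (by decide)]
      exact (hD.cycle i (Nat.lt_succ_self i) v).trans (if_congr Iff.rfl rfl rfl)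
    · rw [e₁.natArr 7 (by decide)]
      exact hD.tail i (Nat.le_succ i) v
    · rw [e₁.natArr 12 (by decide)]
      exact hX1 v
    have c₂ : s₂.natVar 2 = i := (e₂.natVar 2 (by decide)).trans c₁
    refine (runs_expandRow (A := 8) (B := 1) (D := D) (i := i) (g := fun v => (D.f i v).2)
      (w := fun v => (X v).2) ?_ c₂ (by decide) (fun v => ?_)
      (fun v => ?_) fun v => ?_).seq fun s₃ e₃ ⟨hr₃, hv₃⟩ => ?_
    · rw [e₂.natVar 0 (by decide), e₁.natVar 0 (by decide), hm]
    · rw [e₂.natArr 6 (by decide), e₁.natArr 6 (by decide)]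
      exact (hD.cycle i (Nat.lt_succ_self i) v).trans (if_congr Iff.rfl rfl rfl)
    · rw [e₂.natArr 8 (by decide), e₁.natArr 8 (by decide)]
      exact hD.head i (Nat.le_succ i) v
    · rw [hr₂ 1 (by decide), e₁.natArr 12 (by decide)]
      exact hX2 v
    have w6 : s₃.natVar 6 = (X z).1 := by
      rw [e₃.natVar 6 (by decide), e₂.natVar 6 (by decide), v6]
    have w9 : s₃.natVar 9 = (X z).2 := by
      rw [e₃.natVar 9 (by decide), e₂.natVar 9 (by decide), v9]
    have w10 : s₃.natVar 10 = y := by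
      rw [e₃.natVar 10 (by decide), e₂.natVar 10 (by decide), v10]
    have hv₂' : ∀ v : Fin m, s₃.natArr 12 0 v =
        ((if v ∈ D.C i then (D.f i v).1 else (X v).1 : Fin m) : ℕ) := fun v => by
      rw [hr₃ 0 (by decide), hv₂]
    refine (runs_of_loopFree expandEnd s₃ rfl).mono le_rfl ?_
    rintro s₄ e₄ rfl
    have hya : ∀ v, expandArcs (D.π i) (D.f i) (D.C i) z X v =
        if v = y then X z else if v ∈ D.C i then D.f i v else X v := fun v => by
      unfold expandArcs
      congr
    refine ⟨by rw [e₄.natVar 2 (by decide), e₃.natVar 2 (by decide), c₂], fun v => ?_, fun v => ?_⟩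
    · rw [hya]
      simp only [expandEnd, Program.run, NatExpr.eval, store, w6, w9, w10, hv₂']
      by_cases h1 : v = y <;> by_cases h2 : v ∈ D.C i <;> simp [h1, h2, ← Fin.ext_iff]
    · rw [hya]
      simp only [expandEnd, Program.run, NatExpr.eval, store, w6, w9, w10, hv₃]
      by_cases h1 : v = y <;> by_cases h2 : v ∈ D.C i <;> simp [h1, h2, ← Fin.ext_iff]
  obtain ⟨s', T, ex, hT, hc', hX1', hX2'⟩ := main
  have e := ex.frame
  refine ⟨s', T, 300 * (m + 1) * i, ex, ⟨i, _, hik.le, (e.natVar 0 (by decide)).trans hm, ?_, hX1',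
    hX2', hV.isOutput_expand hik hout, le_rfl⟩, by nlinarith⟩
  refine ⟨hc', fun j hj v => ?_, fun j hj v => ?_, fun j hj v => ?_, fun j hj v => ?_,
    fun j hj v => ?_, fun j hj => ?_⟩
  · rw [e.natArr 5 (by decide)]
    exact hD.label j (Nat.le_succ_of_le hj) v
  · rw [e.realArr 2 (by decide)]
    exact hD.reduction j (Nat.le_succ_of_le hj) v
  · rw [e.natArr 7 (by decide)]
    exact hD.tail j (Nat.le_succ_of_le hj) v
  · rw [e.natArr 8 (by decide)]
    exact hD.head j (Nat.le_succ_of_le hj) v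
  · rw [e.natArr 6 (by decide)]
    exact hD.cycle j (Nat.lt_succ_of_lt hj) v
  · rw [e.natArr 11 (by decide)]
    exact hD.name j (Nat.lt_succ_of_lt hj)

theorem runs_expand {D : Record m} (hV : D.Valid G r b) (hk : D.k ≤ m) (hm : s.natVar 0 = m)
    (hD : HoldsRecord D s) (hout : IsOutput G r (D.π D.k) (reducedCost b (D.Y D.k)) (D.f D.k)) :
    Runs expand s (400 * (m + 1) ^ 2) fun s' => ∃ X : Fin m → Fin m × Fin m,
      IsOutput G r id (reducedCost b fun _ => 0) X ∧ ∀ v : Fin m, s'.natArr 12 0 v = (X v).1 := by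
  have hrow : ∀ (A B : ℕ) (g : Fin m → Fin m) (s : Memory), A ≠ 12 → s.natVar 0 = m →
      s.natVar 2 = D.k → (∀ v : Fin m, s.natArr A D.k v = g v) →
      Runs (forN 7 (.putNat 12 (.const B) (.var 7) (.get A (.var 2) (.var 7)))) s
        (m * (6 + 9) + 7) fun s' => (∀ a, a ≠ B → s'.natArr 12 a = s.natArr 12 a) ∧
          ∀ v : Fin m, s'.natArr 12 B v = g v := by
    intro A B g s hA hm h2 hg
    refine runs_fillRow (p := .putNat 12 (.const B) (.var 7) (.get A (.var 2) (.var 7)))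
      (fun s => s.natArr 12) (fun _ _ => rfl) B (fun v : Fin m => (g v : ℕ)) hm (by decide) rfl
      (by simp [Program.natVars]) (by simp [Program.natVars]) ?_
    intro x s' hf hi _ _ a c
    have h2' : s'.natVar 2 = D.k := (hf.natVar 2 (by simp [forN, Program.natVars])).trans h2
    have hA' : s'.natArr A D.k x = g x := by
      rw [hf.natArr A (by simp [forN, Program.natArrs, hA]), hg]
    simp [Program.run, NatExpr.eval, store, h2', hi, hA']
  have hst : (Test.natLe (.const 1) (.var 2)).steps = 3 := rfl
  refine Runs.mono (T := (m * (6 + 9) + 7) + ((m * (6 + 9) + 7) +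
    (300 * (m + 1) * D.k + 1 + (Test.natLe (.const 1) (.var 2)).steps))) ?_
    (by rw [hst]; nlinarith) fun _ _ h => h
  refine (hrow 7 0 (fun v => (D.f D.k v).1) s (by decide) hm hD.count (hD.tail _ le_rfl)).seq
    fun s₁ e₁ ⟨_, h₁⟩ => ?_
  have hm₁ : s₁.natVar 0 = m := (e₁.natVar 0 (by decide)).trans hm
  have hD₁ := hD.of_frame e₁ (by decide) (by decide) (by decide) (by decide) (by decide)
    (by decide) (by decide)
  refine (hrow 8 1 (fun v => (D.f D.k v).2) s₁ (by decide) hm₁ hD₁.count (hD₁.head _ le_rfl)).seq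
    fun s₂ e₂ ⟨hr₂, h₂⟩ => ?_
  have hm₂ : s₂.natVar 0 = m := (e₂.natVar 0 (by decide)).trans hm₁
  have hD₂ := hD₁.of_frame e₂ (by decide) (by decide) (by decide) (by decide) (by decide)
    (by decide) (by decide)
  have hinv : ExpandInv G b r D (300 * (m + 1) * D.k) s₂ :=
    ⟨D.k, D.f D.k, le_rfl, hm₂, hD₂, fun v => by rw [hr₂ 0 (by decide), h₁], h₂, hout, le_rfl⟩
  refine (runs_while (I := ExpandInv G b r D) (fun n s hI ht => ?_) hinv).mono le_rfl ?_
  · obtain ⟨s', T, n', ex, hI', hn⟩ := hI.step hV ht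
    exact ⟨s', T, n', ex, hI', by rw [hst]; omega⟩
  · rintro s' - ⟨⟨n, j, X, -, -, hD', hX, -, hout', -⟩, ht⟩
    have hj : j = 0 := by
      have h1 : s'.natVar 2 = j := hD'.count
      simp only [Test.holds, NatExpr.eval] at ht
      omega
    subst hj
    rw [hV.label_zero, hV.reduction_zero] at hout'
    exact ⟨X, hout', hX⟩

/-- The arc entering `v` in the output comes from the node in the entry `v` of the row `0` of the
array `12`. -/
theorem runs_edmonds (hG : StronglyConnected G) (hI : HoldsInput G b r s) :
    Runs edmonds s (10000 * (m + 1) ^ 2) fun s' => ∃ X : Fin m → Fin m,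
      EdmondsOut G b r ⟨fun u v => v ≠ r ∧ X v = u⟩ ∧ ∀ v : Fin m, s'.natArr 12 0 v = X v := by
  refine Runs.mono (T := 200 * (m + 1) ^ 2 + (100 * (m + 1) +
    (800 * (m + 1) * (m + 3 * m + 1) + 20 + 400 * (m + 1) ^ 2))) ?_ (by nlinarith) fun _ _ h => h
  refine (runs_setup hI).seq fun s₁ e₁ ⟨hD₁, hH₁⟩ => ?_
  have hI₁ := hI.of_frame e₁ (by decide) (by decide) (by decide) (by decide)
  refine (runs_advance hI₁.size hH₁ (pathClosed_initial (G := G) (r := r) (reducedCost b fun _ => 0)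
    fun v => (v, v))).seq fun s₂ e₂ ⟨σ, hH₂, hcase⟩ => ?_
  have hI₂ := hI₁.of_frame e₂ (by decide) (by decide) (by decide) (by decide)
  have hD₂ := hD₁.of_frame e₂ (by decide) (by decide) (by decide) (by decide) (by decide)
    (by decide) (by decide)
  have hsize : (Record.initial m r).size ≤ m := (Finset.card_le_univ _).trans_eq (by simp)
  have hinv : SearchInv G b r (800 * (m + 1) * (m + 3 * m + 1)) s₂ := by
    refine ⟨Record.initial m r, σ, _, hI₂, hD₂, hH₂, Record.valid_initial r, ?_,
      hcase.imp (fun ⟨h4, h, h3, hS, _⟩ => ⟨h4, h, h3, hS, ?_⟩) fun ⟨h4, hall⟩ => ⟨h4, ?_⟩⟩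
    · exact (Nat.zero_add _).trans_le hsize
    · have : (Finset.univ.filter fun v => σ v = 0).card ≤ m :=
        (Finset.card_le_univ _).trans_eq (by simp)
      exact Nat.mul_le_mul_left _ (by omega)
    · exact (pathClosed_initial _ _).isOutput hall
  refine (runs_search hG hinv).seq fun s₃ e₃ ⟨D, hI₃, hD₃, hV, hk, hout⟩ => ?_
  refine (runs_expand hV hk hI₃.size hD₃ hout).mono le_rfl ?_
  rintro s₄ - ⟨X, hX, hs⟩
  exact ⟨fun v => (X v).1, hX.edmondsOut, hs⟩

end EdmondsProgram

/-! ### The program for both branchings and their union -/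

section BothBranchings

/-- The truth value of `e₁ = e₂` as a number: of the two truncated differences at least one is `0`, and
both are if and only if the values are equal. -/
def eqExpr (e₁ e₂ : NatExpr) : NatExpr := .sub (.const 1) (.add (.sub e₁ e₂) (.sub e₂ e₁))

/-- The truth value of `v ≠ r` and `u` being the tail of the output arc with head `v`. -/
def outputExpr (u v : NatExpr) : NatExpr :=
  .sub (.add (.sub (.const 1) (eqExpr v (.var 1))) (eqExpr (.get 12 (.const 0) v) u)) (.const 1)

/-- Copy the input with the entries addressed by the variables `x` and `y`, run Edmonds' algorithm
and write the output to the natural array `A`. With `x = 7` and `y = 8` this is done for the digraph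
itself, with `x = 8` and `y = 7` for the reversed digraph. -/
def branchingProgram (A x y : ℕ) : Program :=
  .seq (fill 4 (.get 0 (.var x) (.var y))) (.seq (fillReal 1 (.get 0 (.var x) (.var y)))
    (.seq edmonds (fill A (outputExpr (.var x) (.var y)))))

/-- Store the maximum of the `0`-`1` arrays `1` and `2` in the array `3`. -/
def unionProgram : Program :=
  fill 3 (.sub (.const 1) (.sub (.const 1)
    (.add (.get 1 (.var 7) (.var 8)) (.get 2 (.var 7) (.var 8)))))

/-- Run Edmonds' algorithm on the reversed digraph and on the digraph itself, and form the union of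
the results. -/
def branchingsProgram : Program :=
  .seq (branchingProgram 1 8 7) (.seq (branchingProgram 2 7 8) unionProgram)

variable {m : ℕ} {s : Memory}

theorem eval_outputExpr {r x : ℕ} {u v : NatExpr} (h1 : s.natVar 1 = r)
    (hx : s.natArr 12 0 (v.eval s) = x) : (outputExpr u v).eval s =
      if v.eval s ≠ r ∧ x = u.eval s then 1 else 0 := by
  simp only [outputExpr, eqExpr, NatExpr.eval, h1, hx]
  split_ifs with h
  · omega
  · have : v.eval s = r ∨ x ≠ u.eval s := by omega
    omega

open Classical in
theorem runs_branchingProgram {G : Digraph (Fin m)} {b : Fin m → Fin m → ℝ} {r : Fin m}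
    (hG : StronglyConnected G) {A x y : ℕ} (hA : A ≠ 12) (p q : Fin m → Fin m → Fin m)
    (hx : ∀ (s' : Memory) (a c : Fin m), s'.natVar 7 = a → s'.natVar 8 = c → s'.natVar x = p a c)
    (hy : ∀ (s' : Memory) (a c : Fin m), s'.natVar 7 = a → s'.natVar 8 = c → s'.natVar y = q a c)
    (hm : s.natVar 0 = m) (hr : s.natVar 1 = r)
    (hadj : ∀ a c : Fin m, s.natArr 0 (p a c) (q a c) = if G.Adj a c then 1 else 0)
    (hcost : ∀ a c : Fin m, s.realArr 0 (p a c) (q a c) = b a c) :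
    Runs (branchingProgram A x y) s (20000 * (m + 1) ^ 2) fun s' => ∃ X : Fin m → Fin m,
      EdmondsOut G b r ⟨fun u v => v ≠ r ∧ X v = u⟩ ∧
        ∀ a c : Fin m, s'.natArr A a c = if q a c ≠ r ∧ X (q a c) = p a c then 1 else 0 := by
  have hsteps : (outputExpr (.var x) (.var y)).steps = 27 := rfl
  refine Runs.mono (T := (m * (m * (3 + 12) + 16) + 7) + ((m * (m * (3 + 12) + 16) + 7) +
    (10000 * (m + 1) ^ 2 + (m * (m * (27 + 12) + 16) + 7)))) ?_ (by nlinarith) fun _ _ h => h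
  refine (runs_fill 4 _ (fun a c => if G.Adj a c then 1 else 0) hm
    fun a c s' hf ha hc => ?_).seq fun s₁ e₁ h₁ => ?_
  · simp only [NatExpr.eval, hx s' a c ha hc, hy s' a c ha hc,
      hf.natArr 0 (by simp [fill, forN, Program.natArrs]), hadj]
  have hm₁ : s₁.natVar 0 = m := (e₁.natVar 0 (by simp [fill, forN, Program.natVars])).trans hm
  refine (runs_fillReal 1 _ b hm₁ fun a c s' hf ha hc => ?_).seq fun s₂ e₂ h₂ => ?_
  · simp only [RealExpr.eval, NatExpr.eval, hx s' a c ha hc, hy s' a c ha hc,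
      hf.realArr 0 (by simp [fillReal, forN, Program.realArrs]),
      e₁.realArr 0 (by simp [fill, forN, Program.realArrs]), hcost]
  have hr₂ : s₂.natVar 1 = r := by
    rw [e₂.natVar 1 (by simp [fillReal, forN, Program.natVars]),
      e₁.natVar 1 (by simp [fill, forN, Program.natVars]), hr]
  have hI : HoldsInput G b r s₂ :=
    ⟨(e₂.natVar 0 (by simp [fillReal, forN, Program.natVars])).trans hm₁, hr₂, fun u v => by
      rw [e₂.natArr 4 (by simp [fillReal, forN, Program.natArrs]), h₁], h₂⟩
  refine (runs_edmonds hG hI).seq fun s₃ e₃ ⟨X, hout, hX⟩ => ?_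
  have hI₃ := hI.of_frame e₃ (by decide) (by decide) (by decide) (by decide)
  refine (runs_fill A _ (fun a c => if q a c ≠ r ∧ X (q a c) = p a c then 1 else 0) hI₃.size
    fun a c s' hf ha hc => ?_).mono (by rw [hsteps]) fun s' _ h => ⟨X, hout, h⟩
  have hy' : (NatExpr.var y).eval s' = q a c := hy s' a c ha hc
  have hx' : (NatExpr.var x).eval s' = p a c := hx s' a c ha hc
  rw [eval_outputExpr (x := X (q a c))
    ((hf.natVar 1 (by simp [fill, forN, Program.natVars])).trans hI₃.root) (by
      rw [hy', hf.natArr 12 (by simp [fill, forN, Program.natArrs, Ne.symm hA]), hX]), hx', hy']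
  simp only [ne_eq, Fin.ext_iff]

theorem runs_unionProgram {B B' : Digraph (Fin m)} (hm : s.natVar 0 = m) (h1 : Holds s 1 B)
    (h2 : Holds s 2 B') : Runs unionProgram s (100 * (m + 1) ^ 2) fun s' => Holds s' 3 (B ⊔ B') := by
  classical
  refine (runs_fill 3 _ (fun a c => if B.Adj a c ∨ B'.Adj a c then 1 else 0) hm
    fun a c s' hf ha hc => ?_).mono ?_ fun s' _ h a c => ?_
  · simp only [NatExpr.eval, ha, hc, hf.natArr 1 (by decide), hf.natArr 2 (by decide), h1 a c,
      h2 a c]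
    split_ifs <;> simp_all
  · simp only [NatExpr.steps]
    nlinarith
  · rw [h a c]
    congr

theorem runs_branchingsProgram {G : Digraph (Fin m)} (b : Matrix (Fin m) (Fin m) ℝ) (r : Fin m)
    (hG : StronglyConnected G) :
    Runs branchingsProgram (inputMemory G b r) (160400 * m ^ 2) fun s' =>
      ∃ Bin Bout : Digraph (Fin m), EdmondsIn G b r Bin ∧ EdmondsOut G b r Bout ∧
        Holds s' 1 Bin ∧ Holds s' 2 Bout ∧ Holds s' 3 (Bin ⊔ Bout) := by
  classical
  have hm : 1 ≤ m := r.pos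
  have hadj : ∀ a c : Fin m, (inputMemory G b r).natArr 0 a c = if G.Adj a c then 1 else 0 :=
    fun a c => by simp [inputMemory]
  have hcost : ∀ a c : Fin m, (inputMemory G b r).realArr 0 a c = b a c :=
    fun a c => by simp [inputMemory]
  refine Runs.mono (T := 20000 * (m + 1) ^ 2 + (20000 * (m + 1) ^ 2 + 100 * (m + 1) ^ 2)) ?_
    (by nlinarith) fun _ _ h => h
  refine (runs_branchingProgram hG.reverse (b := fun u v => b v u) (by decide) (fun _ c => c)
    (fun a _ => a) (fun _ _ _ _ h => h) (fun _ _ _ h _ => h) rfl rfl (fun a c => hadj c a)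
    fun a c => hcost c a).seq fun s₁ e₁ ⟨X, hX, h₁⟩ => ?_
  have n₁ : s₁.natArr 0 = (inputMemory G b r).natArr 0 := e₁.natArr 0 (by decide)
  have r₁ : s₁.realArr 0 = (inputMemory G b r).realArr 0 := e₁.realArr 0 (by decide)
  have m₁ : s₁.natVar 0 = m := e₁.natVar 0 (by decide)
  refine (runs_branchingProgram hG (b := b) (by decide) (fun a _ => a) (fun _ c => c)
    (fun _ _ _ h _ => h) (fun _ _ _ _ h => h) m₁ (e₁.natVar 1 (by decide)) (fun a c => ?_)
    fun a c => by rw [r₁, hcost]).seq fun s₂ e₂ ⟨X', hX', h₂⟩ => ?_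
  · rw [n₁, hadj]
  have hin : Holds s₂ 1 ⟨fun a c => a ≠ r ∧ X a = c⟩ := fun a c => by
    rw [e₂.natArr 1 (by decide), h₁]
    congr
  have hout : Holds s₂ 2 ⟨fun a c => c ≠ r ∧ X' c = a⟩ := fun a c => by
    rw [h₂]
    congr
  refine (runs_unionProgram ((e₂.natVar 0 (by decide)).trans m₁) hin hout).mono le_rfl
    fun s₃ e₃ h₃ => ⟨⟨fun a c => a ≠ r ∧ X a = c⟩, _, hX, hX', fun a c => ?_, fun a c => ?_, h₃⟩
  · rw [e₃.natArr 1 (by decide)]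
    exact hin a c
  · rw [e₃.natArr 2 (by decide)]
    exact hout a c

end BothBranchings

end SensorNet

/-! ### Networking by the union of two branchings -/

theorem mainTheorem2 :
    -- the networking cost problem is the minimum spanning strong subdigraph problem
    (∀ (m : ℕ) (G : Digraph (Fin m)) (b : Matrix (Fin m) (Fin m) ℝ),
      SensorNet.StronglyConnected G → (∀ i j, G.Adj i j → 0 < b i j) →
        (∃ W, SensorNet.IsOptimal G b W) ∧
        (∀ W, SensorNet.IsOptimal G b W ↔
          (∀ i j, W i j = 0 ∨ W i j = 1) ∧
            SensorNet.IsMinSpanningStrong G b (SensorNet.linkDigraph W)) ∧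
        (∀ H, SensorNet.IsMinSpanningStrong G b H ↔
          SensorNet.IsOptimal G b (SensorNet.linkMatrix H)) ∧
        (∀ H, SensorNet.networkingCost b (SensorNet.linkMatrix H) = SensorNet.cost b H)) ∧
    -- the union of the two branchings is feasible and costs at most twice the optimum
    (∀ (m : ℕ) (G : Digraph (Fin m)) (b : Matrix (Fin m) (Fin m) ℝ) (r : Fin m),
      SensorNet.StronglyConnected G → (∀ i j, G.Adj i j → 0 < b i j) →
        (∀ B, SensorNet.EdmondsIn G b r B → SensorNet.IsMinInBranching G b r B) ∧
        (∀ B, SensorNet.EdmondsOut G b r B → SensorNet.IsMinOutBranching G b r B) ∧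
        (∀ Bin Bout, SensorNet.IsMinInBranching G b r Bin →
          SensorNet.IsMinOutBranching G b r Bout →
            SensorNet.IsFeasible G (SensorNet.linkMatrix (Bin ⊔ Bout)) ∧
            ∀ W, SensorNet.IsOptimal G b W →
              SensorNet.networkingCost b (SensorNet.linkMatrix (Bin ⊔ Bout)) ≤
                2 * SensorNet.networkingCost b W)) ∧
    -- one program runs Edmonds' algorithm twice and forms the union in `O(m ^ 2)` steps
    (∃ (P : SensorNet.Program) (K : ℕ),
      ∀ (m : ℕ) (G : Digraph (Fin m)) (b : Matrix (Fin m) (Fin m) ℝ) (r : Fin m),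
        SensorNet.StronglyConnected G → (∀ i j, G.Adj i j → 0 < b i j) →
          ∃ (s : SensorNet.Memory) (t : ℕ) (Bin Bout : Digraph (Fin m)),
            SensorNet.Exec P (SensorNet.inputMemory G b r) s t ∧ t ≤ K * m ^ 2 ∧
            SensorNet.EdmondsIn G b r Bin ∧ SensorNet.EdmondsOut G b r Bout ∧
            SensorNet.Holds s 1 Bin ∧ SensorNet.Holds s 2 Bout ∧
            SensorNet.Holds s 3 (Bin ⊔ Bout)) ∧
    -- the gap in the worst case is one
    IsLUB SensorNet.gaps 1 := by
  refine ⟨fun m G b hG _ => ⟨SensorNet.exists_isOptimal b hG,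
    fun W => SensorNet.isOptimal_iff, fun H => SensorNet.isOptimal_linkMatrix.symm,
    fun H => SensorNet.networkingCost_linkMatrix b H⟩, fun m G b r _ hb => ⟨?_, ?_, ?_⟩, ?_,
    SensorNet.isLUB_gaps⟩
  · exact fun B hB => hB.isMinInBranching fun u v h => (hb u v h).le
  · exact fun B hB => hB.isMinOutBranching fun u v h => (hb u v h).le
  · intro Bin Bout hin hout
    exact ⟨SensorNet.isFeasible_linkMatrix.2 (SensorNet.isSpanningStrong_sup hin.1 hout.1),
      fun W hW => SensorNet.networkingCost_sup_le (fun u v h => (hb u v h).le) hin hout hW⟩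
  · refine ⟨SensorNet.branchingsProgram, 160400, fun m G b r hG _ => ?_⟩
    obtain ⟨s, t, ex, ht, Bin, Bout, h⟩ := SensorNet.runs_branchingsProgram b r hG
    exact ⟨s, t, Bin, Bout, ex, ht, h⟩
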